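/- Let $n,m\ge 1$ and consider $x_{t+1}=Ax_t+Bu_t+w_t$, $x_0=0$, with observations $\hat x_t=x_t+\eta_t$, where $A\in\mathbb R^{n\times n}$, $B\in\mathbb R^{n\times m}$, and where $u_t\sim\mathcal N(0,\Sigma_u)$, $w_t\sim\mathcal N(0,\Sigma_w)$, $\eta_t\sim\mathcal N(0,\Sigma_\eta)$ ($t\ge 0$) are all mutually independent, $\Sigma_u$ is positive definite, and $\Sigma_w,\Sigma_\eta$ are positive semidefinite. Write $\|\cdot\|$ for the operator norm and $\sigma_k(\cdot)$ for the $k$-th largest singular value. Assume: (i) (stability) there are constants $\psi_A\ge 1$ and $0<\rho_A<1$ with $\|A^t\|\le\psi_A\rho_A^{t-1}$ for all $t\ge 0$; (ii) (controllability) $R=[\,B\ \ AB\ \cdots\ A^{n-1}B\,]$ has full row rank, and $\phi_R:=\sigma_n(R)>0$; (iii) $A$ is invertible, and $\phi_A:=\sigma_n(A)>0$. Let $E=[A\ \ B]$, $\hat z_t=\begin{bmatrix}\hat x_t\\u_t\end{bmatrix}$, $\tilde\imath_t=\begin{bmatrix}\hat x_{t-1}\\u_t\end{bmatrix}$, and let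 the instrumental-variable estimator be $$\hat E_{\mathrm{IV}}=\Big(\sum_{t=1}^{T-1}\hat x_{t+1}\tilde\imath_t^{\top}\Big)\Big(\sum_{t=1}^{T-1}\hat z_t\tilde\imath_t^{\top}\Big)^{-1}.$$ Put $\phi_u=\sigma_m(\Sigma_u)$, $\psi_B=\max\{\|B\|,1\}$, $\psi_u=\max\{\|\Sigma_u\|,1\}$, $\psi_w=\max\{\|\Sigma_w\|,1\}$, $\psi_\eta=\max\{\|\Sigma_\eta\|,1\}$, $\psi=\max\{\psi_B^2\psi_u+\psi_w,\psi_\eta\}$ and, for $\delta\in(0,1)$, $$\kappa_1=\psi_A\max\Big\{\sqrt{\tfrac{\psi}{\phi_u}},\tfrac{\psi}{\phi_u}\Big\}\sqrt{\frac{\min\{\phi_R^2,1\}\phi_u+1}{\min\{\phi_R^6,1\}\phi_u}}\sqrt{\log\Big(\frac{5\psi\psi_A^2}{(1-\rho_A^2)\delta}\,n\log\frac4\delta\Big)},$$ $$\kappa_2=\frac{\psi^2\psi_A^4}{\min\{\phi_R^4,1\}\phi_u^2(1-\rho_A^2)}\log\Big(\frac{9n}{\delta}\Big)\log\Big(9\,\frac{\psi\psi_A^4}{(1-\rho_A^2)\delta}(m+n)\log\frac{9n}{\delta}\Big).$$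 There exist absolute constants $c_1,c_2>0$ (depending on none of the above quantities) such that, for every such system, every $\delta\in(0,1)$ and every $T\in\mathbb N$ with $$T\ \ge\ c_2\,\frac{\kappa_2}{\min\{\phi_A^2,1\}}\,n(m+n)^2,$$ with probability at least $1-11\delta$ the matrix $\sum_{t=1}^{T-1}\hat z_t\tilde\imath_t^{\top}$ is invertible and $$\|\hat E_{\mathrm{IV}}-E\|\ \le\ c_1\,\frac{\kappa_1}{\min\{\phi_A,1\}}\sqrt{\frac{m+n}{T}}.$$ -/

import Mathlib

open MeasureTheory ProbabilityTheory
-- `‖M‖` for a real matrix `M` is the operator norm induced by the Euclidean norms.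
open scoped Matrix Matrix.Norms.L2Operator

namespace NoisyLTI

/-- The `k`-th largest singular value of `M`, counted from `k = 1`
(Mathlib counts singular values from `0`). -/
noncomputable def singVal {ι κ : Type*} [Fintype ι] [Fintype κ] [DecidableEq κ]
    (M : Matrix ι κ ℝ) (k : ℕ) : ℝ :=
  (Matrix.toEuclideanLin M).singularValues (k - 1)

/-- The controllability matrix `[B  AB  ⋯  A^{n-1}B]`; column `(k, j)` is column `j` of `A^k B`. -/
def ctrbMatrix {n m : ℕ} (A : Matrix (Fin n) (Fin n) ℝ) (B : Matrix (Fin n) (Fin m) ℝ) :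
    Matrix (Fin n) (Fin n × Fin m) ℝ :=
  Matrix.of fun i kj => (A ^ (kj.1 : ℕ) * B) i kj.2

/-- `(A, B)` is controllable: the controllability matrix has full row rank. -/
def IsControllable {n m : ℕ} (A : Matrix (Fin n) (Fin n) ℝ) (B : Matrix (Fin n) (Fin m) ℝ) :
    Prop :=
  (ctrbMatrix A B).rank = n

/-- Stability with constants `ψA ≥ 1` and `0 < ρA < 1`: `‖A^t‖ ≤ ψA * ρA^(t-1)` for all `t ≥ 0`
(the exponent is an integer, equal to `-1` at `t = 0`). -/
def IsStableWith {n : ℕ} (A : Matrix (Fin n) (Fin n) ℝ) (ψA ρA : ℝ) : Prop :=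
  1 ≤ ψA ∧ 0 < ρA ∧ ρA < 1 ∧ ∀ t : ℕ, ‖A ^ t‖ ≤ ψA * ρA ^ ((t : ℤ) - 1)

/-- The inputs `u`, process noises `w` and observation noises `η` are i.i.d. sequences with laws
`N(0, Su)`, `N(0, Sw)`, `N(0, Sη)`, and all the vectors `u t`, `w t`, `η t` (`t = 0, 1, 2, …`)
are mutually independent. -/
structure IsGaussianNoise {Ω : Type*} [MeasurableSpace Ω] (P : Measure Ω) {n m : ℕ}
    (Su : Matrix (Fin m) (Fin m) ℝ) (Sw Sη : Matrix (Fin n) (Fin n) ℝ)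
    (u : ℕ → Ω → EuclideanSpace ℝ (Fin m)) (w η : ℕ → Ω → EuclideanSpace ℝ (Fin n)) : Prop where
  law_u : ∀ t, HasLaw (u t) (multivariateGaussian 0 Su) P
  law_w : ∀ t, HasLaw (w t) (multivariateGaussian 0 Sw) P
  law_η : ∀ t, HasLaw (η t) (multivariateGaussian 0 Sη) P
  indep_time : iIndepFun (fun t ω => (u t ω, w t ω, η t ω)) P
  indep_u_wη : ∀ t, IndepFun (u t) (fun ω => (w t ω, η t ω)) P
  indep_w_η : ∀ t, IndepFun (w t) (η t) P

/-- The state trajectory: `x 0 = 0` and `x (t+1) = A x_t + B u_t + w_t`. -/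
noncomputable def state {n m : ℕ} (A : Matrix (Fin n) (Fin n) ℝ) (B : Matrix (Fin n) (Fin m) ℝ)
    (u : ℕ → EuclideanSpace ℝ (Fin m)) (w : ℕ → EuclideanSpace ℝ (Fin n)) :
    ℕ → EuclideanSpace ℝ (Fin n)
  | 0 => 0
  | t + 1 => Matrix.toEuclideanLin A (state A B u w t) + Matrix.toEuclideanLin B (u t) + w t

/-- The observations `x_t + η_t` of the states. -/
noncomputable def obs {n m : ℕ} (A : Matrix (Fin n) (Fin n) ℝ) (B : Matrix (Fin n) (Fin m) ℝ)
    (u : ℕ → EuclideanSpace ℝ (Fin m)) (w η : ℕ → EuclideanSpace ℝ (Fin n)) (t : ℕ) :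
    EuclideanSpace ℝ (Fin n) :=
  state A B u w t + η t

/-- The regressor, the stacked vector `[y_t; u_t]`, where `y` is the sequence of observations. -/
def regressor {n m : ℕ} (y : ℕ → EuclideanSpace ℝ (Fin n)) (u : ℕ → EuclideanSpace ℝ (Fin m))
    (t : ℕ) : Fin n ⊕ Fin m → ℝ :=
  Sum.elim (y t) (u t)

/-- The instrument, the stacked vector `[y_{t-1}; u_t]`; it is used for `t ≥ 1` only. -/
def instrument {n m : ℕ} (y : ℕ → EuclideanSpace ℝ (Fin n)) (u : ℕ → EuclideanSpace ℝ (Fin m))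
    (t : ℕ) : Fin n ⊕ Fin m → ℝ :=
  Sum.elim (y (t - 1)) (u t)

/-- `∑_{t=1}^{T-1} [y_t; u_t] [y_{t-1}; u_t]ᵀ`. -/
noncomputable def ivGram {n m : ℕ} (y : ℕ → EuclideanSpace ℝ (Fin n))
    (u : ℕ → EuclideanSpace ℝ (Fin m)) (T : ℕ) : Matrix (Fin n ⊕ Fin m) (Fin n ⊕ Fin m) ℝ :=
  ∑ t ∈ Finset.Ico 1 T, Matrix.vecMulVec (regressor y u t) (instrument y u t)

/-- The instrumental-variable estimator
`(∑_{t=1}^{T-1} y_{t+1} [y_{t-1}; u_t]ᵀ) (∑_{t=1}^{T-1} [y_t; u_t] [y_{t-1}; u_t]ᵀ)⁻¹`. -/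
noncomputable def ivEstimator {n m : ℕ} (y : ℕ → EuclideanSpace ℝ (Fin n))
    (u : ℕ → EuclideanSpace ℝ (Fin m)) (T : ℕ) : Matrix (Fin n) (Fin n ⊕ Fin m) ℝ :=
  (∑ t ∈ Finset.Ico 1 T, Matrix.vecMulVec (y (t + 1)) (instrument y u t)) * (ivGram y u T)⁻¹

/-- `ψ = max {ψ_B² ψ_u + ψ_w, ψ_η}`, where each `ψ_M` is `max {‖M‖, 1}` for the matrix
`B`, `Su`, `Sw`, `Sη` in question. -/
noncomputable def psi {n m : ℕ} (B : Matrix (Fin n) (Fin m) ℝ) (Su : Matrix (Fin m) (Fin m) ℝ)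
    (Sw Sη : Matrix (Fin n) (Fin n) ℝ) : ℝ :=
  max ((max ‖B‖ 1) ^ 2 * max ‖Su‖ 1 + max ‖Sw‖ 1) (max ‖Sη‖ 1)

/-- The constant in the error bound. -/
noncomputable def kappa₁ (n : ℕ) (δ ψA ρA ψ φu φR : ℝ) : ℝ :=
  ψA * max (√(ψ / φu)) (ψ / φu)
    * √((min (φR ^ 2) 1 * φu + 1) / (min (φR ^ 6) 1 * φu))
    * √(Real.log (5 * ψ * ψA ^ 2 / ((1 - ρA ^ 2) * δ) * n * Real.log (4 / δ)))

/-- The constant in the requirement on the trajectory length. -/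
noncomputable def kappa₂ (n m : ℕ) (δ ψA ρA ψ φu φR : ℝ) : ℝ :=
  ψ ^ 2 * ψA ^ 4 / (min (φR ^ 4) 1 * φu ^ 2 * (1 - ρA ^ 2)) * Real.log (9 * n / δ)
    * Real.log (9 * (ψ * ψA ^ 4 / ((1 - ρA ^ 2) * δ)) * ((m : ℝ) + n) * Real.log (9 * n / δ))

end NoisyLTI

/-! The recursion gives y_{j+2} = E [y_{j+1}; u_{j+1}] + v_j with v_j = w_{j+1} + η_{j+2} - A
η_{j+1}. Hence the estimation error is V M⁻¹, where z_j = [y_j; u_{j+1}] is the instrument, V = ∑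
v_j z_jᵀ and M is the matrix to be inverted. The lag of the instrument makes z_j independent of v_j,
which ordinary least squares on noisy states would not have.

Let s_j = [x_j; u_{j+1}] be the noiseless instrument, D = diag(A, I), and g = ∑ ⟨s_j, θ⟩ s_j for a
vector θ. Expanding M θ gives D g plus five sums of products, each pairing a fresh noise with a
factor known before it. If lam bounds the Gram matrix of the s_j from below and the five sums are
small against lam, then ‖M θ‖ ≥ (φ/2) ‖g‖ with φ = min φ_A 1. Self-normalization bounds ‖V θ‖² by a
multiple of ψ_A² K (∑ ⟨z_j, θ⟩² + lam ‖θ‖²), and this is at most ψ_A² K (3/lam + 2H/lam²) ‖g‖² up to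
that multiple, because ∑ ⟨s_j, θ⟩² ≤ ‖θ‖ ‖g‖ and lam ‖θ‖ ≤ ‖g‖. Measuring both sides by g instead of
θ avoids the condition number of the Gram matrix. With lam and H of order T and K of order n + m up
to logarithms, the rate √((m+n)/T) follows. This deterministic argument is `iv_error_le`.

The probabilistic inputs are these. `measure_selfNormalized_le` is the method of mixtures:
det(Λ)^(-1/2) exp(YᵀΛ⁻¹Y/2) is a supermartingale, and a net over directions makes the bound uniform;
it controls V and the five cross terms. `measure_gram_lower_le` gives the lower bound lam: over a
block of n + 2 times, controllability injects fresh Gaussian variance into every direction, so a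
small-ball estimate holds conditionally on the past, and a net finishes. `measure_sum_norm_sq_gt_le`
bounds total energies, and `measure_empirical_cov_gt_le` gives H. Fourteen events of probability at
most δ/2 each may fail, which leaves 7δ in total. -/

namespace NoisyLTI

/-! ### Rank-one updates of positive definite matrices. -/

section RankOne

variable {κ : Type*} [Fintype κ]

lemma posDef_add_vecMulVec {Λ : Matrix κ κ ℝ} (hΛ : Λ.PosDef) (a : κ → ℝ) :
    (Λ + Matrix.vecMulVec a a).PosDef := by
  have h := Matrix.posSemidef_vecMulVec_self_star (R := ℝ) a
  simp only [star_trivial] at h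
  exact hΛ.add_posSemidef h

variable [DecidableEq κ]

lemma dotProduct_inv_mulVec_nonneg {Λ : Matrix κ κ ℝ} (hΛ : Λ.PosDef) (a : κ → ℝ) :
    0 ≤ a ⬝ᵥ Λ⁻¹ *ᵥ a := by
  simpa using hΛ.inv.posSemidef.dotProduct_mulVec_nonneg a

lemma dotProduct_inv_mulVec_comm {Λ : Matrix κ κ ℝ} (hΛ : Λ.PosDef) (a b : κ → ℝ) :
    a ⬝ᵥ Λ⁻¹ *ᵥ b = b ⬝ᵥ Λ⁻¹ *ᵥ a := by
  have h : (Λ⁻¹)ᵀ = Λ⁻¹ := by simpa using hΛ.inv.isHermitian.eq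
  rw [Matrix.dotProduct_mulVec, ← Matrix.mulVec_transpose, h, dotProduct_comm]

lemma mulVec_inv_mulVec {Λ : Matrix κ κ ℝ} (hΛ : Λ.PosDef) (y : κ → ℝ) :
    Λ *ᵥ (Λ⁻¹ *ᵥ y) = y := by
  rw [Matrix.mulVec_mulVec, Matrix.mul_nonsing_inv _ hΛ.det_pos.ne'.isUnit, Matrix.one_mulVec]

/-- Sherman–Morrison. -/
lemma inv_add_vecMulVec_mulVec {Λ : Matrix κ κ ℝ} (hΛ : Λ.PosDef) (a y : κ → ℝ) :
    (Λ + Matrix.vecMulVec a a)⁻¹ *ᵥ y =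
      Λ⁻¹ *ᵥ y - ((a ⬝ᵥ Λ⁻¹ *ᵥ y) / (1 + a ⬝ᵥ Λ⁻¹ *ᵥ a)) • (Λ⁻¹ *ᵥ a) := by
  have hs := dotProduct_inv_mulVec_nonneg hΛ a
  have h' := posDef_add_vecMulVec hΛ a
  set r := Λ⁻¹ *ᵥ y - ((a ⬝ᵥ Λ⁻¹ *ᵥ y) / (1 + a ⬝ᵥ Λ⁻¹ *ᵥ a)) • (Λ⁻¹ *ᵥ a) with hr
  have key : (Λ + Matrix.vecMulVec a a) *ᵥ r = y := by
    have h1 : Matrix.vecMulVec a a *ᵥ r = (a ⬝ᵥ r) • a := by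
      ext i
      simp [Matrix.vecMulVec, Matrix.mulVec, dotProduct, Finset.sum_mul]
      exact Finset.sum_congr rfl fun _ _ => by ring
    have h2 : a ⬝ᵥ r = (a ⬝ᵥ Λ⁻¹ *ᵥ y) / (1 + a ⬝ᵥ Λ⁻¹ *ᵥ a) := by
      rw [hr, dotProduct_sub, dotProduct_smul, smul_eq_mul]
      field_simp
      ring
    rw [Matrix.add_mulVec, h1, h2, hr, Matrix.mulVec_sub, Matrix.mulVec_smul,
      mulVec_inv_mulVec hΛ, mulVec_inv_mulVec hΛ]
    abel
  conv_lhs => rw [← key]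
  rw [Matrix.mulVec_mulVec, Matrix.nonsing_inv_mul _ h'.det_pos.ne'.isUnit, Matrix.one_mulVec]

/-- Factor Λ + a aᵀ = Λ (1 + (Λ⁻¹ a) aᵀ) and use the matrix determinant lemma for the second factor.
-/
lemma det_add_vecMulVec {Λ : Matrix κ κ ℝ} (hΛ : Λ.PosDef) (a : κ → ℝ) :
    (Λ + Matrix.vecMulVec a a).det = Λ.det * (1 + a ⬝ᵥ Λ⁻¹ *ᵥ a) := by
  have : Λ + Matrix.vecMulVec a a = Λ * (1 + Matrix.vecMulVec (Λ⁻¹ *ᵥ a) a) := by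
    rw [mul_add, mul_one, Matrix.mul_vecMulVec, mulVec_inv_mulVec hΛ]
  rw [this, Matrix.det_mul, Matrix.vecMulVec_eq Unit,
    Matrix.det_one_add_replicateCol_mul_replicateRow]

/-- With s = aᵀΛ⁻¹a, the coefficient of g² is s / (1 + s) < 1, so the exponential of half this form
is integrable against a standard Gaussian g. This drives the one-step estimate of the mixture
supermartingale. -/
lemma quadForm_rankOne_update {Λ : Matrix κ κ ℝ} (hΛ : Λ.PosDef) (a y : κ → ℝ) (g : ℝ) :
    (y + g • a) ⬝ᵥ (Λ + Matrix.vecMulVec a a)⁻¹ *ᵥ (y + g • a) =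
      y ⬝ᵥ Λ⁻¹ *ᵥ y + (2 * g * (a ⬝ᵥ Λ⁻¹ *ᵥ y) + g ^ 2 * (a ⬝ᵥ Λ⁻¹ *ᵥ a)
        - (a ⬝ᵥ Λ⁻¹ *ᵥ y) ^ 2) / (1 + a ⬝ᵥ Λ⁻¹ *ᵥ a) := by
  have hs := dotProduct_inv_mulVec_nonneg hΛ a
  have hc := dotProduct_inv_mulVec_comm hΛ y a
  rw [inv_add_vecMulVec_mulVec hΛ]
  simp only [Matrix.mulVec_add, Matrix.mulVec_smul, dotProduct_add, add_dotProduct,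
    dotProduct_smul, smul_dotProduct, smul_eq_mul, dotProduct_sub, hc]
  field_simp
  ring

/-- Cauchy–Schwarz in the norm of a positive definite matrix. -/
lemma sq_dotProduct_le_of_posDef {Λ : Matrix κ κ ℝ} (hΛ : Λ.PosDef) (y θ : κ → ℝ) :
    (y ⬝ᵥ θ) ^ 2 ≤ (y ⬝ᵥ Λ⁻¹ *ᵥ y) * (θ ⬝ᵥ Λ *ᵥ θ) := by
  have hy := dotProduct_inv_mulVec_nonneg hΛ y
  have hsym : Λᵀ = Λ := by simpa using hΛ.isHermitian.eq
  have hcomm : (Λ⁻¹ *ᵥ y) ⬝ᵥ Λ *ᵥ θ = y ⬝ᵥ θ := by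
    rw [Matrix.dotProduct_mulVec, ← Matrix.mulVec_transpose, hsym, mulVec_inv_mulVec hΛ]
  -- The form of Λ at θ - c Λ⁻¹ y is nonnegative for every c; its discriminant in c is the claim.
  have key : ∀ c : ℝ, 0 ≤ (y ⬝ᵥ Λ⁻¹ *ᵥ y) * (c * c) + (-2 * (y ⬝ᵥ θ)) * c + θ ⬝ᵥ Λ *ᵥ θ := by
    intro c
    have := hΛ.posSemidef.dotProduct_mulVec_nonneg (θ - c • (Λ⁻¹ *ᵥ y))
    simp only [star_trivial, Matrix.mulVec_sub, Matrix.mulVec_smul, dotProduct_sub,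
      sub_dotProduct, smul_dotProduct, dotProduct_smul, smul_eq_mul, hcomm,
      mulVec_inv_mulVec hΛ] at this
    rw [dotProduct_comm θ y, dotProduct_comm (Λ⁻¹ *ᵥ y) y] at this
    linarith
  have := discrim_le_zero key
  unfold discrim at this
  nlinarith

/-- `log det ≤ d log (tr / d)` in exponential-free form, via the tangent of the logarithm. -/
lemma log_det_le {Λ : Matrix κ κ ℝ} (hΛ : Λ.PosDef) {c : ℝ} (hc : 0 < c)
    (htr : Λ.trace ≤ Fintype.card κ * c) :
    Real.log Λ.det ≤ Fintype.card κ * Real.log c := by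
  have hdet := hΛ.isHermitian.det_eq_prod_eigenvalues
  have htr' := hΛ.isHermitian.trace_eq_sum_eigenvalues
  simp only [RCLike.ofReal_real_eq_id, id] at hdet htr'
  have hpos := hΛ.eigenvalues_pos
  rw [hdet, Real.log_prod (fun i _ => (hpos i).ne')]
  have h1 : ∀ i, Real.log (hΛ.isHermitian.eigenvalues i) ≤
      Real.log c + (hΛ.isHermitian.eigenvalues i / c - 1) := by
    intro i
    have := Real.log_le_sub_one_of_pos (div_pos (hpos i) hc)
    rw [Real.log_div (hpos i).ne' hc.ne'] at this
    linarith
  calc _ ≤ ∑ i, (Real.log c + (hΛ.isHermitian.eigenvalues i / c - 1)) :=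
        Finset.sum_le_sum fun i _ => h1 i
    _ = Fintype.card κ * Real.log c + (Λ.trace / c - Fintype.card κ) := by
        rw [htr', Finset.sum_add_distrib, Finset.sum_sub_distrib, Finset.sum_div]
        simp
    _ ≤ _ := by
        have : Λ.trace / c ≤ Fintype.card κ := by rw [div_le_iff₀ hc]; exact htr
        linarith

end RankOne

/-! ### An exponential quadratic moment of a Gaussian. -/

section Gaussian

/-- Completing the square: the tilted density is a constant times that of N(α v', v') with v' = v /
(1 - β v). The case v = 0 has no density and is separate. -/
lemma lintegral_exp_quadratic_gaussianReal (v : NNReal) (α β : ℝ) (h : β * v < 1) :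
    ∫⁻ y, ENNReal.ofReal (Real.exp (α * y + β * y ^ 2 / 2)) ∂(gaussianReal 0 v) =
      ENNReal.ofReal ((√(1 - β * v))⁻¹ * Real.exp (α ^ 2 * v / (2 * (1 - β * v)))) := by
  by_cases hv : v = 0
  · subst hv
    simp
  have hv0 : (0 : ℝ) < v := by positivity
  have h1 : 0 < 1 - β * v := by linarith
  obtain ⟨v', hv'⟩ : ∃ v' : NNReal, (v' : ℝ) = v / (1 - β * v) :=
    ⟨⟨v / (1 - β * v), by positivity⟩, rfl⟩
  have hv'0 : (0 : ℝ) < v' := by rw [hv']; positivity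
  have hv'ne : v' ≠ 0 := by exact_mod_cast hv'0.ne'
  set C := (√(1 - β * v))⁻¹ * Real.exp (α ^ 2 * v / (2 * (1 - β * v))) with hC
  have hC0 : 0 ≤ C := by positivity
  rw [gaussianReal_of_var_ne_zero 0 hv,
    lintegral_withDensity_eq_lintegral_mul _ (measurable_gaussianPDF 0 v) (by fun_prop)]
  have key : ∀ y : ℝ, (gaussianPDF 0 v * fun y => ENNReal.ofReal
      (Real.exp (α * y + β * y ^ 2 / 2))) y =
      ENNReal.ofReal C * ENNReal.ofReal (gaussianPDFReal (α * v') v' y) := by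
    intro y
    rw [Pi.mul_apply, gaussianPDF, ← ENNReal.ofReal_mul (gaussianPDFReal_nonneg _ _ _),
      ← ENNReal.ofReal_mul hC0]
    congr 1
    rw [gaussianPDFReal, gaussianPDFReal, hC]
    have e1 : √(2 * Real.pi * v) = √(1 - β * v) * √(2 * Real.pi * v') := by
      rw [← Real.sqrt_mul h1.le, hv']
      congr 1
      rw [← mul_div_assoc, mul_div_cancel₀ _ h1.ne']
    have e2 : -(y - 0) ^ 2 / (2 * v) + (α * y + β * y ^ 2 / 2) =
        α ^ 2 * v / (2 * (1 - β * v)) + -(y - α * v') ^ 2 / (2 * v') := by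
      have hc : (v : ℝ) = v' * (1 - β * v) := by rw [hv', div_mul_cancel₀ _ h1.ne']
      have h2 : α ^ 2 * v / (2 * (1 - β * v)) = α ^ 2 * v' / 2 := by rw [hv']; field_simp
      have h3 : (1 : ℝ) / v' = 1 / v - β := by
        rw [hv']
        field_simp
      have h4 : -(y - α * v') ^ 2 / (2 * v') = -(y ^ 2 / 2) * (1 / v') + α * y - α ^ 2 * v' / 2 := by
        field_simp
        ring
      rw [h2, h4, h3]
      field_simp
      ring
    rw [e1, mul_inv, mul_assoc, ← Real.exp_add, e2, Real.exp_add]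
    ring
  simp_rw [key]
  rw [lintegral_const_mul _ (by fun_prop), lintegral_gaussianPDFReal_eq_one _ hv'ne, mul_one]

end Gaussian

/-! ### Integrating out an independent variable. -/

section Independence

/-- Integrating out a variable that is independent of a σ-algebra. -/
lemma lintegral_indep_le {Ω 𝒳 : Type*} [MeasurableSpace 𝒳] {𝓕 mΩ : MeasurableSpace Ω}
    {P : Measure Ω} [IsProbabilityMeasure P] (h𝓕 : 𝓕 ≤ mΩ)
    {X : Ω → 𝒳} (hX : Measurable[𝓕] X) {h : Ω → ℝ} (hh : Measurable h)
    (hind : Indep 𝓕 (MeasurableSpace.comap h inferInstance) P)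
    {f : 𝒳 × ℝ → ENNReal} (hf : Measurable f) {G : 𝒳 → ENNReal} (hG : Measurable G)
    (hle : ∀ x, ∫⁻ y, f (x, y) ∂(P.map h) ≤ G x) :
    ∫⁻ ω, f (X ω, h ω) ∂P ≤ ∫⁻ ω, G (X ω) ∂P := by
  have hX' : Measurable X := hX.mono h𝓕 le_rfl
  have hi : IndepFun X h P := by
    rw [IndepFun_iff_Indep]
    exact indep_of_indep_of_le_left hind (measurable_iff_comap_le.1 hX)
  have hmap := (indepFun_iff_map_prod_eq_prod_map_map hX'.aemeasurable hh.aemeasurable).1 hi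
  have : IsProbabilityMeasure (P.map h) := Measure.isProbabilityMeasure_map hh.aemeasurable
  calc ∫⁻ ω, f (X ω, h ω) ∂P = ∫⁻ z, f z ∂(P.map fun ω => (X ω, h ω)) := by
        rw [lintegral_map hf (hX'.prodMk hh)]
    _ = ∫⁻ x, ∫⁻ y, f (x, y) ∂(P.map h) ∂(P.map X) := by
        rw [hmap, lintegral_prod _ hf.aemeasurable]
    _ ≤ ∫⁻ x, G x ∂(P.map X) := lintegral_mono hle
    _ = ∫⁻ ω, G (X ω) ∂P := lintegral_map hG hX'

end Independence

/-! ### Measurability of determinants, inverses and quadratic forms. -/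

section Measurability

variable {Ω κ : Type*} [Fintype κ] [DecidableEq κ] {m : MeasurableSpace Ω}

lemma measurable_matrix_det {M : Ω → Matrix κ κ ℝ} (h : ∀ i j, Measurable fun ω => M ω i j) :
    Measurable fun ω => (M ω).det := by
  simp only [Matrix.det_apply']
  exact Finset.measurable_sum _ fun σ _ =>
    (Finset.measurable_prod _ fun i _ => h _ _).const_mul _

lemma measurable_matrix_inv {M : Ω → Matrix κ κ ℝ} (h : ∀ i j, Measurable fun ω => M ω i j)
    (i j : κ) : Measurable fun ω => (M ω)⁻¹ i j := by
  simp only [Matrix.inv_def, Ring.inverse_eq_inv', Matrix.smul_apply, smul_eq_mul,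
    Matrix.adjugate_apply]
  refine (measurable_matrix_det h).inv.mul (measurable_matrix_det fun k l => ?_)
  by_cases hk : k = j
  · subst hk
    simp
  · simpa [Matrix.updateRow_ne hk] using h k l

lemma measurable_quadForm_inv {M : Ω → Matrix κ κ ℝ} (h : ∀ i j, Measurable fun ω => M ω i j)
    {x y : Ω → κ → ℝ} (hx : Measurable x) (hy : Measurable y) :
    Measurable fun ω => x ω ⬝ᵥ (M ω)⁻¹ *ᵥ y ω := by
  simp only [dotProduct, Matrix.mulVec]
  exact Finset.measurable_sum _ fun i _ => ((measurable_pi_apply i).comp hx).mul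
    (Finset.measurable_sum _ fun j _ => (measurable_matrix_inv h i j).mul
      ((measurable_pi_apply j).comp hy))

end Measurability

/-! ### Self-normalized martingale bound by the method of mixtures. -/

section SelfNormalized

variable {Ω κ : Type*} [DecidableEq κ]

/-- The regularized Gram matrix of the first `N` vectors of a sequence. -/
noncomputable def regGram (lam : ℝ) (a : ℕ → κ → ℝ) (N : ℕ) : Matrix κ κ ℝ :=
  lam • 1 + ∑ t ∈ Finset.range N, Matrix.vecMulVec (a t) (a t)

lemma regGram_succ (lam : ℝ) (a : ℕ → κ → ℝ) (N : ℕ) :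
    regGram lam a (N + 1) = regGram lam a N + Matrix.vecMulVec (a N) (a N) := by
  simp [regGram, Finset.sum_range_succ, add_assoc]

variable [Fintype κ]

lemma posDef_regGram {lam : ℝ} (hlam : 0 < lam) (a : ℕ → κ → ℝ) (N : ℕ) :
    (regGram lam a N).PosDef := by
  induction N with
  | zero => simpa [regGram] using Matrix.PosDef.one.smul hlam
  | succ N ih => rw [regGram_succ]; exact posDef_add_vecMulVec ih _

lemma trace_regGram (lam : ℝ) (a : ℕ → κ → ℝ) (N : ℕ) :
    (regGram lam a N).trace = lam * Fintype.card κ + ∑ t ∈ Finset.range N, a t ⬝ᵥ a t := by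
  simp [regGram, Matrix.trace_add, Matrix.trace_sum, Matrix.trace_vecMulVec]

lemma dotProduct_regGram_mulVec (lam : ℝ) (a : ℕ → κ → ℝ) (N : ℕ) (θ : κ → ℝ) :
    θ ⬝ᵥ regGram lam a N *ᵥ θ = ∑ t ∈ Finset.range N, (a t ⬝ᵥ θ) ^ 2 + lam * (θ ⬝ᵥ θ) := by
  induction N with
  | zero => simp [regGram, Matrix.smul_mulVec, dotProduct_smul]
  | succ N ih =>
    rw [regGram_succ, Matrix.add_mulVec, dotProduct_add, ih, Finset.sum_range_succ,
      Matrix.vecMulVec_mulVec]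
    simp only [op_smul_eq_smul, dotProduct_smul, smul_eq_mul, dotProduct_comm θ (a N)]
    ring

variable {𝓕 : ℕ → MeasurableSpace Ω} {mΩ : MeasurableSpace Ω} {P : Measure Ω}
  [IsProbabilityMeasure P]

/-- The mixture supermartingale in closed form. -/
lemma lintegral_mixture_le (hle : ∀ t, 𝓕 t ≤ mΩ) (hmono : Monotone 𝓕) {h : ℕ → Ω → ℝ}
    (hmeas : ∀ t, Measurable[𝓕 (t + 1)] (h t))
    (hind : ∀ t, Indep (𝓕 t) (MeasurableSpace.comap (h t) inferInstance) P)
    (hlaw : ∀ t, ∃ v : NNReal, HasLaw (h t) (gaussianReal 0 v) P ∧ (v : ℝ) ≤ 1)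
    {a : ℕ → Ω → κ → ℝ} (ha : ∀ t, Measurable[𝓕 t] (a t)) {lam : ℝ} (hlam : 0 < lam) (N : ℕ) :
    ∫⁻ ω, ENNReal.ofReal ((√(regGram lam (fun t => a t ω) N).det)⁻¹ *
      Real.exp (((∑ t ∈ Finset.range N, h t ω • a t ω) ⬝ᵥ (regGram lam (fun t => a t ω) N)⁻¹ *ᵥ
        (∑ t ∈ Finset.range N, h t ω • a t ω)) / 2)) ∂P ≤
      ENNReal.ofReal ((√(lam ^ Fintype.card κ))⁻¹) := by
  have hG : ∀ N, ∀ i j, Measurable[𝓕 N] fun ω => regGram lam (fun t => a t ω) N i j := by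
    intro N i j
    have : ∀ ω, regGram lam (fun t => a t ω) N i j = (lam • (1 : Matrix κ κ ℝ)) i j +
        ∑ t ∈ Finset.range N, a t ω i * a t ω j := by
      intro ω; simp [regGram, Matrix.sum_apply, Matrix.vecMulVec_apply]
    simp_rw [this]
    refine measurable_const.add (Finset.measurable_sum _ fun t ht => ?_)
    have h1 : Measurable[𝓕 N] (a t) :=
      (ha t).mono (hmono (Finset.mem_range.1 ht).le) le_rfl
    exact ((measurable_pi_apply i).comp h1).mul ((measurable_pi_apply j).comp h1)
  have hY : ∀ N, Measurable[𝓕 N] fun ω => ∑ t ∈ Finset.range N, h t ω • a t ω := by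
    intro N
    refine Finset.measurable_sum _ fun t ht => ?_
    have h1 : Measurable[𝓕 N] (a t) :=
      (ha t).mono (hmono (Finset.mem_range.1 ht).le) le_rfl
    have h2 : Measurable[𝓕 N] (h t) :=
      (hmeas t).mono (hmono (Finset.mem_range.1 ht)) le_rfl
    exact h2.smul h1
  induction N with
  | zero => simp [regGram]
  | succ N ih =>
    refine le_trans ?_ ih
    set Λ : Ω → Matrix κ κ ℝ := fun ω => regGram lam (fun t => a t ω) N with hΛ
    set Y : Ω → κ → ℝ := fun ω => ∑ t ∈ Finset.range N, h t ω • a t ω with hYd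
    have hpd : ∀ ω, (Λ ω).PosDef := fun ω => posDef_regGram hlam _ _
    -- The past enters the next step only through three numbers: the current value, p = aᵀΛ⁻¹Y and s
    -- = aᵀΛ⁻¹a.
    let X : Ω → ℝ × ℝ × ℝ := fun ω =>
      ((√(Λ ω).det)⁻¹ * Real.exp ((Y ω ⬝ᵥ (Λ ω)⁻¹ *ᵥ Y ω) / 2), a N ω ⬝ᵥ (Λ ω)⁻¹ *ᵥ Y ω,
        a N ω ⬝ᵥ (Λ ω)⁻¹ *ᵥ a N ω)
    have hX : Measurable[𝓕 N] X := by
      refine Measurable.prodMk (Measurable.mul ?_ ?_) (Measurable.prodMk ?_ ?_)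
      · exact (Real.continuous_sqrt.measurable.comp (measurable_matrix_det (hG N))).inv
      · exact Real.measurable_exp.comp ((measurable_quadForm_inv (hG N) (hY N) (hY N)).div_const 2)
      · exact measurable_quadForm_inv (hG N) (ha N) (hY N)
      · exact measurable_quadForm_inv (hG N) (ha N) (ha N)
    -- The bound is needed at every point of ℝ³, also where s would be negative; the absolute value
    -- changes nothing on the range of X.
    let f : (ℝ × ℝ × ℝ) × ℝ → ENNReal := fun z => ENNReal.ofReal z.1.1 *
      (ENNReal.ofReal ((√(1 + |z.1.2.2|))⁻¹ * Real.exp (-z.1.2.1 ^ 2 / (2 * (1 + |z.1.2.2|)))) *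
       ENNReal.ofReal (Real.exp (z.1.2.1 / (1 + |z.1.2.2|) * z.2 +
         |z.1.2.2| / (1 + |z.1.2.2|) * z.2 ^ 2 / 2)))
    have hf : Measurable f := by fun_prop
    have hh : Measurable (h N) := (hmeas N).mono (hle _) le_rfl
    have main := lintegral_indep_le (G := fun x : ℝ × ℝ × ℝ => ENNReal.ofReal x.1) (hle N) hX hh
      (hind N) hf (by fun_prop) ?_
    · refine le_trans (le_of_eq (lintegral_congr fun ω => ?_)) main
      have hs := dotProduct_inv_mulVec_nonneg (hpd ω) (a N ω)
      simp only [f, X]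
      rw [abs_of_nonneg hs, ← ENNReal.ofReal_mul (by positivity),
        ← ENNReal.ofReal_mul (by positivity)]
      congr 1
      rw [regGram_succ, Finset.sum_range_succ]
      change (√(Λ ω + Matrix.vecMulVec (a N ω) (a N ω)).det)⁻¹ * Real.exp
        (((Y ω + h N ω • a N ω) ⬝ᵥ (Λ ω + Matrix.vecMulVec (a N ω) (a N ω))⁻¹ *ᵥ
          (Y ω + h N ω • a N ω)) / 2) = _
      rw [quadForm_rankOne_update (hpd ω), det_add_vecMulVec (hpd ω),
        Real.sqrt_mul (hpd ω).det_pos.le, mul_inv]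
      have e : ∀ q p s y : ℝ, 0 ≤ s → (q + (2 * y * p + y ^ 2 * s - p ^ 2) / (1 + s)) / 2 =
          q / 2 + (-p ^ 2 / (2 * (1 + s)) + (p / (1 + s) * y + s / (1 + s) * y ^ 2 / 2)) := by
        intro q p s y hs
        field_simp
        ring
      rw [e _ _ _ _ hs, Real.exp_add, Real.exp_add]
      ring
    · rintro ⟨z, p, s⟩
      obtain ⟨v, hv, hv1⟩ := hlaw N
      simp only [f]
      rw [hv.map_eq, lintegral_const_mul _ (by fun_prop), lintegral_const_mul _ (by fun_prop)]
      have hs : 0 ≤ |s| := abs_nonneg s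
      set σ := |s|
      have hv0 : (0 : ℝ) ≤ v := v.2
      have h1 : σ / (1 + σ) * v ≤ σ / (1 + σ) := mul_le_of_le_one_right (by positivity) hv1
      have h2 : 1 - σ / (1 + σ) = 1 / (1 + σ) := by field_simp; ring
      -- For v = 1 the Gaussian integral cancels the prefactor exactly; smaller v only lowers it.
      have h3 : 1 / (1 + σ) ≤ 1 - σ / (1 + σ) * v := by linarith
      have h4 : 0 < 1 / (1 + σ) := by positivity
      rw [lintegral_exp_quadratic_gaussianReal v _ _ (by linarith)]
      refine mul_le_of_le_one_right (by positivity) ?_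
      rw [← ENNReal.ofReal_mul (by positivity), ENNReal.ofReal_le_one]
      have h5 : (√(1 - σ / (1 + σ) * v))⁻¹ ≤ √(1 + σ) := by
        rw [← inv_inv (√(1 + σ))]
        refine inv_anti₀ (by positivity) ?_
        rw [← Real.sqrt_inv, inv_eq_one_div]
        exact Real.sqrt_le_sqrt h3
      have h6 : (p / (1 + σ)) ^ 2 * v / (2 * (1 - σ / (1 + σ) * v)) ≤ p ^ 2 / (2 * (1 + σ)) := by
        rw [div_le_iff₀ (by linarith)]
        calc (p / (1 + σ)) ^ 2 * v ≤ (p / (1 + σ)) ^ 2 := mul_le_of_le_one_right (by positivity) hv1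
          _ = p ^ 2 / (2 * (1 + σ)) * (2 * (1 / (1 + σ))) := by field_simp
          _ ≤ _ := by gcongr
      calc _ ≤ (√(1 + σ))⁻¹ * Real.exp (-p ^ 2 / (2 * (1 + σ))) *
            (√(1 + σ) * Real.exp (p ^ 2 / (2 * (1 + σ)))) := by gcongr
        _ = ((√(1 + σ))⁻¹ * √(1 + σ)) *
            Real.exp (-p ^ 2 / (2 * (1 + σ)) + p ^ 2 / (2 * (1 + σ))) := by
            rw [Real.exp_add]; ring
        _ = 1 := by
            rw [inv_mul_cancel₀ (by positivity), neg_div, neg_add_cancel, Real.exp_zero, one_mul]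

/-- Self-normalized tail bound for a scalar noise sequence. -/
lemma measure_selfNormalized_scalar_le (hle : ∀ t, 𝓕 t ≤ mΩ) (hmono : Monotone 𝓕)
    {h : ℕ → Ω → ℝ} (hmeas : ∀ t, Measurable[𝓕 (t + 1)] (h t))
    (hind : ∀ t, Indep (𝓕 t) (MeasurableSpace.comap (h t) inferInstance) P)
    (hlaw : ∀ t, ∃ v : NNReal, HasLaw (h t) (gaussianReal 0 v) P ∧ (v : ℝ) ≤ 1)
    {a : ℕ → Ω → κ → ℝ} (ha : ∀ t, Measurable[𝓕 t] (a t)) {lam L δ : ℝ} (hlam : 0 < lam)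
    (hL : 0 ≤ L) (hδ : 0 < δ) (hκ : 0 < Fintype.card κ) (N : ℕ) :
    P {ω | ∑ t ∈ Finset.range N, a t ω ⬝ᵥ a t ω ≤ L ∧
      ¬ ∀ θ : κ → ℝ, (∑ t ∈ Finset.range N, h t ω * (a t ω ⬝ᵥ θ)) ^ 2 ≤
        (2 * Real.log (1 / δ) + Fintype.card κ * Real.log (1 + L / (Fintype.card κ * lam))) *
        (∑ t ∈ Finset.range N, (a t ω ⬝ᵥ θ) ^ 2 + lam * (θ ⬝ᵥ θ))} ≤ ENNReal.ofReal δ := by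
  set d : ℝ := ((Fintype.card κ : ℕ) : ℝ) with hd
  have hd0 : 0 < d := by rw [hd]; exact_mod_cast hκ
  set Λ : Ω → Matrix κ κ ℝ := fun ω => regGram lam (fun t => a t ω) N with hΛ
  set Y : Ω → κ → ℝ := fun ω => ∑ t ∈ Finset.range N, h t ω • a t ω with hYd
  have hpd : ∀ ω, (Λ ω).PosDef := fun ω => posDef_regGram hlam _ _
  set F : Ω → ENNReal := fun ω => ENNReal.ofReal ((√(Λ ω).det)⁻¹ *
    Real.exp ((Y ω ⬝ᵥ (Λ ω)⁻¹ *ᵥ Y ω) / 2)) with hF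
  have hFle : ∫⁻ ω, F ω ∂P ≤ ENNReal.ofReal ((√(lam ^ Fintype.card κ))⁻¹) :=
    lintegral_mixture_le hle hmono hmeas hind hlaw ha hlam N
  -- The value of the supermartingale at N = 0. Markov's inequality is applied at level c / δ.
  set c : ℝ := (√(lam ^ Fintype.card κ))⁻¹ with hc
  have hc0 : 0 < c := by positivity
  have hFm : AEMeasurable F P := by
    have ha' : ∀ t, Measurable (a t) := fun t => (ha t).mono (hle t) le_rfl
    have hh' : ∀ t, Measurable (h t) := fun t => (hmeas t).mono (hle _) le_rfl
    have hG : ∀ i j, Measurable fun ω => Λ ω i j := by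
      intro i j
      have : ∀ ω, Λ ω i j = (lam • (1 : Matrix κ κ ℝ)) i j +
          ∑ t ∈ Finset.range N, a t ω i * a t ω j := by
        intro ω; simp [hΛ, regGram, Matrix.sum_apply, Matrix.vecMulVec_apply]
      simp_rw [this]
      fun_prop
    have hY : Measurable Y := Finset.measurable_sum _ fun t _ => (hh' t).smul (ha' t)
    exact (((Real.continuous_sqrt.measurable.comp (measurable_matrix_det hG)).inv.mul
      (Real.measurable_exp.comp
        ((measurable_quadForm_inv hG hY hY).div_const 2))).ennreal_ofReal).aemeasurable
  have hsub : {ω | ∑ t ∈ Finset.range N, a t ω ⬝ᵥ a t ω ≤ L ∧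
      ¬ ∀ θ : κ → ℝ, (∑ t ∈ Finset.range N, h t ω * (a t ω ⬝ᵥ θ)) ^ 2 ≤
        (2 * Real.log (1 / δ) + d * Real.log (1 + L / (d * lam))) *
        (∑ t ∈ Finset.range N, (a t ω ⬝ᵥ θ) ^ 2 + lam * (θ ⬝ᵥ θ))} ⊆
      {ω | ENNReal.ofReal (c / δ) ≤ F ω} := by
    rintro ω ⟨h1, h2⟩
    by_contra hcon
    apply h2
    intro θ
    rw [Set.mem_ofPred_eq, not_le, hF, ENNReal.ofReal_lt_ofReal_iff (by positivity)] at hcon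
    have hdet := (hpd ω).det_pos
    have hlog := Real.log_lt_log (mul_pos (by positivity) (Real.exp_pos _)) hcon
    rw [Real.log_mul (by positivity) (by positivity), Real.log_exp, Real.log_inv,
      Real.log_sqrt hdet.le, Real.log_div hc0.ne' hδ.ne', hc, Real.log_inv,
      Real.log_sqrt (by positivity), Real.log_pow] at hlog
    -- The energy bound L controls the trace, and the trace controls the determinant, so the random
    -- normalization becomes deterministic.
    have hld : Real.log (Λ ω).det ≤ d * Real.log (lam * (1 + L / (d * lam))) := by
      refine log_det_le (hpd ω) (by positivity) ?_
      rw [hΛ, trace_regGram, ← hd]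
      have : d * (lam * (1 + L / (d * lam))) = lam * d + L := by field_simp
      rw [this]
      linarith
    rw [Real.log_mul hlam.ne' (by positivity)] at hld
    have hlogδ : Real.log (1 / δ) = - Real.log δ := by rw [one_div, Real.log_inv]
    have hQ : Y ω ⬝ᵥ (Λ ω)⁻¹ *ᵥ Y ω ≤
        2 * Real.log (1 / δ) + d * Real.log (1 + L / (d * lam)) := by
      rw [hlogδ]
      linarith
    have hYθ : Y ω ⬝ᵥ θ = ∑ t ∈ Finset.range N, h t ω * (a t ω ⬝ᵥ θ) := by
      simp [hYd, sum_dotProduct, smul_dotProduct]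
    rw [← hYθ, ← dotProduct_regGram_mulVec]
    refine (sq_dotProduct_le_of_posDef (hpd ω) _ _).trans ?_
    refine mul_le_mul_of_nonneg_right hQ ?_
    simpa using (hpd ω).posSemidef.dotProduct_mulVec_nonneg θ
  calc _ ≤ P {ω | ENNReal.ofReal (c / δ) ≤ F ω} := measure_mono hsub
    _ ≤ (∫⁻ ω, F ω ∂P) / ENNReal.ofReal (c / δ) :=
        meas_ge_le_lintegral_div hFm (by simpa using div_pos hc0 hδ) ENNReal.ofReal_ne_top
    _ ≤ ENNReal.ofReal c / ENNReal.ofReal (c / δ) := by gcongr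
    _ = ENNReal.ofReal δ := by
        rw [← ENNReal.ofReal_div_of_pos (by positivity)]
        congr 1
        field_simp

end SelfNormalized

/-! ### Nets near the unit sphere. -/

section Net

variable {κ : Type*} [Fintype κ] [DecidableEq κ]

/-- A grid near the unit sphere. -/
lemma exists_finset_net (hκ : 0 < Fintype.card κ) {ε : ℝ} (hε : 0 < ε) (hε1 : ε ≤ 1) :
    ∃ 𝒩 : Finset (EuclideanSpace ℝ κ),
      (𝒩.card : ℝ) ≤ (5 * Fintype.card κ / ε) ^ Fintype.card κ ∧
      (∀ p ∈ 𝒩, 1 - ε ≤ ‖p‖ ∧ ‖p‖ ≤ 1 + ε) ∧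
      ∀ v : EuclideanSpace ℝ κ, ‖v‖ = 1 → ∃ p ∈ 𝒩, ‖v - p‖ ≤ ε := by
  classical
  set d : ℝ := ((Fintype.card κ : ℕ) : ℝ) with hd
  have hd1 : 1 ≤ d := by rw [hd]; exact_mod_cast hκ
  -- Rounding each coordinate down to mesh ε / d gives squared error at most d (ε/d)² ≤ ε². A cubic
  -- grid costs only an extra logarithm of the dimension over an optimal net.
  set s : ℝ := ε / d with hs
  have hs0 : 0 < s := by positivity
  set M : ℤ := ⌈d / ε⌉ with hM
  have hM0 : 0 < M := Int.ceil_pos.2 (by positivity)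
  let grid : Finset (κ → ℤ) := Fintype.piFinset fun _ => Finset.Icc (-M) M
  let pt : (κ → ℤ) → EuclideanSpace ℝ κ := fun z => WithLp.toLp 2 fun i => s * z i
  -- Grid points far from the sphere are dropped, so net points are bounded and nonzero when ε < 1,
  -- without being normalized.
  refine ⟨(grid.image pt).filter fun p => 1 - ε ≤ ‖p‖ ∧ ‖p‖ ≤ 1 + ε, ?_, ?_, ?_⟩
  · have h1 : ((grid.image pt).filter fun p => 1 - ε ≤ ‖p‖ ∧ ‖p‖ ≤ 1 + ε).card ≤ grid.card :=
      (Finset.card_filter_le _ _).trans Finset.card_image_le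
    have h2 : grid.card = (2 * M + 1).toNat ^ Fintype.card κ := by
      simp only [grid, Fintype.card_piFinset, Int.card_Icc, Finset.prod_const, Finset.card_univ]
      congr 2
      ring
    have h3 : (((2 * M + 1).toNat : ℕ) : ℝ) ≤ 5 * d / ε := by
      have : (((2 * M + 1).toNat : ℕ) : ℝ) = 2 * (M : ℝ) + 1 := by
        have : (((2 * M + 1).toNat : ℕ) : ℤ) = 2 * M + 1 := Int.toNat_of_nonneg (by omega)
        exact_mod_cast this
      rw [this]
      have h4 : (M : ℝ) < d / ε + 1 := Int.ceil_lt_add_one _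
      have h5 : 1 ≤ d / ε := by rw [le_div_iff₀ hε]; linarith
      have : 5 * d / ε = 5 * (d / ε) := by ring
      rw [this]
      linarith
    calc _ ≤ (grid.card : ℝ) := by exact_mod_cast h1
      _ = (((2 * M + 1).toNat : ℕ) : ℝ) ^ Fintype.card κ := by rw [h2]; push_cast; rfl
      _ ≤ _ := by gcongr
  · intro p hp
    exact (Finset.mem_filter.1 hp).2
  · intro v hv
    let z : κ → ℤ := fun i => ⌊v i / s⌋
    have hvi : ∀ i, |v i| ≤ 1 := fun i => by
      rw [← hv]; exact PiLp.norm_apply_le v i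
    have hz : z ∈ grid := by
      simp only [grid, Fintype.mem_piFinset, Finset.mem_Icc]
      intro i
      have hb := abs_le.1 (hvi i)
      have h1s : 1 / s = d / ε := by rw [hs]; field_simp
      have hMd : 1 / s ≤ M := h1s ▸ Int.le_ceil _
      constructor
      · rw [Int.le_floor]
        push_cast
        have : -(1 / s) ≤ v i / s := by rw [neg_div', div_le_div_iff_of_pos_right hs0]; exact hb.1
        linarith
      · have h1 : v i / s ≤ 1 / s := by gcongr; exact hb.2
        have : ((⌊v i / s⌋ : ℤ) : ℝ) ≤ M := (Int.floor_le _).trans (h1.trans hMd)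
        exact_mod_cast this
    have hclose : ‖v - pt z‖ ≤ ε := by
      have hi : ∀ i, ‖(v - pt z) i‖ ^ 2 ≤ s ^ 2 := by
        intro i
        simp only [pt, PiLp.sub_apply, Real.norm_eq_abs, sq_abs, z]
        have h1 := Int.floor_le (v i / s)
        have h2 := Int.lt_floor_add_one (v i / s)
        rw [le_div_iff₀ hs0] at h1
        rw [div_lt_iff₀ hs0] at h2
        have h3 : 0 ≤ v i - s * ⌊v i / s⌋ := by linarith
        have h4 : v i - s * ⌊v i / s⌋ ≤ s := by linarith
        gcongr
      have h2 : ‖v - pt z‖ ^ 2 ≤ ε ^ 2 := by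
        rw [EuclideanSpace.norm_sq_eq]
        calc _ ≤ ∑ _i : κ, s ^ 2 := Finset.sum_le_sum fun i _ => hi i
          _ = d * s ^ 2 := by simp [hd]
          _ = ε ^ 2 / d := by rw [hs]; field_simp
          _ ≤ ε ^ 2 := div_le_self (by positivity) hd1
      exact (sq_le_sq₀ (norm_nonneg _) hε.le).1 h2
    refine ⟨pt z, ?_, hclose⟩
    rw [Finset.mem_filter]
    refine ⟨Finset.mem_image_of_mem _ hz, ?_, ?_⟩
    · have := norm_le_norm_add_norm_sub' v (pt z)
      linarith
    · have := norm_le_norm_add_norm_sub' (pt z) v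
      rw [norm_sub_rev] at this
      linarith

/-- Only finiteness matters: it makes the supremum over the sphere in the next lemma a real number.
-/
lemma Seminorm.exists_le_mul_norm (p : Seminorm ℝ (EuclideanSpace ℝ κ)) :
    ∃ C, ∀ v, p v ≤ C * ‖v‖ := by
  refine ⟨∑ i, p (EuclideanSpace.basisFun κ ℝ i), fun v => ?_⟩
  have hv : v = ∑ i, v i • EuclideanSpace.basisFun κ ℝ i := by
    simpa using ((EuclideanSpace.basisFun κ ℝ).sum_repr v).symm
  calc p v = p (∑ i, v i • EuclideanSpace.basisFun κ ℝ i) := by rw [← hv]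
    _ ≤ ∑ i, p (v i • EuclideanSpace.basisFun κ ℝ i) :=
        Finset.le_sum_of_subadditive p (map_zero p).le (map_add_le_add p) _ _
    _ ≤ ∑ i, p (EuclideanSpace.basisFun κ ℝ i) * ‖v‖ := by
        refine Finset.sum_le_sum fun i _ => ?_
        rw [map_smul_eq_mul, mul_comm]
        exact mul_le_mul_of_nonneg_left (PiLp.norm_apply_le v i) (apply_nonneg p _)
    _ = _ := by rw [Finset.sum_mul]

/-- A seminorm bounded on a `1/2`-net of the sphere is bounded. -/
lemma Seminorm.le_two_mul_of_net (p : Seminorm ℝ (EuclideanSpace ℝ κ))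
    {𝒩 : Finset (EuclideanSpace ℝ κ)}
    (hnet : ∀ v : EuclideanSpace ℝ κ, ‖v‖ = 1 → ∃ q ∈ 𝒩, ‖v - q‖ ≤ 1 / 2) {b : ℝ}
    (hp : ∀ q ∈ 𝒩, p q ≤ b) (v : EuclideanSpace ℝ κ) : p v ≤ 2 * b * ‖v‖ := by
  obtain ⟨C, hC⟩ := Seminorm.exists_le_mul_norm p
  have scale : ∀ S : ℝ, (∀ v, ‖v‖ = 1 → p v ≤ S) → ∀ v, p v ≤ S * ‖v‖ := by
    intro S hS v
    by_cases hv : v = 0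
    · simp [hv]
    have hn : ‖v‖ ≠ 0 := norm_ne_zero_iff.2 hv
    have h1 := hS (‖v‖⁻¹ • v) (by rw [norm_smul, norm_inv, norm_norm, inv_mul_cancel₀ hn])
    rw [map_smul_eq_mul, norm_inv, norm_norm, inv_mul_le_iff₀ (by positivity)] at h1
    linarith
  set A : Set ℝ := p '' {v | ‖v‖ = 1} with hA
  have hbdd : BddAbove A := by
    refine ⟨C, ?_⟩
    rintro _ ⟨v, hv, rfl⟩
    have := hC v
    rwa [show ‖v‖ = 1 from hv, mul_one] at this
  have hS : ∀ v, p v ≤ sSup A * ‖v‖ :=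
    scale _ fun v hv => le_csSup hbdd ⟨v, hv, rfl⟩
  refine scale _ (fun v hv => ?_) v
  have hA0 : A.Nonempty := ⟨_, v, hv, rfl⟩
  -- Approximating by a net point bounds the supremum by b plus half of itself.
  have hle : sSup A ≤ b + sSup A * (1 / 2) := by
    refine csSup_le hA0 ?_
    rintro _ ⟨w, hw, rfl⟩
    obtain ⟨q, hq, hwq⟩ := hnet w hw
    have h0 : 0 ≤ sSup A := (apply_nonneg p w).trans (le_csSup hbdd ⟨w, hw, rfl⟩)
    calc p w = p (q + (w - q)) := by rw [add_sub_cancel]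
      _ ≤ p q + p (w - q) := map_add_le_add p _ _
      _ ≤ b + sSup A * (1 / 2) := by
          refine add_le_add (hp q hq) ((hS _).trans ?_)
          gcongr
  have := hS v
  rw [hv, mul_one] at this
  linarith

end Net

/-! ### Noise sequences adapted to a filtration, and the bound uniform in directions. -/

section Innovations

variable {Ω : Type*} {mΩ : MeasurableSpace Ω}

/-- `g` is a centered Gaussian noise sequence, `g t` being independent of `𝓕 t` and known at time
`t + 1`, with covariance at most `s`. -/
structure Innovations (P : Measure Ω) {κ : Type*} [Fintype κ] (𝓕 : ℕ → MeasurableSpace Ω)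
    (g : ℕ → Ω → EuclideanSpace ℝ κ) (s : ℝ) : Prop where
  le : ∀ t, 𝓕 t ≤ mΩ
  mono : Monotone 𝓕
  meas : ∀ t, Measurable[𝓕 (t + 1)] (g t)
  indep : ∀ t, Indep (𝓕 t) (MeasurableSpace.comap (g t) inferInstance) P
  law : ∀ t q, ∃ v : NNReal, HasLaw (fun ω => inner ℝ q (g t ω)) (gaussianReal 0 v) P ∧
    (v : ℝ) ≤ s * ‖q‖ ^ 2

variable {P : Measure Ω} {𝓕 : ℕ → MeasurableSpace Ω}

/-- Lets a noise at time t + k be paired with a factor indexed by t. -/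
lemma Innovations.shift {κ : Type*} [Fintype κ] {g : ℕ → Ω → EuclideanSpace ℝ κ} {s : ℝ}
    (h : Innovations P 𝓕 g s) (k : ℕ) :
    Innovations P (fun t => 𝓕 (t + k)) (fun t => g (t + k)) s where
  le t := h.le _
  mono := fun i j hij => h.mono (by omega)
  meas t := by
    have := h.meas (t + k)
    rwa [show t + k + 1 = t + 1 + k by ring] at this
  indep t := h.indep _
  law t q := h.law _ q

lemma Innovations.measurable_inner {κ : Type*} [Fintype κ] {g : ℕ → Ω → EuclideanSpace ℝ κ} {s : ℝ}
    (h : Innovations P 𝓕 g s) (q : EuclideanSpace ℝ κ) (t : ℕ) :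
    Measurable[𝓕 (t + 1)] fun ω => inner ℝ q (g t ω) := by
  have h1 : Measurable fun x : EuclideanSpace ℝ κ => inner ℝ q x := by fun_prop
  exact h1.comp (h.meas t)

lemma Innovations.indep_inner {κ : Type*} [Fintype κ] {g : ℕ → Ω → EuclideanSpace ℝ κ} {s : ℝ}
    (h : Innovations P 𝓕 g s) (q : EuclideanSpace ℝ κ) (c : ℝ) (t : ℕ) :
    Indep (𝓕 t) (MeasurableSpace.comap (fun ω => c * inner ℝ q (g t ω)) inferInstance) P := by
  have h1 : Measurable fun x : EuclideanSpace ℝ κ => c * inner ℝ q x := by fun_prop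
  refine indep_of_indep_of_le_right (h.indep t) ?_
  rw [show (fun ω => c * inner ℝ q (g t ω)) =
    (fun x : EuclideanSpace ℝ κ => c * inner ℝ q x) ∘ g t from rfl, ← MeasurableSpace.comap_comp]
  exact MeasurableSpace.comap_mono h1.comap_le

/-- Self-normalized tail bound, uniform over the directions of a vector-valued noise. -/
lemma measure_selfNormalized_le [IsProbabilityMeasure P] {ι κ : Type*} [Fintype ι] [DecidableEq ι]
    [Fintype κ] [DecidableEq κ] {g : ℕ → Ω → EuclideanSpace ℝ ι} {s : ℝ}
    (hg : Innovations P 𝓕 g s) (hs : 0 < s)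
    {a : ℕ → Ω → EuclideanSpace ℝ κ} (ha : ∀ t, Measurable[𝓕 t] (a t)) {lam L δ : ℝ}
    (hlam : 0 < lam) (hL : 0 ≤ L) (hδ : 0 < δ) (hδ1 : δ ≤ 1) (hι : 0 < Fintype.card ι)
    (hκ : 0 < Fintype.card κ) (N : ℕ) :
    P {ω | ∑ t ∈ Finset.range N, ‖a t ω‖ ^ 2 ≤ L ∧
      ¬ ∀ (q : EuclideanSpace ℝ ι) (θ : EuclideanSpace ℝ κ),
        (∑ t ∈ Finset.range N, inner ℝ q (g t ω) * inner ℝ (a t ω) θ) ^ 2 ≤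
        9 * s * (2 * Fintype.card ι * Real.log (10 * Fintype.card ι) + 2 * Real.log (1 / δ) +
          Fintype.card κ * Real.log (1 + L / (Fintype.card κ * lam))) * ‖q‖ ^ 2 *
        (∑ t ∈ Finset.range N, (inner ℝ (a t ω) θ) ^ 2 + lam * ‖θ‖ ^ 2)} ≤ ENNReal.ofReal δ := by
  obtain ⟨𝒩, hcard, hnorm, hnet⟩ := exists_finset_net (κ := ι) hι
    (show (0 : ℝ) < 1 / 2 by norm_num) (by norm_num)
  set k : ℝ := ((Fintype.card ι : ℕ) : ℝ) with hk
  set d : ℝ := ((Fintype.card κ : ℕ) : ℝ) with hd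
  have hk1 : 1 ≤ k := by rw [hk]; exact_mod_cast hι
  have hd1 : 1 ≤ d := by rw [hd]; exact_mod_cast hκ
  -- The size bound for a net of mesh 1/2; each net point gets probability δ / c.
  set c : ℝ := (10 * k) ^ Fintype.card ι with hc
  have hc0 : 0 < c := by positivity
  have hcard' : (𝒩.card : ℝ) ≤ c := by
    refine hcard.trans (le_of_eq ?_)
    rw [hc]; congr 1; ring
  set δ' := δ / c with hδ'
  have hδ'0 : 0 < δ' := by positivity
  set ℓ := d * Real.log (1 + L / (d * lam)) with hℓ
  have hℓ0 : 0 ≤ ℓ := by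
    have : 0 ≤ Real.log (1 + L / (d * lam)) := Real.log_nonneg (by
      have : 0 ≤ L / (d * lam) := by positivity
      linarith)
    positivity
  have hlogδ' : Real.log (1 / δ') = k * Real.log (10 * k) + Real.log (1 / δ) := by
    rw [hδ', one_div_div, Real.log_div hc0.ne' hδ.ne', hc, Real.log_pow, one_div, Real.log_inv]
    ring
  set K := 2 * k * Real.log (10 * k) + 2 * Real.log (1 / δ) + ℓ with hK
  have hK0 : 0 ≤ K := by
    have h1 : 0 ≤ Real.log (10 * k) := Real.log_nonneg (by linarith)
    have h2 : 0 ≤ Real.log (1 / δ) := Real.log_nonneg (by rw [le_div_iff₀ hδ]; linarith)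
    positivity
  have hKeq : K = 2 * Real.log (1 / δ') + ℓ := by rw [hK, hlogδ']; ring
  -- Net points have norm at most 3/2, so dividing by (3/2) √s brings the variance of ⟨q, g t⟩ below
  -- 1.
  let bad : EuclideanSpace ℝ ι → Set Ω := fun q =>
    {ω | ∑ t ∈ Finset.range N, (a t ω).ofLp ⬝ᵥ (a t ω).ofLp ≤ L ∧
      ¬ ∀ θ : κ → ℝ, (∑ t ∈ Finset.range N, ((3 / 2 * √s)⁻¹ * inner ℝ q (g t ω)) *
        ((a t ω).ofLp ⬝ᵥ θ)) ^ 2 ≤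
        (2 * Real.log (1 / δ') + Fintype.card κ * Real.log (1 + L / (Fintype.card κ * lam))) *
        (∑ t ∈ Finset.range N, ((a t ω).ofLp ⬝ᵥ θ) ^ 2 + lam * (θ ⬝ᵥ θ))}
  have hbad : ∀ q ∈ 𝒩, P (bad q) ≤ ENNReal.ofReal δ' := by
    intro q hq
    refine measure_selfNormalized_scalar_le hg.le hg.mono (fun t => ?_)
      (fun t => hg.indep_inner q _ t) (fun t => ?_) (fun t => ?_) hlam hL hδ'0 hκ N
    · exact (hg.measurable_inner q t).const_mul _
    · obtain ⟨v, hv, hvs⟩ := hg.law t q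
      have hlaw := gaussianReal_const_mul hv (3 / 2 * √s)⁻¹
      rw [mul_zero] at hlaw
      refine ⟨_, hlaw, ?_⟩
      have h32 := (hnorm q hq).2
      push_cast
      have h4 : (v : ℝ) ≤ s * (3 / 2) ^ 2 := hvs.trans (by gcongr; linarith)
      change ((3 / 2 * √s)⁻¹) ^ 2 * (v : ℝ) ≤ 1
      rw [inv_pow, mul_pow, Real.sq_sqrt hs.le, inv_mul_le_iff₀ (by positivity)]
      linarith
    · exact (WithLp.measurable_ofLp 2 _).comp (ha t)
  have hdot : ∀ (x : EuclideanSpace ℝ κ) (θ : EuclideanSpace ℝ κ),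
      x.ofLp ⬝ᵥ θ.ofLp = inner ℝ x θ := by
    intro x θ
    rw [EuclideanSpace.inner_eq_star_dotProduct, star_trivial, dotProduct_comm]
  calc _ ≤ P (⋃ q ∈ 𝒩, bad q) := by
        refine measure_mono ?_
        rintro ω ⟨h1, h2⟩
        by_contra hcon
        apply h2
        simp only [Set.mem_iUnion, not_exists] at hcon
        have h1' : ∑ t ∈ Finset.range N, (a t ω).ofLp ⬝ᵥ (a t ω).ofLp ≤ L := by
          simpa only [hdot, real_inner_self_eq_norm_sq] using h1
        have hgood : ∀ q ∈ 𝒩, ∀ θ : EuclideanSpace ℝ κ,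
            |∑ t ∈ Finset.range N, inner ℝ q (g t ω) * inner ℝ (a t ω) θ| ≤
            3 / 2 * √s * √(K * (∑ t ∈ Finset.range N, (inner ℝ (a t ω) θ) ^ 2 + lam * ‖θ‖ ^ 2)) := by
          intro q hq θ
          have h3 := not_not.1 (fun h => hcon q hq ⟨h1', h⟩) θ.ofLp
          simp only [hdot, real_inner_self_eq_norm_sq] at h3
          rw [← hd, ← hℓ, ← hKeq] at h3
          have h4 : ∑ t ∈ Finset.range N, (3 / 2 * √s)⁻¹ * inner ℝ q (g t ω) * inner ℝ (a t ω) θ =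
              (3 / 2 * √s)⁻¹ * ∑ t ∈ Finset.range N, inner ℝ q (g t ω) * inner ℝ (a t ω) θ := by
            rw [Finset.mul_sum]
            exact Finset.sum_congr rfl fun _ _ => by ring
          rw [h4] at h3
          have h5 := Real.abs_le_sqrt h3
          have hs' : 0 < 3 / 2 * √s := by positivity
          rw [abs_mul, abs_of_pos (inv_pos.2 hs'), inv_mul_le_iff₀ hs'] at h5
          exact h5
        intro q θ
        set R := ∑ t ∈ Finset.range N, (inner ℝ (a t ω) θ) ^ 2 + lam * ‖θ‖ ^ 2 with hR
        have hR0 : 0 ≤ R := by positivity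
        let lin : EuclideanSpace ℝ ι →ₗ[ℝ] ℝ :=
          ∑ t ∈ Finset.range N, (inner ℝ (a t ω) θ) • (innerSL ℝ (g t ω)).toLinearMap
        have hlin : ∀ q, lin q = ∑ t ∈ Finset.range N, inner ℝ q (g t ω) * inner ℝ (a t ω) θ := by
          intro q
          simp only [lin, LinearMap.sum_apply, LinearMap.smul_apply, smul_eq_mul]
          refine Finset.sum_congr rfl fun t _ => ?_
          change _ * inner ℝ (g t ω) q = _
          rw [real_inner_comm q, mul_comm]
        let p : Seminorm ℝ (EuclideanSpace ℝ ι) := (normSeminorm ℝ ℝ).comp lin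
        have hp : ∀ q, p q = |∑ t ∈ Finset.range N, inner ℝ q (g t ω) * inner ℝ (a t ω) θ| := by
          intro q
          rw [← hlin]
          rfl
        have h6 := Seminorm.le_two_mul_of_net p hnet
          (b := 3 / 2 * √s * √(K * R)) (fun q hq => by
            rw [hp]; exact hgood q hq θ) q
        rw [hp] at h6
        rw [← sq_abs]
        -- The constant 9 is (2 · 3/2)²: a factor 2 from the net and 3/2 from the norm of its
        -- points.
        calc _ ≤ (2 * (3 / 2 * √s * √(K * R)) * ‖q‖) ^ 2 := by gcongr
          _ = 9 * √s ^ 2 * √(K * R) ^ 2 * ‖q‖ ^ 2 := by ring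
          _ = 9 * s * K * ‖q‖ ^ 2 * R := by
              rw [Real.sq_sqrt hs.le, Real.sq_sqrt (by positivity)]; ring
    _ ≤ ∑ q ∈ 𝒩, P (bad q) := measure_biUnion_finset_le _ _
    _ ≤ ∑ _q ∈ 𝒩, ENNReal.ofReal δ' := Finset.sum_le_sum hbad
    _ = ENNReal.ofReal (𝒩.card * δ') := by
        rw [Finset.sum_const, nsmul_eq_mul, ENNReal.ofReal_mul (by positivity),
          ENNReal.ofReal_natCast]
    _ ≤ ENNReal.ofReal δ := by
        refine ENNReal.ofReal_le_ofReal ?_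
        rw [hδ', ← mul_div_assoc, div_le_iff₀ hc0, mul_comm]
        gcongr

end Innovations

/-! ### Chernoff bounds for energies and empirical covariances. -/

section GaussianVectors

variable {Ω : Type*} {mΩ : MeasurableSpace Ω} {P : Measure Ω}

lemma measure_gt_le_of_lintegral_exp_le {X : Ω → ℝ} (hX : AEMeasurable X P) {b δ : ℝ}
    (h : ∫⁻ ω, ENNReal.ofReal (Real.exp (X ω)) ∂P ≤ ENNReal.ofReal (δ * Real.exp b)) :
    P {ω | b ≤ X ω} ≤ ENNReal.ofReal δ := by
  calc P {ω | b ≤ X ω} ≤ P {ω | ENNReal.ofReal (Real.exp b) ≤ ENNReal.ofReal (Real.exp (X ω))} :=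
        measure_mono fun ω hω => ENNReal.ofReal_le_ofReal (Real.exp_le_exp.2 hω)
    _ ≤ (∫⁻ ω, ENNReal.ofReal (Real.exp (X ω)) ∂P) / ENNReal.ofReal (Real.exp b) :=
        meas_ge_le_lintegral_div (Real.measurable_exp.comp_aemeasurable hX).ennreal_ofReal
          (by simpa using Real.exp_pos b) ENNReal.ofReal_ne_top
    _ ≤ ENNReal.ofReal (δ * Real.exp b) / ENNReal.ofReal (Real.exp b) := by gcongr
    _ = ENNReal.ofReal δ := by
        rw [← ENNReal.ofReal_div_of_pos (by positivity), mul_div_cancel_right₀ _ (by positivity)]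

/-- The rate 1/(4s) is chosen so that 1 - βv ≥ 1/2 in the quadratic moment formula. -/
lemma lintegral_exp_sq_gaussianReal_le {v : NNReal} {s : ℝ} (hs : 0 < s) (hv : (v : ℝ) ≤ s) :
    ∫⁻ y, ENNReal.ofReal (Real.exp (y ^ 2 / (4 * s))) ∂(gaussianReal 0 v) ≤
      ENNReal.ofReal (√2) := by
  have h1 : (1 / (2 * s)) * (v : ℝ) ≤ 1 / 2 := by
    rw [div_mul_eq_mul_div, one_mul, div_le_iff₀ (by positivity)]
    linarith
  have h := lintegral_exp_quadratic_gaussianReal v 0 (1 / (2 * s)) (by linarith)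
  calc _ = ∫⁻ y, ENNReal.ofReal (Real.exp (0 * y + 1 / (2 * s) * y ^ 2 / 2))
        ∂(gaussianReal 0 v) := by
        refine lintegral_congr fun y => ?_
        congr 2
        field_simp
        ring
    _ ≤ _ := by
        rw [h]
        refine ENNReal.ofReal_le_ofReal ?_
        have h2 : √(2⁻¹ : ℝ) ≤ √(1 - 1 / (2 * s) * v) := Real.sqrt_le_sqrt (by linarith)
        calc _ = (√(1 - 1 / (2 * s) * v))⁻¹ := by simp
          _ ≤ (√(2⁻¹ : ℝ))⁻¹ := by gcongr
          _ = √2 := by rw [Real.sqrt_inv, inv_inv]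

/-- Upper tail of a sum of squares of (possibly dependent) centered Gaussian variables. -/
lemma measure_sum_sq_gt_le {ι : Type*} {I : Finset ι} (hI : I.Nonempty) {X : ι → Ω → ℝ} {s δ : ℝ}
    (hs : 0 < s) (hδ : 0 < δ)
    (hX : ∀ i, ∃ v : NNReal, HasLaw (X i) (gaussianReal 0 v) P ∧ (v : ℝ) ≤ s) :
    P {ω | I.card * s * (4 * Real.log (2 / δ)) ≤ ∑ i ∈ I, X i ω ^ 2} ≤ ENNReal.ofReal δ := by
  have hc : (0 : ℝ) < I.card := by exact_mod_cast hI.card_pos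
  have hXm : ∀ i, AEMeasurable (X i) P := fun i => by
    obtain ⟨v, hv, -⟩ := hX i
    exact hv.aemeasurable
  have hmeas : AEMeasurable (fun ω => ∑ i ∈ I, (I.card : ℝ)⁻¹ * (X i ω ^ 2 / (4 * s))) P :=
    Finset.aemeasurable_fun_sum _ fun i _ => (((hXm i).pow_const 2).div_const _).const_mul _
  refine le_trans (measure_mono ?_) (measure_gt_le_of_lintegral_exp_le (b := Real.log (2 / δ))
    hmeas ?_)
  · intro ω hω
    have h1 : ∑ i ∈ I, (I.card : ℝ)⁻¹ * (X i ω ^ 2 / (4 * s)) =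
        (∑ i ∈ I, X i ω ^ 2) / (I.card * s * 4) := by
      rw [Finset.sum_div]
      refine Finset.sum_congr rfl fun i _ => ?_
      field_simp
    change _ ≤ ∑ i ∈ I, (I.card : ℝ)⁻¹ * (X i ω ^ 2 / (4 * s))
    rw [h1, le_div_iff₀ (by positivity)]
    have : (I.card : ℝ) * s * (4 * Real.log (2 / δ)) ≤ ∑ i ∈ I, X i ω ^ 2 := hω
    linarith
  · rw [Real.exp_log (by positivity), mul_div_cancel₀ _ hδ.ne']
    calc _ ≤ ∫⁻ ω, ∑ i ∈ I, ENNReal.ofReal ((I.card : ℝ)⁻¹) *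
          ENNReal.ofReal (Real.exp (X i ω ^ 2 / (4 * s))) ∂P := by
          refine lintegral_mono fun ω => ?_
          -- Jensen with uniform weights replaces the exponential of the average by an average of
          -- exponentials, so no independence is needed.
          have hj := convexOn_exp.map_sum_le (t := I) (w := fun _ => (I.card : ℝ)⁻¹)
            (p := fun i => X i ω ^ 2 / (4 * s)) (fun _ _ => by positivity)
            (by rw [Finset.sum_const, nsmul_eq_mul, mul_inv_cancel₀ hc.ne'])
            (fun _ _ => Set.mem_univ _)
          simp only [smul_eq_mul] at hj
          refine (ENNReal.ofReal_le_ofReal hj).trans (le_of_eq ?_)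
          rw [ENNReal.ofReal_sum_of_nonneg fun _ _ => by positivity]
          exact Finset.sum_congr rfl fun i _ => ENNReal.ofReal_mul (by positivity)
      _ = ∑ i ∈ I, ENNReal.ofReal ((I.card : ℝ)⁻¹) *
          ∫⁻ ω, ENNReal.ofReal (Real.exp (X i ω ^ 2 / (4 * s))) ∂P := by
          have hm : ∀ i, AEMeasurable (fun ω => ENNReal.ofReal (Real.exp (X i ω ^ 2 / (4 * s)))) P :=
            fun i => (Real.measurable_exp.comp_aemeasurable
              (((hXm i).pow_const 2).div_const _)).ennreal_ofReal
          rw [lintegral_finsetSum' _ fun i _ => (hm i).const_mul _]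
          exact Finset.sum_congr rfl fun i _ => lintegral_const_mul'' _ (hm i)
      _ ≤ ∑ i ∈ I, ENNReal.ofReal ((I.card : ℝ)⁻¹) * ENNReal.ofReal 2 := by
          refine Finset.sum_le_sum fun i _ => ?_
          gcongr
          obtain ⟨v, hv, hvs⟩ := hX i
          have h1 := hv.lintegral_comp
            (f := fun y => ENNReal.ofReal (Real.exp (y ^ 2 / (4 * s)))) (by fun_prop)
          refine (le_of_eq h1).trans ((lintegral_exp_sq_gaussianReal_le hs hvs).trans
            (ENNReal.ofReal_le_ofReal ?_))
          rw [Real.sqrt_le_left (by norm_num)]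
          norm_num
      _ = ENNReal.ofReal 2 := by
          rw [Finset.sum_const, nsmul_eq_mul, ← mul_assoc, ← ENNReal.ofReal_natCast,
            ← ENNReal.ofReal_mul hc.le, mul_inv_cancel₀ hc.ne', ENNReal.ofReal_one, one_mul]

/-- `X` is a centered Gaussian vector with covariance at most `s`. -/
def IsGaussianVec (P : Measure Ω) {κ : Type*} [Fintype κ] (X : Ω → EuclideanSpace ℝ κ) (s : ℝ) :
    Prop :=
  ∀ q, ∃ v : NNReal, HasLaw (fun ω => inner ℝ q (X ω)) (gaussianReal 0 v) P ∧
    (v : ℝ) ≤ s * ‖q‖ ^ 2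

lemma IsGaussianVec.mono {κ : Type*} [Fintype κ] {X : Ω → EuclideanSpace ℝ κ} {s s' : ℝ}
    (h : IsGaussianVec P X s) (hs : s ≤ s') : IsGaussianVec P X s' := fun q => by
  obtain ⟨v, hv, hvs⟩ := h q
  exact ⟨v, hv, hvs.trans (by gcongr)⟩

/-- The coordinates at all times are treated as one family. Dependence between times is allowed,
which is what the states require. -/
lemma measure_sum_norm_sq_gt_le {κ : Type*} [Fintype κ] [DecidableEq κ]
    (hκ : 0 < Fintype.card κ) {X : ℕ → Ω → EuclideanSpace ℝ κ} {s δ : ℝ} (hs : 0 < s) (hδ : 0 < δ)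
    (hX : ∀ t, IsGaussianVec P (X t) s) {T : ℕ} (hT : 0 < T) :
    P {ω | T * Fintype.card κ * s * (4 * Real.log (2 / δ)) ≤ ∑ t ∈ Finset.range T, ‖X t ω‖ ^ 2} ≤
      ENNReal.ofReal δ := by
  have hne : (Finset.range T ×ˢ (Finset.univ : Finset κ)).Nonempty := by
    have := Fintype.card_pos_iff.1 hκ
    exact Finset.Nonempty.product (Finset.nonempty_range_iff.2 hT.ne') Finset.univ_nonempty
  have h := measure_sum_sq_gt_le hne (P := P)
    (X := fun (i : ℕ × κ) ω => inner ℝ (EuclideanSpace.single i.2 (1 : ℝ)) (X i.1 ω)) hs hδ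
    (fun i => by simpa using hX i.1 (EuclideanSpace.single i.2 (1 : ℝ)))
  refine le_trans (le_of_eq ?_) h
  congr 1
  ext ω
  simp only [Set.mem_ofPred_eq, Finset.card_product, Finset.card_range, Finset.card_univ,
    Finset.sum_product, EuclideanSpace.inner_single_left, map_one, one_mul,
    EuclideanSpace.norm_sq_eq, Real.norm_eq_abs, sq_abs]
  push_cast
  rfl

/-! ### Empirical covariance of independent noise. -/

section Innovations

variable {𝓕 : ℕ → MeasurableSpace Ω} [IsProbabilityMeasure P]

/-- Independence over time gives one factor √2 per step. The resulting tail has T and log(1/δ) added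
rather than multiplied, which is needed to get H of order T. -/
lemma lintegral_exp_sum_sq_le {κ : Type*} [Fintype κ] {g : ℕ → Ω → EuclideanSpace ℝ κ} {s : ℝ}
    (hg : Innovations P 𝓕 g s) (q : EuclideanSpace ℝ κ) {r : ℝ} (hr : 0 < r) (hq : s * ‖q‖ ^ 2 ≤ r)
    (T : ℕ) :
    ∫⁻ ω, ENNReal.ofReal (Real.exp (∑ t ∈ Finset.range T, (inner ℝ q (g t ω)) ^ 2 / (4 * r))) ∂P ≤
      ENNReal.ofReal (√2 ^ T) := by
  have hm : ∀ T, Measurable[𝓕 T] fun ω =>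
      ∑ t ∈ Finset.range T, (inner ℝ q (g t ω)) ^ 2 / (4 * r) := by
    intro T
    refine Finset.measurable_sum _ fun t ht => ?_
    exact (((hg.measurable_inner q t).mono (hg.mono (Finset.mem_range.1 ht)) le_rfl).pow_const
      2).div_const _
  induction T with
  | zero => simp
  | succ T ih =>
    have main := lintegral_indep_le (P := P) (𝓕 := 𝓕 T)
      (X := fun ω => ∑ t ∈ Finset.range T, (inner ℝ q (g t ω)) ^ 2 / (4 * r))
      (h := fun ω => 1 * inner ℝ q (g T ω))
      (f := fun z : ℝ × ℝ => ENNReal.ofReal (Real.exp z.1) *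
        ENNReal.ofReal (Real.exp (z.2 ^ 2 / (4 * r))))
      (G := fun x : ℝ => ENNReal.ofReal (Real.exp x) * ENNReal.ofReal (√2)) (hg.le T) (hm T)
      (((hg.measurable_inner q T).mono (hg.le _) le_rfl).const_mul 1) (hg.indep_inner q 1 T)
      (by fun_prop) (by fun_prop) (fun x => by
        obtain ⟨v, hv, hvs⟩ := hg.law T q
        simp only [one_mul]
        rw [hv.map_eq, lintegral_const_mul _ (by fun_prop)]
        gcongr
        exact lintegral_exp_sq_gaussianReal_le hr (hvs.trans hq))
    simp only [one_mul] at main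
    calc _ = ∫⁻ ω, ENNReal.ofReal (Real.exp (∑ t ∈ Finset.range T,
          (inner ℝ q (g t ω)) ^ 2 / (4 * r))) *
          ENNReal.ofReal (Real.exp ((inner ℝ q (g T ω)) ^ 2 / (4 * r))) ∂P := by
          refine lintegral_congr fun ω => ?_
          rw [Finset.sum_range_succ, Real.exp_add, ENNReal.ofReal_mul (by positivity)]
      _ ≤ _ := main
      _ = (∫⁻ ω, ENNReal.ofReal (Real.exp (∑ t ∈ Finset.range T,
          (inner ℝ q (g t ω)) ^ 2 / (4 * r))) ∂P) * ENNReal.ofReal (√2) :=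
          lintegral_mul_const' _ _ ENNReal.ofReal_ne_top
      _ ≤ ENNReal.ofReal (√2 ^ T) * ENNReal.ofReal (√2) := by gcongr
      _ = _ := by rw [← ENNReal.ofReal_mul (by positivity), pow_succ]

/-- Operator norm bound for the empirical covariance of a Gaussian noise sequence. -/
lemma measure_empirical_cov_gt_le {κ : Type*} [Fintype κ] [DecidableEq κ]
    (hκ : 0 < Fintype.card κ) {g : ℕ → Ω → EuclideanSpace ℝ κ} {s δ : ℝ}
    (hg : Innovations P 𝓕 g s) (hs : 0 < s) (hδ : 0 < δ) (hδ1 : δ ≤ 1) (T : ℕ) :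
    P {ω | ¬ ∀ q, ∑ t ∈ Finset.range T, (inner ℝ q (g t ω)) ^ 2 ≤
      9 * s * (2 * T + 4 * Fintype.card κ * Real.log (10 * Fintype.card κ) +
        4 * Real.log (1 / δ)) * ‖q‖ ^ 2} ≤ ENNReal.ofReal δ := by
  obtain ⟨𝒩, hcard, hnorm, hnet⟩ := exists_finset_net (κ := κ) hκ
    (show (0 : ℝ) < 1 / 2 by norm_num) (by norm_num)
  set k : ℝ := ((Fintype.card κ : ℕ) : ℝ) with hk
  have hk1 : 1 ≤ k := by rw [hk]; exact_mod_cast hκ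
  set c : ℝ := (10 * k) ^ Fintype.card κ with hc
  have hc0 : 0 < c := by positivity
  have hcard' : (𝒩.card : ℝ) ≤ c := by
    refine hcard.trans (le_of_eq ?_)
    rw [hc]; congr 1; ring
  set δ' := δ / c with hδ'
  have hδ'0 : 0 < δ' := by positivity
  have hlogδ' : Real.log (1 / δ') = k * Real.log (10 * k) + Real.log (1 / δ) := by
    rw [hδ', one_div_div, Real.log_div hc0.ne' hδ.ne', hc, Real.log_pow, one_div, Real.log_inv]
    ring
  set r := s * (3 / 2) ^ 2 with hr
  have hr0 : 0 < r := by positivity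
  -- The first summand absorbs √2 ^ T through √2 ≤ exp(1/2); the second pays for the union over the
  -- net.
  set b := (T : ℝ) / 2 + Real.log (1 / δ') with hb
  have hb0 : 0 ≤ b := by
    have h1 : 0 ≤ Real.log (10 * k) := Real.log_nonneg (by linarith)
    have h2 : 0 ≤ Real.log (1 / δ) := Real.log_nonneg (by rw [le_div_iff₀ hδ]; linarith)
    rw [hb, hlogδ']
    positivity
  let bad : EuclideanSpace ℝ κ → Set Ω := fun q =>
    {ω | b ≤ ∑ t ∈ Finset.range T, (inner ℝ q (g t ω)) ^ 2 / (4 * r)}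
  have hbad : ∀ q ∈ 𝒩, P (bad q) ≤ ENNReal.ofReal δ' := by
    intro q hq
    have hm : Measurable fun ω => ∑ t ∈ Finset.range T, (inner ℝ q (g t ω)) ^ 2 / (4 * r) :=
      Finset.measurable_sum _ fun t _ =>
        (((hg.measurable_inner q t).mono (hg.le _) le_rfl).pow_const 2).div_const _
    refine measure_gt_le_of_lintegral_exp_le hm.aemeasurable ?_
    refine (lintegral_exp_sum_sq_le hg q hr0 ?_ T).trans (ENNReal.ofReal_le_ofReal ?_)
    · rw [hr]
      gcongr
      linarith [(hnorm q hq).2]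
    · rw [hb, Real.exp_add, Real.exp_log (by positivity)]
      have h1 : √2 ≤ Real.exp (1 / 2) := by
        rw [Real.sqrt_le_left (by positivity), ← Real.exp_nat_mul]
        have := Real.add_one_le_exp (1 : ℝ)
        norm_num at this ⊢
        linarith
      calc √2 ^ T ≤ Real.exp (1 / 2) ^ T := by gcongr
        _ = Real.exp (T / 2) := by rw [← Real.exp_nat_mul]; congr 1; ring
        _ = _ := by field_simp
  calc _ ≤ P (⋃ q ∈ 𝒩, bad q) := by
        refine measure_mono ?_
        intro ω h2
        by_contra hcon
        apply h2
        simp only [Set.mem_iUnion, not_exists] at hcon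
        -- The root of the sum of squares is ‖lin q‖, a seminorm in q, so the net lemma applies to
        -- it.
        let lin : EuclideanSpace ℝ κ →ₗ[ℝ] EuclideanSpace ℝ (Fin T) :=
          (WithLp.linearEquiv 2 ℝ (Fin T → ℝ)).symm.toLinearMap ∘ₗ
            LinearMap.pi fun t : Fin T => (innerSL ℝ (g t ω)).toLinearMap
        let p : Seminorm ℝ (EuclideanSpace ℝ κ) := (normSeminorm ℝ _).comp lin
        have hp : ∀ q, p q ^ 2 = ∑ t ∈ Finset.range T, (inner ℝ q (g t ω)) ^ 2 := by
          intro q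
          change ‖lin q‖ ^ 2 = _
          rw [EuclideanSpace.norm_sq_eq, ← Fin.sum_univ_eq_sum_range
            (fun t => (inner ℝ q (g t ω)) ^ 2)]
          refine Finset.sum_congr rfl fun t _ => ?_
          change ‖inner ℝ (g t ω) q‖ ^ 2 = _
          rw [real_inner_comm q, Real.norm_eq_abs, sq_abs]
        have hgood : ∀ q ∈ 𝒩, p q ≤ √(4 * r * b) := by
          intro q hq
          refine Real.le_sqrt_of_sq_le ?_
          have h3 : ∑ t ∈ Finset.range T, (inner ℝ q (g t ω)) ^ 2 / (4 * r) < b :=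
            not_le.1 (hcon q hq)
          rw [← Finset.sum_div, div_lt_iff₀ (by positivity)] at h3
          rw [hp]
          linarith
        intro q
        have h6 := Seminorm.le_two_mul_of_net p hnet hgood q
        rw [← hp]
        calc p q ^ 2 ≤ (2 * √(4 * r * b) * ‖q‖) ^ 2 := by
              have := apply_nonneg p q
              gcongr
          _ = 4 * √(4 * r * b) ^ 2 * ‖q‖ ^ 2 := by ring
          _ = _ := by
              rw [Real.sq_sqrt (by positivity), hb, hlogδ', hr]
              ring
    _ ≤ ∑ q ∈ 𝒩, P (bad q) := measure_biUnion_finset_le _ _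
    _ ≤ ∑ _q ∈ 𝒩, ENNReal.ofReal δ' := Finset.sum_le_sum hbad
    _ = ENNReal.ofReal (𝒩.card * δ') := by
        rw [Finset.sum_const, nsmul_eq_mul, ENNReal.ofReal_mul (by positivity),
          ENNReal.ofReal_natCast]
    _ ≤ ENNReal.ofReal δ := by
        refine ENNReal.ofReal_le_ofReal ?_
        rw [hδ', ← mul_div_assoc, div_le_iff₀ hc0, mul_comm]
        gcongr

end Innovations

/-! ### Small-ball estimates for conditionally Gaussian sequences. -/

section SmallBall

/-- The determinant factor is 1/√(1 + 8v/V) ≤ 1/3, and what remains of the exponent after completing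
the square is nonpositive. The bound is therefore uniform in c, which later carries the unknown
past. -/
lemma lintegral_exp_neg_sq_gaussianReal_le {v : NNReal} {V : ℝ} (hV : 0 < V) (hv : V ≤ v) (c : ℝ) :
    ∫⁻ y, ENNReal.ofReal (Real.exp (-(4 / V) * (c + y) ^ 2)) ∂(gaussianReal 0 v) ≤
      ENNReal.ofReal (1 / 3) := by
  have hv0 : (0 : ℝ) ≤ v := v.2
  have h8 : 8 ≤ 8 / V * v := by rw [div_mul_eq_mul_div, le_div_iff₀ hV]; linarith
  have h := lintegral_exp_quadratic_gaussianReal v (-(8 / V) * c) (-(8 / V)) (by linarith)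
  calc _ = ∫⁻ y, ENNReal.ofReal (Real.exp (-(4 / V) * c ^ 2)) *
        ENNReal.ofReal (Real.exp (-(8 / V) * c * y + -(8 / V) * y ^ 2 / 2))
        ∂(gaussianReal 0 v) := by
        refine lintegral_congr fun y => ?_
        rw [← ENNReal.ofReal_mul (by positivity), ← Real.exp_add]
        congr 2
        ring
    _ = ENNReal.ofReal (Real.exp (-(4 / V) * c ^ 2)) * _ := lintegral_const_mul _ (by fun_prop)
    _ ≤ _ := by
        rw [h, ← ENNReal.ofReal_mul (by positivity)]
        refine ENNReal.ofReal_le_ofReal ?_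
        have h9 : (9 : ℝ) ≤ 1 - -(8 / V) * v := by linarith
        have h3 : (3 : ℝ) ≤ √(1 - -(8 / V) * v) := Real.le_sqrt_of_sq_le (by linarith)
        have h4 : -(4 / V) * c ^ 2 + (-(8 / V) * c) ^ 2 * v / (2 * (1 - -(8 / V) * v)) ≤ 0 := by
          have : (-(8 / V) * c) ^ 2 * v / (2 * (1 - -(8 / V) * v)) ≤ 4 / V * c ^ 2 := by
            rw [div_le_iff₀ (by linarith)]
            have e : 4 / V * c ^ 2 * (2 * (1 - -(8 / V) * v)) =
              8 / V * c ^ 2 + (-(8 / V) * c) ^ 2 * v := by ring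
            rw [e]
            have : 0 ≤ 8 / V * c ^ 2 := by positivity
            linarith
          linarith
        calc _ = (√(1 - -(8 / V) * v))⁻¹ * Real.exp (-(4 / V) * c ^ 2 +
              (-(8 / V) * c) ^ 2 * v / (2 * (1 - -(8 / V) * v))) := by
              rw [Real.exp_add]; ring
          _ ≤ 3⁻¹ * 1 := by
              gcongr
              exact Real.exp_le_one_iff.2 h4
          _ = 1 / 3 := by norm_num

/-- Small-ball estimate along a sequence whose increments are conditionally Gaussian. -/
lemma lintegral_exp_neg_sum_sq_le [IsProbabilityMeasure P] {𝓖 : ℕ → MeasurableSpace Ω} (hle : ∀ l, 𝓖 l ≤ mΩ)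
    (hmono : Monotone 𝓖) {c y : ℕ → Ω → ℝ} (hc : ∀ l, Measurable[𝓖 l] (c l))
    (hy : ∀ l, Measurable[𝓖 (l + 1)] (y l))
    (hind : ∀ l, Indep (𝓖 l) (MeasurableSpace.comap (y l) inferInstance) P) {V : ℝ} (hV : 0 < V)
    (hlaw : ∀ l, ∃ v : NNReal, HasLaw (y l) (gaussianReal 0 v) P ∧ V ≤ v) (J : ℕ) :
    ∫⁻ ω, ENNReal.ofReal (Real.exp (∑ l ∈ Finset.range J, -(4 / V) * (c l ω + y l ω) ^ 2)) ∂P ≤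
      ENNReal.ofReal ((1 / 3) ^ J) := by
  have hm : ∀ J, Measurable[𝓖 J] fun ω =>
      ∑ l ∈ Finset.range J, -(4 / V) * (c l ω + y l ω) ^ 2 := by
    intro J
    refine Finset.measurable_sum _ fun l hl => ?_
    have h1 := Finset.mem_range.1 hl
    exact ((((hc l).mono (hmono h1.le) le_rfl).add
      ((hy l).mono (hmono h1) le_rfl)).pow_const 2).const_mul _
  induction J with
  | zero => simp
  | succ J ih =>
    have main := lintegral_indep_le (P := P) (𝓕 := 𝓖 J)
      (X := fun ω => (∑ l ∈ Finset.range J, -(4 / V) * (c l ω + y l ω) ^ 2, c J ω))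
      (h := y J)
      (f := fun z : (ℝ × ℝ) × ℝ => ENNReal.ofReal (Real.exp z.1.1) *
        ENNReal.ofReal (Real.exp (-(4 / V) * (z.1.2 + z.2) ^ 2)))
      (G := fun x : ℝ × ℝ => ENNReal.ofReal (Real.exp x.1) * ENNReal.ofReal (1 / 3)) (hle J)
      (Measurable.prodMk (hm J) (hc J))
      ((hy J).mono (hle _) le_rfl) (hind J)
      (by fun_prop) (by fun_prop) (fun x => by
        obtain ⟨v, hv, hvs⟩ := hlaw J
        simp only
        rw [hv.map_eq, lintegral_const_mul _ (by fun_prop)]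
        gcongr
        exact lintegral_exp_neg_sq_gaussianReal_le hV hvs x.2)
    calc _ = ∫⁻ ω, ENNReal.ofReal (Real.exp (∑ l ∈ Finset.range J,
          -(4 / V) * (c l ω + y l ω) ^ 2)) *
          ENNReal.ofReal (Real.exp (-(4 / V) * (c J ω + y J ω) ^ 2)) ∂P := by
          refine lintegral_congr fun ω => ?_
          rw [Finset.sum_range_succ, Real.exp_add, ENNReal.ofReal_mul (by positivity)]
      _ ≤ _ := main
      _ = (∫⁻ ω, ENNReal.ofReal (Real.exp (∑ l ∈ Finset.range J,
          -(4 / V) * (c l ω + y l ω) ^ 2)) ∂P) * ENNReal.ofReal (1 / 3) :=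
          lintegral_mul_const' _ _ ENNReal.ofReal_ne_top
      _ ≤ ENNReal.ofReal ((1 / 3) ^ J) * ENNReal.ofReal (1 / 3) := by gcongr
      _ = _ := by rw [← ENNReal.ofReal_mul (by positivity), pow_succ]

lemma sum_range_mul_eq (F : ℕ → ℝ) (K J : ℕ) :
    ∑ i ∈ Finset.range (K * J), F i =
      ∑ r ∈ Finset.range K, ∑ l ∈ Finset.range J, F (r + K * l) := by
  rw [Finset.sum_comm]
  induction J with
  | zero => simp
  | succ J ih =>
    rw [mul_add, mul_one, Finset.sum_range_add, ih, Finset.sum_range_succ]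
    congr 1
    exact Finset.sum_congr rfl fun r _ => by rw [add_comm]

/-- Averaging the small-ball estimate over the interleaved subsequences of stride `K`. -/
lemma measure_sum_sq_le_of_strided {f : ℕ → Ω → ℝ} (hf : ∀ j, Measurable (f j)) {V : ℝ}
    (hV : 0 < V) {n₀ K J N : ℕ} (hK : 0 < K) (hN : n₀ + K * J ≤ N)
    (h : ∀ r < K, ∫⁻ ω, ENNReal.ofReal (Real.exp (∑ l ∈ Finset.range J,
      -(4 / V) * f (n₀ + (r + K * l)) ω ^ 2)) ∂P ≤ ENNReal.ofReal ((1 / 3) ^ J)) :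
    P {ω | ∑ j ∈ Finset.range N, f j ω ^ 2 ≤ K * J * V / 8} ≤
      ENNReal.ofReal (Real.exp (-(J / 2))) := by
  have hK0 : (0 : ℝ) < K := by exact_mod_cast hK
  have hmr : ∀ r, Measurable fun ω => ∑ l ∈ Finset.range J, -(4 / V) * f (n₀ + (r + K * l)) ω ^ 2 :=
    fun r => Finset.measurable_sum _ fun l _ => ((hf _).pow_const 2).const_mul _
  have hm : AEMeasurable (fun ω => ∑ r ∈ Finset.range K, (K : ℝ)⁻¹ *
      ∑ l ∈ Finset.range J, -(4 / V) * f (n₀ + (r + K * l)) ω ^ 2) P :=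
    (Finset.measurable_sum _ fun r _ => (hmr r).const_mul _).aemeasurable
  -- The K strides are dependent on each other, so their exponents are averaged and Jensen is used.
  -- On the bad event the averaged exponent is at least -J/2.
  refine le_trans (measure_mono ?_) (measure_gt_le_of_lintegral_exp_le (b := -(J / 2))
    hm ?_)
  · intro ω hω
    have hω' : ∑ j ∈ Finset.range N, f j ω ^ 2 ≤ K * J * V / 8 := hω
    change _ ≤ ∑ r ∈ Finset.range K, (K : ℝ)⁻¹ *
      ∑ l ∈ Finset.range J, -(4 / V) * f (n₀ + (r + K * l)) ω ^ 2
    have h1 : ∑ r ∈ Finset.range K, (K : ℝ)⁻¹ *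
        ∑ l ∈ Finset.range J, -(4 / V) * f (n₀ + (r + K * l)) ω ^ 2 =
        -(4 / (K * V)) * ∑ i ∈ Finset.range (K * J), f (n₀ + i) ω ^ 2 := by
      rw [sum_range_mul_eq (fun i => f (n₀ + i) ω ^ 2), Finset.mul_sum]
      refine Finset.sum_congr rfl fun r _ => ?_
      rw [Finset.mul_sum, Finset.mul_sum]
      refine Finset.sum_congr rfl fun l _ => ?_
      field_simp
    have h2 : ∑ i ∈ Finset.range (K * J), f (n₀ + i) ω ^ 2 ≤ ∑ j ∈ Finset.range N, f j ω ^ 2 := by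
      have h3 := Finset.sum_range_add (fun j => f j ω ^ 2) n₀ (K * J)
      have h4 : ∑ j ∈ Finset.range (n₀ + K * J), f j ω ^ 2 ≤ ∑ j ∈ Finset.range N, f j ω ^ 2 :=
        Finset.sum_le_sum_of_subset_of_nonneg (Finset.range_mono hN) fun _ _ _ => sq_nonneg _
      have h5 : 0 ≤ ∑ j ∈ Finset.range n₀, f j ω ^ 2 := Finset.sum_nonneg fun _ _ => sq_nonneg _
      linarith
    rw [h1]
    calc -((J : ℝ) / 2) = -(4 / (K * V)) * (K * J * V / 8) := by field_simp; ring
      _ ≤ _ := by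
        have : 0 ≤ 4 / (K * V) := by positivity
        nlinarith [mul_le_mul_of_nonneg_left (h2.trans hω') this]
  · calc _ ≤ ∫⁻ ω, ∑ r ∈ Finset.range K, ENNReal.ofReal ((K : ℝ)⁻¹) *
          ENNReal.ofReal (Real.exp (∑ l ∈ Finset.range J,
            -(4 / V) * f (n₀ + (r + K * l)) ω ^ 2)) ∂P := by
          refine lintegral_mono fun ω => ?_
          have hj := convexOn_exp.map_sum_le (t := Finset.range K) (w := fun _ => (K : ℝ)⁻¹)
            (p := fun r => ∑ l ∈ Finset.range J, -(4 / V) * f (n₀ + (r + K * l)) ω ^ 2)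
            (fun _ _ => by positivity)
            (by rw [Finset.sum_const, nsmul_eq_mul, Finset.card_range, mul_inv_cancel₀ hK0.ne'])
            (fun _ _ => Set.mem_univ _)
          simp only [smul_eq_mul] at hj
          refine (ENNReal.ofReal_le_ofReal hj).trans (le_of_eq ?_)
          rw [ENNReal.ofReal_sum_of_nonneg fun _ _ => by positivity]
          exact Finset.sum_congr rfl fun i _ => ENNReal.ofReal_mul (by positivity)
      _ = ∑ r ∈ Finset.range K, ENNReal.ofReal ((K : ℝ)⁻¹) *
          ∫⁻ ω, ENNReal.ofReal (Real.exp (∑ l ∈ Finset.range J,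
            -(4 / V) * f (n₀ + (r + K * l)) ω ^ 2)) ∂P := by
          have hm : ∀ r, Measurable (fun ω => ENNReal.ofReal (Real.exp (∑ l ∈ Finset.range J,
            -(4 / V) * f (n₀ + (r + K * l)) ω ^ 2))) := fun r =>
              (Real.measurable_exp.comp (hmr r)).ennreal_ofReal
          rw [lintegral_finsetSum _ fun i _ => (hm i).const_mul _]
          exact Finset.sum_congr rfl fun i _ => lintegral_const_mul _ (hm i)
      _ ≤ ∑ r ∈ Finset.range K, ENNReal.ofReal ((K : ℝ)⁻¹) * ENNReal.ofReal ((1 / 3) ^ J) := by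
          refine Finset.sum_le_sum fun r hr => ?_
          gcongr
          exact h r (Finset.mem_range.1 hr)
      _ = ENNReal.ofReal ((1 / 3) ^ J) := by
          rw [Finset.sum_const, Finset.card_range, nsmul_eq_mul, ← mul_assoc,
            ← ENNReal.ofReal_natCast, ← ENNReal.ofReal_mul hK0.le, mul_inv_cancel₀ hK0.ne',
            ENNReal.ofReal_one, one_mul]
      _ ≤ _ := by
          refine ENNReal.ofReal_le_ofReal ?_
          rw [← Real.exp_add]
          -- Since e < 3, (1/3)^J ≤ exp(-J); half of this exponent is spent on the level -J/2.
          have h3 : (1 / 3 : ℝ) ≤ Real.exp (-1) := by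
            rw [Real.exp_neg, one_div]
            exact inv_anti₀ (Real.exp_pos _) (Real.exp_one_lt_d9.le.trans (by norm_num))
          calc (1 / 3 : ℝ) ^ J ≤ Real.exp (-1) ^ J := by gcongr
            _ = _ := by rw [← Real.exp_nat_mul]; congr 1; ring

end SmallBall

end GaussianVectors

/-! ### Matrices acting on Euclidean space and Gaussian marginals. -/

section Euclidean

variable {ι κ : Type*} [Fintype ι] [Fintype κ] [DecidableEq κ]

lemma norm_toEuclideanLin_le (M : Matrix ι κ ℝ) (x : EuclideanSpace ℝ κ) :
    ‖Matrix.toEuclideanLin M x‖ ≤ ‖M‖ * ‖x‖ :=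
  Matrix.l2_opNorm_mulVec M x

lemma measurable_toEuclideanLin (M : Matrix ι κ ℝ) :
    Measurable (Matrix.toEuclideanLin M : EuclideanSpace ℝ κ → EuclideanSpace ℝ ι) :=
  (LinearMap.continuous_of_finiteDimensional _).measurable

variable [DecidableEq ι]

lemma inner_toEuclideanLin_right (M : Matrix ι κ ℝ) (q : EuclideanSpace ℝ ι)
    (x : EuclideanSpace ℝ κ) :
    inner ℝ q (Matrix.toEuclideanLin M x) = inner ℝ (Matrix.toEuclideanLin Mᵀ q) x := by
  rw [← Matrix.conjTranspose_eq_transpose_of_trivial, Matrix.toEuclideanLin_conjTranspose_eq_adjoint,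
    LinearMap.adjoint_inner_left]

lemma norm_transpose_eq (M : Matrix ι κ ℝ) : ‖Mᵀ‖ = ‖M‖ := by
  rw [← Matrix.conjTranspose_eq_transpose_of_trivial, Matrix.l2_opNorm_conjTranspose]

lemma quadForm_eq_inner (S : Matrix ι ι ℝ) (q : EuclideanSpace ℝ ι) :
    q.ofLp ⬝ᵥ S *ᵥ q.ofLp = inner ℝ q (Matrix.toEuclideanLin S q) := by
  rw [EuclideanSpace.inner_eq_star_dotProduct, star_trivial, dotProduct_comm]
  rfl

lemma quadForm_le (S : Matrix ι ι ℝ) (q : EuclideanSpace ℝ ι) :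
    q.ofLp ⬝ᵥ S *ᵥ q.ofLp ≤ ‖S‖ * ‖q‖ ^ 2 := by
  rw [quadForm_eq_inner]
  calc _ ≤ ‖q‖ * ‖Matrix.toEuclideanLin S q‖ := real_inner_le_norm _ _
    _ ≤ ‖q‖ * (‖S‖ * ‖q‖) := by gcongr; exact norm_toEuclideanLin_le S q
    _ = _ := by ring

lemma hasLaw_inner_multivariateGaussian {Ω : Type*} [MeasurableSpace Ω] {P : Measure Ω}
    {X : Ω → EuclideanSpace ℝ ι} {S : Matrix ι ι ℝ} (hS : S.PosSemidef)
    (hX : HasLaw X (multivariateGaussian 0 S) P) (q : EuclideanSpace ℝ ι) :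
    HasLaw (fun ω => inner ℝ q (X ω))
      (gaussianReal 0 (q.ofLp ⬝ᵥ S *ᵥ q.ofLp).toNNReal) P := by
  have h1 : HasLaw (fun x : EuclideanSpace ℝ ι => inner ℝ q x)
      (gaussianReal 0 (q.ofLp ⬝ᵥ S *ᵥ q.ofLp).toNNReal) (multivariateGaussian 0 S) := by
    refine ⟨by fun_prop, ?_⟩
    have h := IsGaussian.map_eq_gaussianReal (μ := multivariateGaussian 0 S) (innerSL ℝ q)
    have hint : ∫ x, innerSL ℝ q x ∂(multivariateGaussian 0 S) = 0 := by
      have h0 := (innerSL ℝ q).integral_comp_id_comm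
        (IsGaussian.integrable_id (μ := multivariateGaussian (0 : EuclideanSpace ℝ ι) S))
      rw [h0, integral_id_multivariateGaussian, map_zero]
    have hvar : Var[innerSL ℝ q; multivariateGaussian 0 S] = q.ofLp ⬝ᵥ S *ᵥ q.ofLp := by
      rw [← covarianceBilin_multivariateGaussian hS (μ := 0),
        covarianceBilin_self IsGaussian.memLp_two_id]
      rfl
    rw [hint, hvar] at h
    exact h
  exact h1.fun_comp hX

end Euclidean

/-! ### The σ-algebras generated by subfamilies of the noise. -/

section Noise

variable {Ω : Type*} {mΩ : MeasurableSpace Ω} {P : Measure Ω} {n m : ℕ}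

/-- The three noise sequences as one family, indexed by time and kind. -/
def noise (u : ℕ → Ω → EuclideanSpace ℝ (Fin m)) (w η : ℕ → Ω → EuclideanSpace ℝ (Fin n)) (t : ℕ)
    (k : Fin 3) : Ω → EuclideanSpace ℝ (Fin m) × EuclideanSpace ℝ (Fin n) :=
  -- Padding with zeros gives the three kinds a common codomain, so they form a single independent
  -- family.
  ![fun ω => (u t ω, 0), fun ω => (0, w t ω), fun ω => (0, η t ω)] k

/-- The σ-algebra generated by the noise variables with index in `S`. -/
def noiseSigma (u : ℕ → Ω → EuclideanSpace ℝ (Fin m)) (w η : ℕ → Ω → EuclideanSpace ℝ (Fin n))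
    (S : Set (ℕ × Fin 3)) : MeasurableSpace Ω :=
  ⨆ p ∈ S, MeasurableSpace.comap (noise u w η p.1 p.2) inferInstance

variable {u : ℕ → Ω → EuclideanSpace ℝ (Fin m)} {w η : ℕ → Ω → EuclideanSpace ℝ (Fin n)}

lemma noiseSigma_mono {S S' : Set (ℕ × Fin 3)} (h : S ⊆ S') :
    noiseSigma u w η S ≤ noiseSigma u w η S' :=
  biSup_mono h

lemma measurable_noise (hu : ∀ t, Measurable (u t)) (hw : ∀ t, Measurable (w t))
    (hη : ∀ t, Measurable (η t)) (t : ℕ) (k : Fin 3) : Measurable (noise u w η t k) := by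
  fin_cases k
  · exact (hu t).prodMk measurable_const
  · exact measurable_const.prodMk (hw t)
  · exact measurable_const.prodMk (hη t)

lemma noiseSigma_le (hu : ∀ t, Measurable (u t)) (hw : ∀ t, Measurable (w t))
    (hη : ∀ t, Measurable (η t)) (S : Set (ℕ × Fin 3)) : noiseSigma u w η S ≤ mΩ :=
  iSup₂_le fun p _ => (measurable_noise hu hw hη p.1 p.2).comap_le

lemma measurable_noise_noiseSigma {S : Set (ℕ × Fin 3)} {t : ℕ} {k : Fin 3} (h : (t, k) ∈ S) :
    Measurable[noiseSigma u w η S] (noise u w η t k) := by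
  rw [measurable_iff_comap_le]
  exact le_biSup (fun p : ℕ × Fin 3 => MeasurableSpace.comap (noise u w η p.1 p.2) inferInstance) h

lemma measurable_u_noiseSigma {S : Set (ℕ × Fin 3)} {t : ℕ} (h : (t, 0) ∈ S) :
    Measurable[noiseSigma u w η S] (u t) :=
  measurable_fst.comp (measurable_noise_noiseSigma (u := u) (w := w) (η := η) h)

lemma measurable_w_noiseSigma {S : Set (ℕ × Fin 3)} {t : ℕ} (h : (t, 1) ∈ S) :
    Measurable[noiseSigma u w η S] (w t) :=
  measurable_snd.comp (measurable_noise_noiseSigma (u := u) (w := w) (η := η) h)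

lemma measurable_η_noiseSigma {S : Set (ℕ × Fin 3)} {t : ℕ} (h : (t, 2) ∈ S) :
    Measurable[noiseSigma u w η S] (η t) :=
  measurable_snd.comp (measurable_noise_noiseSigma (u := u) (w := w) (η := η) h)

lemma isGaussianVec_of_hasLaw {κ : Type*} [Fintype κ] [DecidableEq κ]
    {X : Ω → EuclideanSpace ℝ κ} {S : Matrix κ κ ℝ} (hS : S.PosSemidef)
    (hX : HasLaw X (multivariateGaussian 0 S) P) : IsGaussianVec P X ‖S‖ := fun q =>
  ⟨_, hasLaw_inner_multivariateGaussian hS hX q, by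
    rw [Real.coe_toNNReal _ (by simpa using hS.dotProduct_mulVec_nonneg q.ofLp)]
    exact quadForm_le S q⟩

lemma IsGaussianVec.toEuclideanLin {ι κ : Type*} [Fintype ι] [Fintype κ] [DecidableEq ι]
    [DecidableEq κ] {X : Ω → EuclideanSpace ℝ κ} {s : ℝ} (hs : 0 ≤ s) (h : IsGaussianVec P X s)
    (M : Matrix ι κ ℝ) : IsGaussianVec P (fun ω => Matrix.toEuclideanLin M (X ω)) (‖M‖ ^ 2 * s) := by
  intro q
  obtain ⟨v, hv, hvs⟩ := h (Matrix.toEuclideanLin Mᵀ q)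
  refine ⟨v, by simpa only [inner_toEuclideanLin_right] using hv, hvs.trans ?_⟩
  have h1 := norm_toEuclideanLin_le Mᵀ q
  rw [norm_transpose_eq] at h1
  calc _ ≤ s * (‖M‖ * ‖q‖) ^ 2 := by gcongr
    _ = _ := by ring

variable [IsProbabilityMeasure P] {Su : Matrix (Fin m) (Fin m) ℝ} {Sw Sη : Matrix (Fin n) (Fin n) ℝ}

/-- Independence across times is combined with independence inside one time, where u ⟂ (w, η) and w
⟂ η give the triple. -/
lemma iIndepFun_noise (hu : ∀ t, Measurable (u t)) (hw : ∀ t, Measurable (w t))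
    (hη : ∀ t, Measurable (η t)) (h : IsGaussianNoise P Su Sw Sη u w η) :
    iIndepFun (fun (p : ℕ × Fin 3) => noise u w η p.1 p.2) P := by
  refine iIndepFun_uncurry' (measurable_noise hu hw hη) ?_ fun t => ?_
  · have h1 := h.indep_time.comp
      (fun _ x => (![(x.1, 0), (0, x.2.1), (0, x.2.2)] :
        Fin 3 → EuclideanSpace ℝ (Fin m) × EuclideanSpace ℝ (Fin n))) (fun _ => by
        refine measurable_pi_iff.2 fun k => ?_
        fin_cases k
        · exact measurable_fst.prodMk measurable_const
        · exact measurable_const.prodMk (measurable_fst.comp measurable_snd)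
        · exact measurable_const.prodMk (measurable_snd.comp measurable_snd))
    convert h1 using 2 with t
    ext ω k : 2
    fin_cases k <;> rfl
  · rw [iIndepFun_iff]
    intro s f hf
    -- Indices outside s receive the whole space, so every finite subfamily is reduced to all three
    -- kinds at once.
    have hpre : ∀ i, ∃ g : Set (EuclideanSpace ℝ (Fin m) × EuclideanSpace ℝ (Fin n)),
        MeasurableSet g ∧ (i ∈ s → f i = noise u w η t i ⁻¹' g) ∧ (i ∉ s → g = Set.univ) := by
      intro i
      by_cases hi : i ∈ s
      · obtain ⟨g, hg, hgf⟩ := hf i hi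
        exact ⟨g, hg, fun _ => hgf.symm, fun h => absurd hi h⟩
      · exact ⟨Set.univ, MeasurableSet.univ, fun h => absurd h hi, fun _ => rfl⟩
    choose g hg hgf hgu using hpre
    have e1 : (⋂ i ∈ s, f i) = noise u w η t 0 ⁻¹' g 0 ∩
        (noise u w η t 1 ⁻¹' g 1 ∩ noise u w η t 2 ⁻¹' g 2) := by
      ext ω
      simp only [Set.mem_iInter, Set.mem_inter_iff]
      have h3 : ∀ i, (i ∈ s → ω ∈ f i) ↔ ω ∈ noise u w η t i ⁻¹' g i := by
        intro i
        by_cases hi : i ∈ s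
        · simp [hi, hgf i hi]
        · simp [hi, hgu i hi]
      simp only [h3, Fin.forall_fin_succ]
      simp
    have e2 : ∏ i ∈ s, P (f i) = ∏ i, P (noise u w η t i ⁻¹' g i) := by
      rw [← Finset.prod_subset (Finset.subset_univ s)]
      · exact Finset.prod_congr rfl fun i hi => by rw [hgf i hi]
      · intro i _ hi
        rw [hgu i hi, Set.preimage_univ, measure_univ]
    have i1 : IndepFun (noise u w η t 0) (fun ω => (noise u w η t 1 ω, noise u w η t 2 ω)) P :=
      (h.indep_u_wη t).comp (φ := fun x => (x, (0 : EuclideanSpace ℝ (Fin n))))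
        (ψ := fun z : EuclideanSpace ℝ (Fin n) × EuclideanSpace ℝ (Fin n) =>
          (((0 : EuclideanSpace ℝ (Fin m)), z.1), ((0 : EuclideanSpace ℝ (Fin m)), z.2)))
        (by fun_prop) (by fun_prop)
    have i2 : IndepFun (noise u w η t 1) (noise u w η t 2) P :=
      (h.indep_w_η t).comp
        (φ := fun x : EuclideanSpace ℝ (Fin n) => ((0 : EuclideanSpace ℝ (Fin m)), x))
        (ψ := fun x : EuclideanSpace ℝ (Fin n) => ((0 : EuclideanSpace ℝ (Fin m)), x))
        (by fun_prop) (by fun_prop)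
    have i1' := i1.measure_inter_preimage_eq_mul _ _ (hg 0) ((hg 1).prod (hg 2))
    have i2' := i2.measure_inter_preimage_eq_mul _ _ (hg 1) (hg 2)
    have e3 : (fun ω => (noise u w η t 1 ω, noise u w η t 2 ω)) ⁻¹' (g 1 ×ˢ g 2) =
        noise u w η t 1 ⁻¹' g 1 ∩ noise u w η t 2 ⁻¹' g 2 := rfl
    rw [e1, e2, Fin.prod_univ_three]
    rw [e3, i2'] at i1'
    rw [i1', mul_assoc]

lemma indep_noiseSigma (hu : ∀ t, Measurable (u t)) (hw : ∀ t, Measurable (w t))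
    (hη : ∀ t, Measurable (η t)) (h : IsGaussianNoise P Su Sw Sη u w η) {S S' : Set (ℕ × Fin 3)}
    (hd : Disjoint S S') : Indep (noiseSigma u w η S) (noiseSigma u w η S') P :=
  indep_iSup_of_disjoint
    (m := fun p : ℕ × Fin 3 => MeasurableSpace.comap (noise u w η p.1 p.2) inferInstance)
    (fun p => (measurable_noise hu hw hη p.1 p.2).comap_le) (iIndepFun_noise hu hw hη h).iIndep hd

lemma indepFun_of_noiseSigma (hu : ∀ t, Measurable (u t)) (hw : ∀ t, Measurable (w t))
    (hη : ∀ t, Measurable (η t)) (h : IsGaussianNoise P Su Sw Sη u w η) {S S' : Set (ℕ × Fin 3)}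
    (hd : Disjoint S S') {α β : Type*} [MeasurableSpace α] [MeasurableSpace β] {X : Ω → α}
    {Y : Ω → β} (hX : Measurable[noiseSigma u w η S] X) (hY : Measurable[noiseSigma u w η S'] Y) :
    IndepFun X Y P := by
  rw [IndepFun_iff_Indep]
  exact indep_of_indep_of_le_left (indep_of_indep_of_le_right (indep_noiseSigma hu hw hη h hd)
    (measurable_iff_comap_le.1 hY)) (measurable_iff_comap_le.1 hX)

/-- All noise except the `k`-th kind from time `t` on. -/
def beforeSet (k : Fin 3) (t : ℕ) : Set (ℕ × Fin 3) := {p | p.2 = k → p.1 < t}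

lemma monotone_beforeSet (k : Fin 3) : Monotone (beforeSet k) :=
  fun _ _ hst _ hp hk => (hp hk).trans_le hst

/-- The σ-algebra at time t contains the other two kinds of noise at all times, future included.
Thus u_{j+1} may occur in a factor that is predictable for w_j or η_j. -/
lemma innovations_of_noise (hu : ∀ t, Measurable (u t)) (hw : ∀ t, Measurable (w t))
    (hη : ∀ t, Measurable (η t)) (h : IsGaussianNoise P Su Sw Sη u w η) (k : Fin 3)
    {κ : Type*} [Fintype κ] {g : ℕ → Ω → EuclideanSpace ℝ κ} {s : ℝ}
    (hg : ∀ t, Measurable[noiseSigma u w η {(t, k)}] (g t)) (hlaw : ∀ t, IsGaussianVec P (g t) s) :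
    Innovations P (fun t => noiseSigma u w η (beforeSet k t)) g s where
  le _ := noiseSigma_le hu hw hη _
  mono := fun _ _ hst => noiseSigma_mono (monotone_beforeSet k hst)
  meas t := (hg t).mono (noiseSigma_mono (by
    rintro p rfl
    exact fun _ => Nat.lt_succ_self t)) le_rfl
  indep t := by
    refine indep_of_indep_of_le_right (indep_noiseSigma hu hw hη h (S' := {(t, k)}) ?_)
      (measurable_iff_comap_le.1 (hg t))
    rw [Set.disjoint_singleton_right]
    exact fun hmem => lt_irrefl t (hmem rfl)
  law t q := hlaw t q

end Noise

/-! ### The state as a Gaussian process. -/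

section State

variable {Ω : Type*} {mΩ : MeasurableSpace Ω} {P : Measure Ω} {n m : ℕ}
  {u : ℕ → Ω → EuclideanSpace ℝ (Fin m)} {w η : ℕ → Ω → EuclideanSpace ℝ (Fin n)}

/-- Separates the influence of the past up to τ from that of the noise in the next k steps. -/
lemma state_add (A : Matrix (Fin n) (Fin n) ℝ) (B : Matrix (Fin n) (Fin m) ℝ)
    (u : ℕ → EuclideanSpace ℝ (Fin m)) (w : ℕ → EuclideanSpace ℝ (Fin n)) (τ k : ℕ) :
    state A B u w (τ + k) = (Matrix.toEuclideanLin A ^ k) (state A B u w τ) +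
      state A B (fun i => u (τ + i)) (fun i => w (τ + i)) k := by
  induction k with
  | zero => simp [state]
  | succ k ih =>
    rw [← add_assoc, state, ih, state, map_add, pow_succ', Module.End.mul_apply]
    abel

lemma measurable_state (A : Matrix (Fin n) (Fin n) ℝ) (B : Matrix (Fin n) (Fin m) ℝ) (τ k : ℕ)
    {S : Set (ℕ × Fin 3)} (hS : ∀ i < k, (τ + i, 0) ∈ S ∧ (τ + i, 1) ∈ S) :
    Measurable[noiseSigma u w η S] fun ω =>
      state A B (fun i => u (τ + i) ω) (fun i => w (τ + i) ω) k := by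
  induction k with
  | zero => exact measurable_const
  | succ k ih =>
    have h1 := ih fun i hi => hS i (by omega)
    have h2 := hS k (by omega)
    exact (((measurable_toEuclideanLin A).comp h1).add
      ((measurable_toEuclideanLin B).comp (measurable_u_noiseSigma h2.1))).add
      (measurable_w_noiseSigma h2.2)

lemma hasLaw_add_gaussianReal {X Y : Ω → ℝ} {v₁ v₂ : NNReal} (h : IndepFun X Y P)
    (hX : HasLaw X (gaussianReal 0 v₁) P) (hY : HasLaw Y (gaussianReal 0 v₂) P) :
    HasLaw (fun ω => X ω + Y ω) (gaussianReal 0 (v₁ + v₂)) P := by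
  have := h.hasLaw_add hX hY
  rw [gaussianReal_conv_gaussianReal, add_zero] at this
  exact this

variable [IsProbabilityMeasure P] {Su : Matrix (Fin m) (Fin m) ℝ} {Sw Sη : Matrix (Fin n) (Fin n) ℝ}

/-- The law of a linear functional of the state, started at zero, with bounds on its variance. -/
lemma hasLaw_inner_state (hu : ∀ t, Measurable (u t)) (hw : ∀ t, Measurable (w t))
    (hη : ∀ t, Measurable (η t)) (h : IsGaussianNoise P Su Sw Sη u w η) (hSu : Su.PosSemidef)
    (hSw : Sw.PosSemidef) (A : Matrix (Fin n) (Fin n) ℝ) (B : Matrix (Fin n) (Fin m) ℝ)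
    {φ : ℝ} (hφ : ∀ q : EuclideanSpace ℝ (Fin m), φ * ‖q‖ ^ 2 ≤ q.ofLp ⬝ᵥ Su *ᵥ q.ofLp)
    (τ k : ℕ) (q : EuclideanSpace ℝ (Fin n)) :
    ∃ v : NNReal, HasLaw (fun ω => inner ℝ q
        (state A B (fun i => u (τ + i) ω) (fun i => w (τ + i) ω) k)) (gaussianReal 0 v) P ∧
      (v : ℝ) ≤ (‖B‖ ^ 2 * ‖Su‖ + ‖Sw‖) *
        ∑ i ∈ Finset.range k, ‖(Matrix.toEuclideanLin Aᵀ ^ i) q‖ ^ 2 ∧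
      φ * ∑ i ∈ Finset.range k, ‖Matrix.toEuclideanLin Bᵀ ((Matrix.toEuclideanLin Aᵀ ^ i) q)‖ ^ 2 ≤
        v := by
  induction k generalizing q with
  | zero =>
    refine ⟨0, ?_, by simp, by simp⟩
    simp only [state, inner_zero_right, gaussianReal_zero_var]
    exact hasLaw_dirac_of_ae_eq (by simp)
  | succ k ih =>
    -- ⟨q, x_{k+1}⟩ = ⟨Aᵀq, x_k⟩ + ⟨Bᵀq, u⟩ + ⟨q, w⟩ with independent summands, so the induction
    -- runs over all q and is used at Aᵀq.
    obtain ⟨v, hv, hvle, hvge⟩ := ih (Matrix.toEuclideanLin Aᵀ q)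
    have hlu := hasLaw_inner_multivariateGaussian hSu (h.law_u (τ + k)) (Matrix.toEuclideanLin Bᵀ q)
    have hlw := hasLaw_inner_multivariateGaussian hSw (h.law_w (τ + k)) q
    have hnu : 0 ≤ (Matrix.toEuclideanLin Bᵀ q).ofLp ⬝ᵥ Su *ᵥ (Matrix.toEuclideanLin Bᵀ q).ofLp := by
      simpa using hSu.dotProduct_mulVec_nonneg (Matrix.toEuclideanLin Bᵀ q).ofLp
    have hnw : 0 ≤ q.ofLp ⬝ᵥ Sw *ᵥ q.ofLp := by
      simpa using hSw.dotProduct_mulVec_nonneg q.ofLp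
    have hms := (measurable_state (u := u) (w := w) (η := η) A B τ k
      (S := {p | p.1 < τ + k}) (fun i hi => ⟨by simpa using hi, by simpa using hi⟩))
    have hmin : ∀ (κ : Type) [Fintype κ] (q : EuclideanSpace ℝ κ),
        Measurable fun x : EuclideanSpace ℝ κ => inner ℝ q x := fun κ _ q => by fun_prop
    have hi1 : IndepFun (fun ω => inner ℝ (Matrix.toEuclideanLin Aᵀ q)
        (state A B (fun i => u (τ + i) ω) (fun i => w (τ + i) ω) k))
        (fun ω => inner ℝ (Matrix.toEuclideanLin Bᵀ q) (u (τ + k) ω)) P := by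
      refine indepFun_of_noiseSigma hu hw hη h (S := {p | p.1 < τ + k}) (S' := {(τ + k, 0)}) ?_
        ((hmin _ _).comp hms) ((hmin _ _).comp (measurable_u_noiseSigma rfl))
      rw [Set.disjoint_singleton_right]
      exact fun hlt => lt_irrefl (τ + k) hlt
    have hi2 : IndepFun (fun ω => inner ℝ (Matrix.toEuclideanLin Aᵀ q)
        (state A B (fun i => u (τ + i) ω) (fun i => w (τ + i) ω) k) +
        inner ℝ (Matrix.toEuclideanLin Bᵀ q) (u (τ + k) ω)) (fun ω => inner ℝ q (w (τ + k) ω)) P := by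
      refine indepFun_of_noiseSigma hu hw hη h (S := {p | p.1 < τ + k} ∪ {(τ + k, 0)})
        (S' := {(τ + k, 1)}) ?_ (Measurable.add ?_ ?_)
        ((hmin _ _).comp (measurable_w_noiseSigma rfl))
      · rw [Set.disjoint_singleton_right]
        rintro (hlt | heq)
        · exact lt_irrefl (τ + k) hlt
        · simp at heq
      · exact ((hmin _ _).comp hms).mono (noiseSigma_mono Set.subset_union_left) le_rfl
      · exact (hmin _ _).comp (measurable_u_noiseSigma (Or.inr rfl))
    refine ⟨(v + ((Matrix.toEuclideanLin Bᵀ q).ofLp ⬝ᵥ Su *ᵥ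
        (Matrix.toEuclideanLin Bᵀ q).ofLp).toNNReal) + (q.ofLp ⬝ᵥ Sw *ᵥ q.ofLp).toNNReal, ?_, ?_, ?_⟩
    · have := hasLaw_add_gaussianReal hi2 (hasLaw_add_gaussianReal hi1 hv hlu) hlw
      simp only [state, inner_add_right, inner_toEuclideanLin_right A,
        inner_toEuclideanLin_right B]
      exact this
    · push_cast
      rw [Real.coe_toNNReal _ hnu, Real.coe_toNNReal _ hnw, Finset.sum_range_succ']
      have h1 := quadForm_le Su (Matrix.toEuclideanLin Bᵀ q)
      have h2 := quadForm_le Sw q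
      have h3 := norm_toEuclideanLin_le Bᵀ q
      rw [norm_transpose_eq] at h3
      have h4 : ‖Su‖ * ‖Matrix.toEuclideanLin Bᵀ q‖ ^ 2 ≤ ‖B‖ ^ 2 * ‖Su‖ * ‖q‖ ^ 2 := by
        calc _ ≤ ‖Su‖ * (‖B‖ * ‖q‖) ^ 2 := by gcongr
          _ = _ := by ring
      simp only [pow_succ, Module.End.mul_apply] at hvle ⊢
      simp only [pow_zero, Module.End.one_apply] at hvle ⊢
      nlinarith
    · push_cast
      rw [Real.coe_toNNReal _ hnu, Real.coe_toNNReal _ hnw, Finset.sum_range_succ']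
      have h1 := hφ (Matrix.toEuclideanLin Bᵀ q)
      simp only [pow_succ, Module.End.mul_apply] at hvge ⊢
      simp only [pow_zero, Module.End.one_apply] at hvge h1 ⊢
      simp only [pow_succ, pow_zero] at h1
      rw [mul_add]
      linarith

end State

/-! ### Lower bounds from singular values. -/

section SingularValues

open Module InnerProductSpace

variable {E F : Type*} [NormedAddCommGroup E] [InnerProductSpace ℝ E] [FiniteDimensional ℝ E]
  [NormedAddCommGroup F] [InnerProductSpace ℝ F] [FiniteDimensional ℝ F]

lemma le_inner_of_le_eigenvalues {T : E →ₗ[ℝ] E} (hT : T.IsSymmetric) {N : ℕ}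
    (hN : finrank ℝ E = N) {c : ℝ} (hc : ∀ i, c ≤ hT.eigenvalues hN i) (v : E) :
    c * ‖v‖ ^ 2 ≤ inner ℝ v (T v) := by
  set b := hT.eigenvectorBasis hN
  have h1 : inner ℝ v (T v) = ∑ i, hT.eigenvalues hN i * (b.repr v i) ^ 2 := by
    rw [← b.repr.inner_map_map, PiLp.inner_apply]
    refine Finset.sum_congr rfl fun i _ => ?_
    rw [hT.eigenvectorBasis_apply_self_apply hN]
    simp only [RCLike.inner_apply, conj_trivial, RCLike.ofReal_real_eq_id, id]
    change _ * b.repr v i * b.repr v i = _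
    ring
  have h2 : ‖v‖ ^ 2 = ∑ i, (b.repr v i) ^ 2 := by
    rw [← b.repr.norm_map v, EuclideanSpace.norm_sq_eq]
    simp
  rw [h1, h2, Finset.mul_sum]
  exact Finset.sum_le_sum fun i _ => mul_le_mul_of_nonneg_right (hc i) (sq_nonneg _)

lemma singularValues_mul_norm_le (T : E →ₗ[ℝ] F) {N : ℕ} (hN : finrank ℝ E = N) (v : E) :
    T.singularValues (N - 1) * ‖v‖ ≤ ‖T v‖ := by
  have hs : (T.singularValues (N - 1)) ^ 2 * ‖v‖ ^ 2 ≤ ‖T v‖ ^ 2 := by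
    have h := le_inner_of_le_eigenvalues T.isSymmetric_adjoint_comp_self hN
      (c := T.singularValues (N - 1) ^ 2) (fun i => by
        rw [← T.sq_singularValues_fin hN]
        have h1 := T.singularValues_antitone (show (i : ℕ) ≤ N - 1 by omega)
        have h2 := T.singularValues_nonneg (N - 1)
        gcongr) v
    rwa [LinearMap.comp_apply, LinearMap.adjoint_inner_right, real_inner_self_eq_norm_sq] at h
  rw [← mul_pow] at hs
  exact le_of_sq_le_sq hs (norm_nonneg _)

/-- The adjoint of a map onto an `n`-dimensional space is bounded below by the `n`-th singular
value. -/
lemma singularValues_mul_norm_le_adjoint (T : E →ₗ[ℝ] F) {n : ℕ} (hn : finrank ℝ F = n)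
    (hn0 : 0 < n) (q : F) :
    (T.singularValues (n - 1)) ^ 2 * ‖q‖ ^ 2 ≤ ‖LinearMap.adjoint T q‖ ^ 2 := by
  -- A vanishing singular value makes the claim trivial; a positive one forces the domain to have
  -- dimension at least n.
  rcases (T.singularValues_nonneg (n - 1)).eq_or_lt with h0 | hpos
  · rw [← h0]
    simp
  have hlt : n - 1 < finrank ℝ E := by
    by_contra h
    rw [T.singularValues_of_finrank_le (not_lt.1 h)] at hpos
    exact lt_irrefl _ hpos
  set hS := T.isSymmetric_adjoint_comp_self
  set b := hS.eigenvectorBasis rfl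
  let idx : Fin n → Fin (finrank ℝ E) := fun i => ⟨i, by omega⟩
  have hidx : Function.Injective idx := fun i j h => by
    simpa [idx, Fin.ext_iff] using h
  set μ : Fin n → ℝ := fun i => T.singularValues i with hμ
  have hμle : ∀ i, T.singularValues (n - 1) ≤ μ i := fun i =>
    T.singularValues_antitone (show (i : ℕ) ≤ n - 1 by omega)
  have hμpos : ∀ i, 0 < μ i := fun i => hpos.trans_le (hμle i)
  have hTT : ∀ i j, inner ℝ (T (b (idx i))) (T (b (idx j))) = if i = j then μ i ^ 2 else 0 := by
    intro i j
    have h1 : (LinearMap.adjoint T ∘ₗ T) (b (idx j)) = (μ j ^ 2) • b (idx j) := by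
      have := hS.apply_eigenvectorBasis rfl (idx j)
      rw [this, ← T.sq_singularValues_fin rfl]
      rfl
    rw [← LinearMap.adjoint_inner_right]
    change inner ℝ (b (idx i)) ((LinearMap.adjoint T ∘ₗ T) (b (idx j))) = _
    rw [h1, inner_smul_right, orthonormal_iff_ite.1 b.orthonormal]
    by_cases hij : i = j
    · simp [hij]
    · simp [hij, hidx.ne hij]
  -- The normalized images of the top n right singular vectors are n orthonormal vectors in an
  -- n-dimensional space, hence a basis.
  have hf : Orthonormal ℝ fun i => (μ i)⁻¹ • T (b (idx i)) := by
    rw [orthonormal_iff_ite]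
    intro i j
    rw [inner_smul_left, inner_smul_right, hTT]
    by_cases hij : i = j
    · subst hij
      have := (hμpos i).ne'
      simp only [conj_trivial, if_true]
      field_simp
    · simp [hij]
  have hspan : Submodule.span ℝ (Set.range fun i => (μ i)⁻¹ • T (b (idx i))) = ⊤ := by
    refine hf.linearIndependent.span_eq_top_of_card_eq_finrank' ?_
    rw [Fintype.card_fin, hn]
  set fb := OrthonormalBasis.mk hf hspan.ge
  have hq : ‖q‖ ^ 2 = ∑ i, (inner ℝ ((μ i)⁻¹ • T (b (idx i))) q) ^ 2 := by
    rw [← fb.sum_sq_norm_inner_right q]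
    refine Finset.sum_congr rfl fun i _ => ?_
    rw [OrthonormalBasis.coe_mk, Real.norm_eq_abs, sq_abs]
  -- Bessel for the adjoint image of q: its coefficients are μ_i times those of q in the new basis.
  have hB := (b.orthonormal.comp idx hidx).sum_inner_products_le (s := Finset.univ)
    (x := LinearMap.adjoint T q)
  refine le_trans ?_ hB
  rw [hq, Finset.mul_sum]
  refine Finset.sum_le_sum fun i _ => ?_
  rw [Function.comp_apply, LinearMap.adjoint_inner_right, Real.norm_eq_abs, sq_abs, inner_smul_left,
    conj_trivial, mul_pow, ← mul_assoc]
  refine mul_le_of_le_one_left (sq_nonneg _) ?_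
  rw [inv_pow, mul_inv_le_iff₀ (by have := hμpos i; positivity), one_mul]
  have := hμle i
  gcongr

end SingularValues

/-! ### Singular values of Su, A and the controllability matrix. -/

section SingVal

variable {n m : ℕ}

lemma singVal_mul_norm_le {ι : Type*} [Fintype ι] (M : Matrix ι (Fin m) ℝ)
    (v : EuclideanSpace ℝ (Fin m)) : singVal M m * ‖v‖ ≤ ‖Matrix.toEuclideanLin M v‖ :=
  singularValues_mul_norm_le _ (by simp) v

/-- An eigenvalue of S is nonnegative, so it equals ‖S e‖ for its unit eigenvector e and is at least
the last singular value. -/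
lemma singVal_mul_norm_sq_le_quadForm {S : Matrix (Fin m) (Fin m) ℝ} (hS : S.PosSemidef)
    (v : EuclideanSpace ℝ (Fin m)) : singVal S m * ‖v‖ ^ 2 ≤ v.ofLp ⬝ᵥ S *ᵥ v.ofLp := by
  have hsym : (Matrix.toEuclideanLin S).IsSymmetric :=
    Matrix.isSymmetric_toEuclideanLin_iff.2 hS.isHermitian
  have hfr : Module.finrank ℝ (EuclideanSpace ℝ (Fin m)) = m := by simp
  rw [quadForm_eq_inner]
  refine le_inner_of_le_eigenvalues hsym hfr (fun i => ?_) v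
  set e := hsym.eigenvectorBasis hfr i
  have he : ‖e‖ = 1 := (hsym.eigenvectorBasis hfr).orthonormal.1 i
  have hap : Matrix.toEuclideanLin S e = hsym.eigenvalues hfr i • e :=
    hsym.apply_eigenvectorBasis hfr i
  have h0 : 0 ≤ hsym.eigenvalues hfr i := by
    have h1 : 0 ≤ e.ofLp ⬝ᵥ S *ᵥ e.ofLp := by simpa using hS.dotProduct_mulVec_nonneg e.ofLp
    rw [quadForm_eq_inner, hap, inner_smul_right, real_inner_self_eq_norm_sq, he] at h1
    simpa using h1
  have h2 := singVal_mul_norm_le S e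
  rw [hap, norm_smul, he, mul_one, mul_one, Real.norm_eq_abs, abs_of_nonneg h0] at h2
  exact h2

lemma finrank_range_toEuclideanLin {ι κ : Type*} [Fintype ι] [Fintype κ] [DecidableEq ι]
    [DecidableEq κ] (M : Matrix ι κ ℝ) :
    Module.finrank ℝ (LinearMap.range (Matrix.toEuclideanLin M)) = M.rank := by
  rw [Matrix.rank_eq_finrank_range_toLin M (PiLp.basisFun 2 ℝ ι) (PiLp.basisFun 2 ℝ κ)]
  rfl

lemma singVal_pos {ι κ : Type*} [Fintype ι] [Fintype κ] [DecidableEq ι]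
    [DecidableEq κ] (M : Matrix ι κ ℝ) {k : ℕ} (hk : 0 < k) (h : M.rank = k) : 0 < singVal M k := by
  rw [singVal, LinearMap.singularValues_pos_iff_lt_finrank_range, finrank_range_toEuclideanLin, h]
  omega

/-- The blocks of Rᵀq are Bᵀ(Aᵀ)^i q, so the right side is ‖Rᵀq‖². This turns controllability into a
variance bound. -/
lemma singVal_ctrbMatrix_sq_mul_le (A : Matrix (Fin n) (Fin n) ℝ) (B : Matrix (Fin n) (Fin m) ℝ)
    (hn : 0 < n) (q : EuclideanSpace ℝ (Fin n)) :
    singVal (ctrbMatrix A B) n ^ 2 * ‖q‖ ^ 2 ≤ ∑ i ∈ Finset.range n,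
      ‖Matrix.toEuclideanLin Bᵀ ((Matrix.toEuclideanLin Aᵀ ^ i) q)‖ ^ 2 := by
  have h := singularValues_mul_norm_le_adjoint (Matrix.toEuclideanLin (ctrbMatrix A B))
    (n := n) (by simp) hn q
  refine h.trans (le_of_eq ?_)
  rw [← Matrix.toEuclideanLin_conjTranspose_eq_adjoint,
    Matrix.conjTranspose_eq_transpose_of_trivial, EuclideanSpace.norm_sq_eq, Fintype.sum_prod_type,
    ← Fin.sum_univ_eq_sum_range
      (fun i => ‖Matrix.toEuclideanLin Bᵀ ((Matrix.toEuclideanLin Aᵀ ^ i) q)‖ ^ 2)]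
  refine Finset.sum_congr rfl fun k _ => ?_
  rw [EuclideanSpace.norm_sq_eq]
  refine Finset.sum_congr rfl fun j _ => ?_
  congr 2
  have hpow : ∀ i : ℕ, (Matrix.toEuclideanLin Aᵀ ^ i) q = WithLp.toLp 2 ((A ^ i)ᵀ *ᵥ q.ofLp) := by
    intro i
    induction i with
    | zero => simp
    | succ i ih =>
      rw [pow_succ', Module.End.mul_apply, ih, pow_succ, Matrix.transpose_mul,
        ← Matrix.mulVec_mulVec]
      rfl
  rw [hpow]
  change ((ctrbMatrix A B)ᵀ *ᵥ q.ofLp) (k, j) = (Bᵀ *ᵥ ((A ^ (k : ℕ))ᵀ *ᵥ q.ofLp)) j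
  rw [Matrix.mulVec_mulVec, ← Matrix.transpose_mul]
  rfl

end SingVal

/-! ### Stacked vectors and their blocks. -/

section Stack

variable {n m : ℕ}

/-- The stacked vector `[x; u]`. -/
def stack (x : EuclideanSpace ℝ (Fin n)) (u : EuclideanSpace ℝ (Fin m)) :
    EuclideanSpace ℝ (Fin n ⊕ Fin m) :=
  WithLp.toLp 2 (Sum.elim x.ofLp u.ofLp)

/-- The first block of a stacked vector. -/
def blockFst (θ : EuclideanSpace ℝ (Fin n ⊕ Fin m)) : EuclideanSpace ℝ (Fin n) :=
  WithLp.toLp 2 fun i => θ (Sum.inl i)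

/-- The second block of a stacked vector. -/
def blockSnd (θ : EuclideanSpace ℝ (Fin n ⊕ Fin m)) : EuclideanSpace ℝ (Fin m) :=
  WithLp.toLp 2 fun i => θ (Sum.inr i)

lemma inner_stack (x : EuclideanSpace ℝ (Fin n)) (u : EuclideanSpace ℝ (Fin m))
    (θ : EuclideanSpace ℝ (Fin n ⊕ Fin m)) :
    inner ℝ (stack x u) θ = inner ℝ x (blockFst θ) + inner ℝ u (blockSnd θ) := by
  simp [PiLp.inner_apply, stack, blockFst, blockSnd]

lemma norm_sq_stack (x : EuclideanSpace ℝ (Fin n)) (u : EuclideanSpace ℝ (Fin m)) :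
    ‖stack x u‖ ^ 2 = ‖x‖ ^ 2 + ‖u‖ ^ 2 := by
  simp [EuclideanSpace.norm_sq_eq, stack]

lemma norm_sq_eq_blocks (θ : EuclideanSpace ℝ (Fin n ⊕ Fin m)) :
    ‖θ‖ ^ 2 = ‖blockFst θ‖ ^ 2 + ‖blockSnd θ‖ ^ 2 := by
  simp [EuclideanSpace.norm_sq_eq, blockFst, blockSnd]

lemma norm_blockFst_le (θ : EuclideanSpace ℝ (Fin n ⊕ Fin m)) : ‖blockFst θ‖ ≤ ‖θ‖ := by
  refine le_of_sq_le_sq ?_ (norm_nonneg _)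
  rw [norm_sq_eq_blocks θ]
  linarith [sq_nonneg ‖blockSnd θ‖]

lemma norm_blockSnd_le (θ : EuclideanSpace ℝ (Fin n ⊕ Fin m)) : ‖blockSnd θ‖ ≤ ‖θ‖ := by
  refine le_of_sq_le_sq ?_ (norm_nonneg _)
  rw [norm_sq_eq_blocks θ]
  linarith [sq_nonneg ‖blockFst θ‖]

lemma measurable_stack {Ω : Type*} {mΩ : MeasurableSpace Ω} {x : Ω → EuclideanSpace ℝ (Fin n)}
    {u : Ω → EuclideanSpace ℝ (Fin m)} (hx : Measurable x) (hu : Measurable u) :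
    Measurable fun ω => stack (x ω) (u ω) := by
  refine (WithLp.measurable_toLp 2 _).comp (measurable_pi_iff.2 fun i => ?_)
  rcases i with i | i
  · exact (measurable_pi_apply i).comp ((WithLp.measurable_ofLp 2 _).comp hx)
  · exact (measurable_pi_apply i).comp ((WithLp.measurable_ofLp 2 _).comp hu)

end Stack

/-! ### Persistent excitation of the noiseless instruments. -/

section SmallBall

variable {Ω : Type*} {mΩ : MeasurableSpace Ω} {P : Measure Ω} [IsProbabilityMeasure P] {n m : ℕ}
  {u : ℕ → Ω → EuclideanSpace ℝ (Fin m)} {w η : ℕ → Ω → EuclideanSpace ℝ (Fin n)}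
  {Su : Matrix (Fin m) (Fin m) ℝ} {Sw Sη : Matrix (Fin n) (Fin n) ℝ}
  {A : Matrix (Fin n) (Fin n) ℝ} {B : Matrix (Fin n) (Fin m) ℝ}

lemma measurable_state_zero {S : Set (ℕ × Fin 3)} {k : ℕ}
    (hS : ∀ i < k, (i, 0) ∈ S ∧ (i, 1) ∈ S) :
    Measurable[noiseSigma u w η S] fun ω => state A B (fun i => u i ω) (fun i => w i ω) k := by
  have h := measurable_state (u := u) (w := w) (η := η) A B 0 k (S := S)
    (fun i hi => by simpa using hS i hi)
  simpa only [zero_add] using h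

/-- Excitation of a fixed direction along a stride. -/
lemma lintegral_exp_neg_sum_excitation_le (hu : ∀ t, Measurable (u t)) (hw : ∀ t, Measurable (w t))
    (hη : ∀ t, Measurable (η t)) (h : IsGaussianNoise P Su Sw Sη u w η) (hSu : Su.PosSemidef)
    (hSw : Sw.PosSemidef) {φ V₀ : ℝ}
    (hφ : ∀ q : EuclideanSpace ℝ (Fin m), φ * ‖q‖ ^ 2 ≤ q.ofLp ⬝ᵥ Su *ᵥ q.ofLp)
    (hV₀φ : V₀ ≤ φ)
    (hR : ∀ q : EuclideanSpace ℝ (Fin n), V₀ * ‖q‖ ^ 2 ≤ φ * ∑ i ∈ Finset.range n,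
      ‖Matrix.toEuclideanLin Bᵀ ((Matrix.toEuclideanLin Aᵀ ^ i) q)‖ ^ 2)
    (θ : EuclideanSpace ℝ (Fin n ⊕ Fin m)) {V : ℝ} (hV : 0 < V) (hVle : V ≤ V₀ * ‖θ‖ ^ 2)
    (r J : ℕ) :
    ∫⁻ ω, ENNReal.ofReal (Real.exp (∑ l ∈ Finset.range J, -(4 / V) *
      (inner ℝ (stack (state A B (fun i => u i ω) (fun i => w i ω) (n + (r + (n + 2) * l)))
        (u (n + (r + (n + 2) * l) + 1) ω)) θ) ^ 2)) ∂P ≤ ENNReal.ofReal ((1 / 3) ^ J) := by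
  have hin : ∀ (k : ℕ) (q : EuclideanSpace ℝ (Fin k)),
      Measurable fun x : EuclideanSpace ℝ (Fin k) => inner ℝ q x := fun k q => by fun_prop
  -- With τ = r + (n+2) l, the block of times τ, …, τ+n+1 contains the n noises that drive the state
  -- from τ to τ+n and the input u_{τ+n+1} stacked with x_{τ+n}. Blocks are disjoint, so each has a
  -- fresh Gaussian part y; the past enters only through the shift c.
  have key := lintegral_exp_neg_sum_sq_le (P := P)
    (𝓖 := fun l => noiseSigma u w η {p | p.1 < r + (n + 2) * l})
    (c := fun l ω => inner ℝ (blockFst θ) ((Matrix.toEuclideanLin A ^ n)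
      (state A B (fun i => u i ω) (fun i => w i ω) (r + (n + 2) * l))))
    (y := fun l ω => inner ℝ (blockFst θ) (state A B (fun i => u (r + (n + 2) * l + i) ω)
      (fun i => w (r + (n + 2) * l + i) ω) n) +
      inner ℝ (blockSnd θ) (u (n + (r + (n + 2) * l) + 1) ω))
    (fun l => noiseSigma_le hu hw hη _) (fun i j hij => noiseSigma_mono fun p hp => ?_)
    (fun l => ?_) (fun l => ?_) (fun l => ?_) hV (fun l => ?_) J
  · refine le_trans (le_of_eq (lintegral_congr fun ω => ?_)) key
    congr 2
    refine Finset.sum_congr rfl fun l _ => ?_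
    congr 2
    rw [inner_stack, add_comm n (r + (n + 2) * l), state_add, inner_add_left,
      real_inner_comm (blockFst θ), real_inner_comm (blockFst θ), real_inner_comm (blockSnd θ),
      add_assoc]
  · have : (n + 2) * i ≤ (n + 2) * j := Nat.mul_le_mul_left _ hij
    have hp' : p.1 < r + (n + 2) * i := hp
    change p.1 < r + (n + 2) * j
    omega
  · have h1 : Measurable fun x => inner ℝ (blockFst θ) ((Matrix.toEuclideanLin A ^ n) x) :=
      (hin n _).comp (LinearMap.continuous_of_finiteDimensional _).measurable
    exact h1.comp (measurable_state_zero fun i hi => ⟨hi, hi⟩)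
  · refine Measurable.add ((hin n _).comp (measurable_state A B _ _ fun i hi => ?_))
      ((hin m _).comp (measurable_u_noiseSigma ?_))
    · change r + (n + 2) * l + i < r + (n + 2) * (l + 1) ∧ r + (n + 2) * l + i <
        r + (n + 2) * (l + 1)
      rw [mul_add]
      omega
    · change n + (r + (n + 2) * l) + 1 < r + (n + 2) * (l + 1)
      rw [mul_add]
      omega
  · refine indep_of_indep_of_le_right (indep_noiseSigma hu hw hη h
      (S' := {p | r + (n + 2) * l ≤ p.1}) ?_) (measurable_iff_comap_le.1 ?_)
    · rw [Set.disjoint_left]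
      exact fun p hp hp' => not_lt.2 (show r + (n + 2) * l ≤ p.1 from hp') hp
    · refine Measurable.add ((hin n _).comp (measurable_state A B _ _ fun i hi => ?_))
        ((hin m _).comp (measurable_u_noiseSigma ?_))
      · exact ⟨Nat.le_add_right _ _, Nat.le_add_right _ _⟩
      · change r + (n + 2) * l ≤ n + (r + (n + 2) * l) + 1
        omega
  · obtain ⟨v, hv, -, hvge⟩ := hasLaw_inner_state hu hw hη h hSu hSw A B hφ (r + (n + 2) * l) n
      (blockFst θ)
    have hlu := hasLaw_inner_multivariateGaussian hSu (h.law_u (n + (r + (n + 2) * l) + 1))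
      (blockSnd θ)
    have hind : IndepFun (fun ω => inner ℝ (blockFst θ)
        (state A B (fun i => u (r + (n + 2) * l + i) ω) (fun i => w (r + (n + 2) * l + i) ω) n))
        (fun ω => inner ℝ (blockSnd θ) (u (n + (r + (n + 2) * l) + 1) ω)) P := by
      refine indepFun_of_noiseSigma hu hw hη h (S := {p | p.1 < n + (r + (n + 2) * l)})
        (S' := {(n + (r + (n + 2) * l) + 1, 0)}) ?_
        ((hin n _).comp (measurable_state A B _ _ fun i hi => ?_))
        ((hin m _).comp (measurable_u_noiseSigma rfl))
      · rw [Set.disjoint_singleton_right]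
        intro hlt
        have : n + (r + (n + 2) * l) + 1 < n + (r + (n + 2) * l) := hlt
        omega
      · change r + (n + 2) * l + i < n + (r + (n + 2) * l) ∧ r + (n + 2) * l + i <
          n + (r + (n + 2) * l)
        omega
    refine ⟨_, hasLaw_add_gaussianReal hind hv hlu, ?_⟩
    have hnu : 0 ≤ (blockSnd θ).ofLp ⬝ᵥ Su *ᵥ (blockSnd θ).ofLp := by
      simpa using hSu.dotProduct_mulVec_nonneg (blockSnd θ).ofLp
    push_cast
    rw [Real.coe_toNNReal _ hnu]
    have h1 := hφ (blockSnd θ)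
    have h2 := hR (blockFst θ)
    have h3 : V₀ * ‖blockSnd θ‖ ^ 2 ≤ φ * ‖blockSnd θ‖ ^ 2 := by gcongr
    rw [norm_sq_eq_blocks θ, mul_add] at hVle
    linarith

/-- Lower bound for the Gram matrix of the noiseless regressors. -/
lemma measure_gram_lower_le (hu : ∀ t, Measurable (u t)) (hw : ∀ t, Measurable (w t))
    (hη : ∀ t, Measurable (η t)) (h : IsGaussianNoise P Su Sw Sη u w η) (hSu : Su.PosSemidef)
    (hSw : Sw.PosSemidef) (hn : 0 < n) {φ V₀ : ℝ} (hV₀ : 0 < V₀)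
    (hφ : ∀ q : EuclideanSpace ℝ (Fin m), φ * ‖q‖ ^ 2 ≤ q.ofLp ⬝ᵥ Su *ᵥ q.ofLp)
    (hV₀φ : V₀ ≤ φ)
    (hR : ∀ q : EuclideanSpace ℝ (Fin n), V₀ * ‖q‖ ^ 2 ≤ φ * ∑ i ∈ Finset.range n,
      ‖Matrix.toEuclideanLin Bᵀ ((Matrix.toEuclideanLin Aᵀ ^ i) q)‖ ^ 2)
    {J N : ℕ} (hN : n + (n + 2) * J ≤ N) {ε L lam : ℝ} (hε : 0 < ε) (hε1 : ε ≤ 1 / 2)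
    (hlam : lam ≤ (n + 2) * J * V₀ / 128) (hL : ε ^ 2 * L ≤ lam) :
    P {ω | ∑ j ∈ Finset.range N,
        ‖stack (state A B (fun i => u i ω) (fun i => w i ω) j) (u (j + 1) ω)‖ ^ 2 ≤ L ∧
      ¬ ∀ θ : EuclideanSpace ℝ (Fin n ⊕ Fin m), lam * ‖θ‖ ^ 2 ≤ ∑ j ∈ Finset.range N,
        (inner ℝ (stack (state A B (fun i => u i ω) (fun i => w i ω) j) (u (j + 1) ω)) θ) ^ 2} ≤
      ENNReal.ofReal ((5 * ((n : ℝ) + m) / ε) ^ (n + m) * Real.exp (-(J / 2))) := by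
  have hcardd : Fintype.card (Fin n ⊕ Fin m) = n + m := by simp
  obtain ⟨𝒩, hcard, hnorm, hnet⟩ := exists_finset_net (κ := Fin n ⊕ Fin m)
    (by rw [hcardd]; omega) hε (by linarith)
  rw [hcardd] at hcard
  push_cast at hcard
  set s : ℕ → Ω → EuclideanSpace ℝ (Fin n ⊕ Fin m) := fun j ω =>
    stack (state A B (fun i => u i ω) (fun i => w i ω) j) (u (j + 1) ω) with hs
  have hsm : ∀ j, Measurable (s j) := fun j =>
    measurable_stack ((measurable_state_zero (η := η) (S := Set.univ) (fun i _ =>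
      ⟨trivial, trivial⟩)).mono (noiseSigma_le hu hw hη _) le_rfl) (hu _)
  let bad : EuclideanSpace ℝ (Fin n ⊕ Fin m) → Set Ω := fun q =>
    {ω | ∑ j ∈ Finset.range N, (inner ℝ (s j ω) q) ^ 2 ≤
      ((n + 2 : ℕ) : ℝ) * J * (V₀ * ‖q‖ ^ 2) / 8}
  have hbad : ∀ q ∈ 𝒩, P (bad q) ≤ ENNReal.ofReal (Real.exp (-(J / 2))) := by
    intro q hq
    have hq0 : 0 < ‖q‖ := by linarith [(hnorm q hq).1]
    refine measure_sum_sq_le_of_strided (f := fun j ω => inner ℝ (s j ω) q)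
      (fun j => ?_) (by positivity) (n₀ := n) (by omega) hN fun r _ => ?_
    · have h1 : Measurable fun x : EuclideanSpace ℝ (Fin n ⊕ Fin m) => inner ℝ x q := by fun_prop
      exact h1.comp (hsm j)
    · exact lintegral_exp_neg_sum_excitation_le hu hw hη h hSu hSw hφ hV₀φ hR q
        (by positivity) le_rfl r J
  calc _ ≤ P (⋃ q ∈ 𝒩, bad q) := by
        refine measure_mono ?_
        rintro ω ⟨h1, h2⟩
        by_contra hcon
        apply h2
        simp only [Set.mem_iUnion, not_exists] at hcon
        let lin : EuclideanSpace ℝ (Fin n ⊕ Fin m) →ₗ[ℝ] EuclideanSpace ℝ (Fin N) :=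
          (WithLp.linearEquiv 2 ℝ (Fin N → ℝ)).symm.toLinearMap ∘ₗ
            LinearMap.pi fun t : Fin N => (innerSL ℝ (s t ω)).toLinearMap
        have hp : ∀ q, ‖lin q‖ ^ 2 = ∑ j ∈ Finset.range N, (inner ℝ (s j ω) q) ^ 2 := by
          intro q
          rw [EuclideanSpace.norm_sq_eq, ← Fin.sum_univ_eq_sum_range
            (fun t => (inner ℝ (s t ω) q) ^ 2)]
          refine Finset.sum_congr rfl fun t _ => ?_
          change ‖inner ℝ (s t ω) q‖ ^ 2 = _
          rw [Real.norm_eq_abs, sq_abs]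
        have hL0 : 0 ≤ L := le_trans (Finset.sum_nonneg fun _ _ => sq_nonneg _) h1
        have hlam0 : 0 ≤ lam := le_trans (by positivity) hL
        have hup : ∀ q, ‖lin q‖ ≤ √L * ‖q‖ := by
          intro q
          refine le_of_sq_le_sq ?_ (by positivity)
          rw [mul_pow, Real.sq_sqrt hL0, hp]
          calc _ ≤ ∑ j ∈ Finset.range N, ‖s j ω‖ ^ 2 * ‖q‖ ^ 2 := by
                refine Finset.sum_le_sum fun j _ => ?_
                rw [← mul_pow, sq_le_sq, abs_of_nonneg (by positivity : 0 ≤ ‖s j ω‖ * ‖q‖)]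
                exact abs_real_inner_le_norm _ _
            _ = (∑ j ∈ Finset.range N, ‖s j ω‖ ^ 2) * ‖q‖ ^ 2 := by rw [Finset.sum_mul]
            _ ≤ _ := by gcongr
        -- Net points have norm at least 1/2, so their energy exceeds (n+2) J V₀ / 32, which is at
        -- least 4 lam. Passing from the net to the sphere then costs at most √L ε ≤ √lam.
        have hgood : ∀ q ∈ 𝒩, 2 * √lam ≤ ‖lin q‖ := by
          intro q hq
          have h3 : ((n + 2 : ℕ) : ℝ) * J * (V₀ * ‖q‖ ^ 2) / 8 <
            ∑ j ∈ Finset.range N, (inner ℝ (s j ω) q) ^ 2 := not_le.1 (hcon q hq)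
          rw [← hp] at h3
          refine le_of_sq_le_sq ?_ (norm_nonneg _)
          have hq1 : (1 / 2 : ℝ) ≤ ‖q‖ := by linarith [(hnorm q hq).1]
          have hq2 : (1 / 4 : ℝ) ≤ ‖q‖ ^ 2 := by nlinarith
          push_cast at h3
          have h4 : ((n : ℝ) + 2) * J * V₀ * (1 / 4) ≤ ((n : ℝ) + 2) * J * V₀ * ‖q‖ ^ 2 := by
            gcongr
          rw [mul_pow, Real.sq_sqrt hlam0]
          nlinarith
        have hunit : ∀ q, ‖q‖ = 1 → √lam ≤ ‖lin q‖ := by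
          intro q hq
          obtain ⟨p, hp𝒩, hpq⟩ := hnet q hq
          have h5 := hgood p hp𝒩
          have h6 : ‖lin p‖ ≤ ‖lin q‖ + ‖lin (q - p)‖ := by
            rw [map_sub]
            have := norm_sub_norm_le (lin p) (lin q)
            rw [norm_sub_rev] at this
            linarith
          have h7 : ‖lin (q - p)‖ ≤ √lam := by
            calc _ ≤ √L * ‖q - p‖ := hup _
              _ ≤ √L * ε := by gcongr
              _ = √(ε ^ 2 * L) := by
                  rw [Real.sqrt_mul (by positivity), Real.sqrt_sq hε.le, mul_comm]
              _ ≤ √lam := Real.sqrt_le_sqrt hL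
          linarith
        intro θ
        change lam * ‖θ‖ ^ 2 ≤ ∑ j ∈ Finset.range N, (inner ℝ (s j ω) θ) ^ 2
        rw [← hp]
        by_cases hθ : θ = 0
        · simp [hθ]
        have hθn : 0 < ‖θ‖ := norm_pos_iff.2 hθ
        have h8 := hunit (‖θ‖⁻¹ • θ) (by
          rw [norm_smul, norm_inv, norm_norm, inv_mul_cancel₀ hθn.ne'])
        rw [map_smul, norm_smul, norm_inv, norm_norm, le_inv_mul_iff₀ hθn] at h8
        calc lam * ‖θ‖ ^ 2 = (‖θ‖ * √lam) ^ 2 := by rw [mul_pow, Real.sq_sqrt hlam0]; ring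
          _ ≤ _ := by gcongr
    _ ≤ ∑ q ∈ 𝒩, P (bad q) := measure_biUnion_finset_le _ _
    _ ≤ ∑ _q ∈ 𝒩, ENNReal.ofReal (Real.exp (-(J / 2))) := Finset.sum_le_sum hbad
    _ = ENNReal.ofReal (𝒩.card * Real.exp (-(J / 2))) := by
        rw [Finset.sum_const, nsmul_eq_mul, ENNReal.ofReal_mul (by positivity),
          ENNReal.ofReal_natCast]
    _ ≤ _ := by
        refine ENNReal.ofReal_le_ofReal ?_
        gcongr

end SmallBall

/-! ### Operator norms and invertibility through vectors. -/

section Euclidean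

variable {ι κ : Type*} [Fintype κ] [DecidableEq κ]

lemma toEuclideanLin_sum_vecMulVec {α : Type*} (I : Finset α) (a : α → EuclideanSpace ℝ ι)
    (b : α → EuclideanSpace ℝ κ) (θ : EuclideanSpace ℝ κ) :
    Matrix.toEuclideanLin (∑ j ∈ I, Matrix.vecMulVec (a j).ofLp (b j).ofLp) θ =
      ∑ j ∈ I, (inner ℝ (b j) θ) • a j := by
  rw [map_sum, LinearMap.sum_apply]
  refine Finset.sum_congr rfl fun j _ => ?_
  ext i
  simp only [Matrix.toLpLin_apply, Matrix.vecMulVec_mulVec, PiLp.smul_apply, smul_eq_mul,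
    op_smul_eq_smul, Pi.smul_apply]
  rw [EuclideanSpace.inner_eq_star_dotProduct, star_trivial, dotProduct_comm]

lemma opNorm_le_of_forall [Fintype ι] {M : Matrix ι κ ℝ} {c : ℝ} (hc : 0 ≤ c)
    (h : ∀ p, ‖Matrix.toEuclideanLin M p‖ ≤ c * ‖p‖) : ‖M‖ ≤ c := by
  rw [Matrix.l2_opNorm_def]
  exact ContinuousLinearMap.opNorm_le_bound _ hc h

lemma toEuclideanLin_mul_apply {μ : Type*} [Fintype μ] [DecidableEq μ] (M : Matrix ι κ ℝ)
    (M' : Matrix κ μ ℝ) (p : EuclideanSpace ℝ μ) :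
    Matrix.toEuclideanLin (M * M') p = Matrix.toEuclideanLin M (Matrix.toEuclideanLin M' p) := by
  simp [Matrix.toLpLin_apply, Matrix.mulVec_mulVec]

lemma isUnit_of_norm_pos {M : Matrix κ κ ℝ} {c : ℝ} (hc : 0 < c)
    (h : ∀ p, c * ‖p‖ ≤ ‖Matrix.toEuclideanLin M p‖) : IsUnit M := by
  rw [← Matrix.mulVec_injective_iff_isUnit]
  intro x y hxy
  have h1 := h (WithLp.toLp 2 (x - y))
  have h2 : Matrix.toEuclideanLin M (WithLp.toLp 2 (x - y)) = 0 := by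
    simp only [Matrix.toLpLin_apply, Matrix.mulVec_sub]
    rw [hxy, sub_self]
    rfl
  rw [h2, norm_zero] at h1
  have h3 : ‖WithLp.toLp 2 (x - y)‖ = 0 := by
    refine le_antisymm ?_ (norm_nonneg _)
    by_contra hcon
    nlinarith
  exact sub_eq_zero.1 (congrArg WithLp.ofLp (norm_eq_zero.1 h3))

/-- If `‖V θ‖ ≤ c ‖M θ‖` for all `θ`, then `‖V M⁻¹‖ ≤ c`. -/
lemma opNorm_mul_inv_le [Fintype ι] {V : Matrix ι κ ℝ} {M : Matrix κ κ ℝ} (hM : IsUnit M) {c : ℝ} (hc : 0 ≤ c)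
    (h : ∀ θ, ‖Matrix.toEuclideanLin V θ‖ ≤ c * ‖Matrix.toEuclideanLin M θ‖) : ‖V * M⁻¹‖ ≤ c := by
  refine opNorm_le_of_forall hc fun p => ?_
  rw [toEuclideanLin_mul_apply]
  refine (h _).trans (le_of_eq ?_)
  rw [← toEuclideanLin_mul_apply, Matrix.mul_nonsing_inv _ ((Matrix.isUnit_iff_isUnit_det _).1 hM)]
  simp

end Euclidean

/-! ### The error bound on the good event. -/

section Deterministic

variable {n m : ℕ} {A : Matrix (Fin n) (Fin n) ℝ} {B : Matrix (Fin n) (Fin m) ℝ}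

lemma stack_blocks (θ : EuclideanSpace ℝ (Fin n ⊕ Fin m)) : stack (blockFst θ) (blockSnd θ) = θ := by
  ext i
  rcases i with i | i <;> rfl

@[simp] lemma blockFst_stack (x : EuclideanSpace ℝ (Fin n)) (u : EuclideanSpace ℝ (Fin m)) :
    blockFst (stack x u) = x := rfl

@[simp] lemma blockSnd_stack (x : EuclideanSpace ℝ (Fin n)) (u : EuclideanSpace ℝ (Fin m)) :
    blockSnd (stack x u) = u := rfl

lemma toEuclideanLin_fromCols_stack (A : Matrix (Fin n) (Fin n) ℝ) (B : Matrix (Fin n) (Fin m) ℝ)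
    (x : EuclideanSpace ℝ (Fin n)) (u : EuclideanSpace ℝ (Fin m)) :
    Matrix.toEuclideanLin (Matrix.fromCols A B) (stack x u) =
      Matrix.toEuclideanLin A x + Matrix.toEuclideanLin B u := by
  ext i
  simp [Matrix.toLpLin_apply, stack]

lemma sum_Ico_one_eq {M : Type*} [AddCommMonoid M] (f : ℕ → M) (T : ℕ) :
    ∑ t ∈ Finset.Ico 1 T, f t = ∑ j ∈ Finset.range (T - 1), f (j + 1) := by
  rw [Finset.sum_Ico_eq_sum_range]
  exact Finset.sum_congr rfl fun j _ => by rw [add_comm]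

lemma toEuclideanLin_ivGram (y : ℕ → EuclideanSpace ℝ (Fin n)) (u : ℕ → EuclideanSpace ℝ (Fin m))
    (T : ℕ) (θ : EuclideanSpace ℝ (Fin n ⊕ Fin m)) :
    Matrix.toEuclideanLin (ivGram y u T) θ = ∑ j ∈ Finset.range (T - 1),
      (inner ℝ (stack (y j) (u (j + 1))) θ) • stack (y (j + 1)) (u (j + 1)) := by
  rw [ivGram, sum_Ico_one_eq]
  exact toEuclideanLin_sum_vecMulVec _ (fun j => stack (y (j + 1)) (u (j + 1)))
    (fun j => stack (y j) (u (j + 1))) θ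

/-- The estimation error as a noise matrix times the inverse Gram matrix. -/
lemma ivEstimator_sub_eq (y v : ℕ → EuclideanSpace ℝ (Fin n)) (u : ℕ → EuclideanSpace ℝ (Fin m))
    (T : ℕ) (hM : IsUnit (ivGram y u T))
    (hv : ∀ j, y (j + 2) = Matrix.toEuclideanLin A (y (j + 1)) +
      Matrix.toEuclideanLin B (u (j + 1)) + v j) :
    ivEstimator y u T - Matrix.fromCols A B =
      (∑ j ∈ Finset.range (T - 1), Matrix.vecMulVec (v j).ofLp (stack (y j) (u (j + 1))).ofLp) *
        (ivGram y u T)⁻¹ := by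
  have hnum : ∑ t ∈ Finset.Ico 1 T, Matrix.vecMulVec (y (t + 1)).ofLp (instrument y u t) =
      Matrix.fromCols A B * ivGram y u T +
      ∑ j ∈ Finset.range (T - 1), Matrix.vecMulVec (v j).ofLp (stack (y j) (u (j + 1))).ofLp := by
    refine Matrix.toEuclideanLin.injective (LinearMap.ext fun θ => ?_)
    rw [sum_Ico_one_eq]
    change Matrix.toEuclideanLin (∑ j ∈ Finset.range (T - 1), Matrix.vecMulVec (y (j + 2)).ofLp
      (stack (y j) (u (j + 1))).ofLp) θ = _
    rw [map_add, LinearMap.add_apply, toEuclideanLin_mul_apply, toEuclideanLin_ivGram,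
      toEuclideanLin_sum_vecMulVec _ (fun j => y (j + 2)) (fun j => stack (y j) (u (j + 1))),
      toEuclideanLin_sum_vecMulVec _ v (fun j => stack (y j) (u (j + 1))), map_sum,
      ← Finset.sum_add_distrib]
    refine Finset.sum_congr rfl fun j _ => ?_
    rw [map_smul, toEuclideanLin_fromCols_stack, hv, smul_add]
  rw [ivEstimator, hnum, Matrix.add_mul, Matrix.mul_assoc,
    Matrix.mul_nonsing_inv _ ((Matrix.isUnit_iff_isUnit_det _).1 hM), Matrix.mul_one,
    add_sub_cancel_left]

set_option maxHeartbeats 1000000 in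
/-- The deterministic part of the error analysis. -/
lemma iv_error_le {x y w η : ℕ → EuclideanSpace ℝ (Fin n)} {u : ℕ → EuclideanSpace ℝ (Fin m)}
    (hx : ∀ t, x (t + 1) = Matrix.toEuclideanLin A (x t) + Matrix.toEuclideanLin B (u t) + w t)
    (hy : ∀ t, y t = x t + η t) {T : ℕ} {ψA φ lam c H K : ℝ} (hψ1 : 1 ≤ ψA) (hψA : ‖A‖ ≤ ψA)
    (hφ : 0 < φ) (hφ1 : φ ≤ 1)
    (hA : ∀ v : EuclideanSpace ℝ (Fin n), φ * ‖v‖ ≤ ‖Matrix.toEuclideanLin A v‖) (hlam : 0 < lam)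
    (hc : 0 ≤ c) (hcle : 5 * ψA * c ≤ φ * lam / 2) (hH : 0 ≤ H) (hK : 0 ≤ K)
    (hG : ∀ θ, lam * ‖θ‖ ^ 2 ≤ ∑ j ∈ Finset.range (T - 1), (inner ℝ (stack (x j) (u (j + 1))) θ) ^ 2)
    (hη : ∀ q, ∑ j ∈ Finset.range (T - 1), (inner ℝ q (η j)) ^ 2 ≤ H * ‖q‖ ^ 2)
    (c₁ : ∀ q p, |∑ j ∈ Finset.range (T - 1), inner ℝ q (η j) *
      inner ℝ (stack (x j) (u (j + 1))) p| ≤ c * ‖q‖ * ‖p‖)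
    (c₂ : ∀ q p, |∑ j ∈ Finset.range (T - 1), inner ℝ q (Matrix.toEuclideanLin B (u j)) *
      inner ℝ (y j) p| ≤ c * ‖q‖ * ‖p‖)
    (c₃ : ∀ q p, |∑ j ∈ Finset.range (T - 1), inner ℝ q (u (j + 1)) *
      inner ℝ (Matrix.toEuclideanLin B (u j)) p| ≤ c * ‖q‖ * ‖p‖)
    (c₄ : ∀ q p, |∑ j ∈ Finset.range (T - 1), inner ℝ q (w j) *
      inner ℝ (stack (y j) (u (j + 1))) p| ≤ c * ‖q‖ * ‖p‖)
    (c₅ : ∀ q p, |∑ j ∈ Finset.range (T - 1), inner ℝ q (η (j + 1)) *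
      inner ℝ (stack (y j) (u (j + 1))) p| ≤ c * ‖q‖ * ‖p‖)
    (v₁ : ∀ q θ, (∑ j ∈ Finset.range (T - 1), inner ℝ q (w (j + 1)) *
      inner ℝ (stack (y j) (u (j + 1))) θ) ^ 2 ≤ K * ‖q‖ ^ 2 *
        (∑ j ∈ Finset.range (T - 1), (inner ℝ (stack (y j) (u (j + 1))) θ) ^ 2 + lam * ‖θ‖ ^ 2))
    (v₂ : ∀ q θ, (∑ j ∈ Finset.range (T - 1), inner ℝ q (η (j + 2)) *
      inner ℝ (stack (y j) (u (j + 1))) θ) ^ 2 ≤ K * ‖q‖ ^ 2 *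
        (∑ j ∈ Finset.range (T - 1), (inner ℝ (stack (y j) (u (j + 1))) θ) ^ 2 + lam * ‖θ‖ ^ 2))
    (v₃ : ∀ q θ, (∑ j ∈ Finset.range (T - 1), inner ℝ q (η (j + 1)) *
      inner ℝ (stack (y j) (u (j + 1))) θ) ^ 2 ≤ K * ‖q‖ ^ 2 *
        (∑ j ∈ Finset.range (T - 1), (inner ℝ (stack (y j) (u (j + 1))) θ) ^ 2 + lam * ‖θ‖ ^ 2)) :
    IsUnit (ivGram y u T) ∧ ‖ivEstimator y u T - Matrix.fromCols A B‖ ≤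
      6 * ψA / φ * √(K * (3 / lam + 2 * H / lam ^ 2)) := by
  have hψ0 : 0 < ψA := by linarith
  set I := Finset.range (T - 1) with hI
  set s : ℕ → EuclideanSpace ℝ (Fin n ⊕ Fin m) := fun j => stack (x j) (u (j + 1)) with hs
  set z : ℕ → EuclideanSpace ℝ (Fin n ⊕ Fin m) := fun j => stack (y j) (u (j + 1)) with hz
  have hzs : ∀ j θ, inner ℝ (z j) θ = inner ℝ (s j) θ + inner ℝ (blockFst θ) (η j) := by
    intro j θ
    simp only [hz, hs, inner_stack, hy, inner_add_left, real_inner_comm (blockFst θ) (η j)]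
    ring
  -- The vector g = ∑ ⟨s_j, θ⟩ s_j mediates: it bounds the Gram matrix from below and the
  -- normalization of the noise from above.
  have hgram : ∀ θ, ∃ g : EuclideanSpace ℝ (Fin n ⊕ Fin m),
      lam * ‖θ‖ ≤ ‖g‖ ∧ φ / 2 * ‖g‖ ≤ ‖Matrix.toEuclideanLin (ivGram y u T) θ‖ ∧
      ∑ j ∈ I, (inner ℝ (z j) θ) ^ 2 + lam * ‖θ‖ ^ 2 ≤ (3 / lam + 2 * H / lam ^ 2) * ‖g‖ ^ 2 := by
    intro θ
    set g := ∑ j ∈ I, (inner ℝ (s j) θ) • s j with hg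
    have hQ : ∑ j ∈ I, (inner ℝ (s j) θ) ^ 2 ≤ ‖θ‖ * ‖g‖ := by
      have : ∑ j ∈ I, (inner ℝ (s j) θ) ^ 2 = inner ℝ θ g := by
        rw [hg, inner_sum]
        refine Finset.sum_congr rfl fun j _ => ?_
        rw [inner_smul_right, real_inner_comm θ (s j)]
        rw [real_inner_comm]
        ring
      rw [this]
      exact real_inner_le_norm _ _
    have hθg : lam * ‖θ‖ ≤ ‖g‖ := by
      by_cases h0 : ‖θ‖ = 0
      · rw [h0, mul_zero]
        exact norm_nonneg _
      · have hpos : 0 < ‖θ‖ := lt_of_le_of_ne (norm_nonneg _) (Ne.symm h0)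
        have := (hG θ).trans hQ
        nlinarith
    refine ⟨g, hθg, ?_, ?_⟩
    · set Dg := stack (Matrix.toEuclideanLin A (blockFst g)) (blockSnd g) with hDg
      have hDn : φ * ‖g‖ ≤ ‖Dg‖ := by
        refine le_of_sq_le_sq ?_ (norm_nonneg _)
        rw [mul_pow, norm_sq_stack, norm_sq_eq_blocks g, mul_add, ← mul_pow, ← mul_pow]
        have h1 := hA (blockFst g)
        have h2 : φ * ‖blockSnd g‖ ≤ ‖blockSnd g‖ := mul_le_of_le_one_left (norm_nonneg _) hφ1
        gcongr
      set Mθ := Matrix.toEuclideanLin (ivGram y u T) θ with hMθ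
      -- The matrix minus D ∑ s sᵀ has five cross terms, each at most ψA c ‖p‖ ‖θ‖; only the first
      -- needs the factor ψA, through p' = Dᵀp.
      have hdiff : ∀ p, |inner ℝ p (Mθ - Dg)| ≤ 5 * ψA * c * ‖p‖ * ‖θ‖ := by
        intro p
        set p' := stack (Matrix.toEuclideanLin Aᵀ (blockFst p)) (blockSnd p) with hp'
        have hp'n : ‖p'‖ ≤ ψA * ‖p‖ := by
          refine le_of_sq_le_sq ?_ (by positivity)
          have h1 := norm_toEuclideanLin_le Aᵀ (blockFst p)
          rw [norm_transpose_eq] at h1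
          have h2 : ‖Matrix.toEuclideanLin Aᵀ (blockFst p)‖ ≤ ψA * ‖blockFst p‖ :=
            h1.trans (by gcongr)
          have h3 : ‖blockSnd p‖ ≤ ψA * ‖blockSnd p‖ :=
            le_mul_of_one_le_left (norm_nonneg _) hψ1
          rw [hp', norm_sq_stack, mul_pow, norm_sq_eq_blocks p, mul_add, ← mul_pow, ← mul_pow]
          gcongr
        have hM1 : inner ℝ p Mθ = ∑ j ∈ I, inner ℝ (z j) θ *
            (inner ℝ (s j) p' + inner ℝ (blockFst p) (Matrix.toEuclideanLin B (u j)) +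
              inner ℝ (blockFst p) (w j) + inner ℝ (blockFst p) (η (j + 1))) := by
          rw [hMθ, toEuclideanLin_ivGram, inner_sum]
          refine Finset.sum_congr rfl fun j _ => ?_
          rw [inner_smul_right, real_inner_comm _ p]
          have e : inner ℝ p (stack (y (j + 1)) (u (j + 1))) =
              inner ℝ (s j) p' + inner ℝ (blockFst p) (Matrix.toEuclideanLin B (u j)) +
              inner ℝ (blockFst p) (w j) + inner ℝ (blockFst p) (η (j + 1)) := by
            have e1 : inner ℝ (s j) p' =
                inner ℝ (x j) (Matrix.toEuclideanLin Aᵀ (blockFst p)) +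
                  inner ℝ (u (j + 1)) (blockSnd p) := inner_stack _ _ _
            rw [real_inner_comm, inner_stack, hy, hx, e1, real_inner_comm (blockFst p),
              real_inner_comm (Matrix.toEuclideanLin Aᵀ (blockFst p)) (x j)]
            simp only [inner_add_right, inner_toEuclideanLin_right A]
            ring
          rw [real_inner_comm p, e]
        have hD1 : inner ℝ p Dg = ∑ j ∈ I, inner ℝ (s j) θ * inner ℝ (s j) p' := by
          have : inner ℝ p Dg = inner ℝ g p' := by
            rw [real_inner_comm, hDg, inner_stack, ← stack_blocks g, inner_stack]
            simp only [hp', blockFst_stack, blockSnd_stack]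
            rw [real_inner_comm, inner_toEuclideanLin_right,
              real_inner_comm (Matrix.toEuclideanLin Aᵀ (blockFst p))]
          rw [this, hg, sum_inner]
          refine Finset.sum_congr rfl fun j _ => ?_
          rw [inner_smul_left]
          rfl
        -- The new regressor is D s_j plus B u_j + w_j + η_{j+1} in its first block. The term with B
        -- u_j is split because z_j contains the later input u_{j+1}: against y_j the fresh factor
        -- is B u_j, against u_{j+1} it is u_{j+1}.
        have hsplit : inner ℝ p (Mθ - Dg) =
            ∑ j ∈ I, inner ℝ (blockFst θ) (η j) * inner ℝ (s j) p' +
            ∑ j ∈ I, inner ℝ (blockFst p) (Matrix.toEuclideanLin B (u j)) *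
              inner ℝ (y j) (blockFst θ) +
            ∑ j ∈ I, inner ℝ (blockSnd θ) (u (j + 1)) *
              inner ℝ (Matrix.toEuclideanLin B (u j)) (blockFst p) +
            ∑ j ∈ I, inner ℝ (blockFst p) (w j) * inner ℝ (z j) θ +
            ∑ j ∈ I, inner ℝ (blockFst p) (η (j + 1)) * inner ℝ (z j) θ := by
          rw [inner_sub_right, hM1, hD1, ← Finset.sum_sub_distrib, ← Finset.sum_add_distrib,
            ← Finset.sum_add_distrib, ← Finset.sum_add_distrib, ← Finset.sum_add_distrib]
          refine Finset.sum_congr rfl fun j _ => ?_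
          have e1 := hzs j θ
          have e2 : inner ℝ (z j) θ = inner ℝ (y j) (blockFst θ) +
            inner ℝ (u (j + 1)) (blockSnd θ) := inner_stack _ _ _
          rw [real_inner_comm (blockSnd θ)] at e2
          have e3 := real_inner_comm (Matrix.toEuclideanLin B (u j)) (blockFst p)
          linear_combination inner ℝ (s j) p' * e1 +
            inner ℝ (blockFst p) (Matrix.toEuclideanLin B (u j)) * e2 +
            inner ℝ (blockSnd θ) (u (j + 1)) * e3
        have n1 := norm_blockFst_le θ
        have n2 := norm_blockSnd_le θ
        have n3 := norm_blockFst_le p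
        have b1 : |∑ j ∈ I, inner ℝ (blockFst θ) (η j) * inner ℝ (s j) p'| ≤
            ψA * (c * ‖p‖ * ‖θ‖) :=
          (c₁ _ _).trans (by
            calc c * ‖blockFst θ‖ * ‖p'‖ ≤ c * ‖θ‖ * (ψA * ‖p‖) := by gcongr
              _ = _ := by ring)
        have b2 : |∑ j ∈ I, inner ℝ (blockFst p) (Matrix.toEuclideanLin B (u j)) *
              inner ℝ (y j) (blockFst θ)| ≤ c * ‖p‖ * ‖θ‖ := (c₂ _ _).trans (by gcongr)
        have b3 : |∑ j ∈ I, inner ℝ (blockSnd θ) (u (j + 1)) *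
              inner ℝ (Matrix.toEuclideanLin B (u j)) (blockFst p)| ≤ c * ‖p‖ * ‖θ‖ :=
          (c₃ _ _).trans (by
            calc _ ≤ c * ‖θ‖ * ‖p‖ := by gcongr
              _ = _ := by ring)
        have b4 : |∑ j ∈ I, inner ℝ (blockFst p) (w j) * inner ℝ (z j) θ| ≤ c * ‖p‖ * ‖θ‖ :=
          (c₄ _ _).trans (by gcongr)
        have b5 : |∑ j ∈ I, inner ℝ (blockFst p) (η (j + 1)) * inner ℝ (z j) θ| ≤
            c * ‖p‖ * ‖θ‖ := (c₅ _ _).trans (by gcongr)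
        have hcp : 0 ≤ c * ‖p‖ * ‖θ‖ := by positivity
        have hcψ : c * ‖p‖ * ‖θ‖ ≤ ψA * (c * ‖p‖ * ‖θ‖) := le_mul_of_one_le_left hcp hψ1
        rw [hsplit]
        refine (abs_add_le _ _).trans ?_
        refine (add_le_add (abs_add_le _ _) b5).trans ?_
        refine (add_le_add_left (add_le_add (abs_add_le _ _) b4) _).trans ?_
        refine (add_le_add_left (add_le_add_left (add_le_add (abs_add_le _ _) b3) _) _).trans ?_
        refine (add_le_add_left (add_le_add_left (add_le_add_left (add_le_add b1 b2) _) _) _).trans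
          ?_
        linarith
      have hnorm : ‖Mθ - Dg‖ ≤ φ / 2 * ‖g‖ := by
        have h1 := hdiff (Mθ - Dg)
        rw [real_inner_self_eq_norm_sq, abs_of_nonneg (by positivity)] at h1
        have h2 : 5 * ψA * c * ‖θ‖ ≤ φ / 2 * ‖g‖ := by
          calc _ ≤ φ * lam / 2 * ‖θ‖ := by gcongr
            _ = φ / 2 * (lam * ‖θ‖) := by ring
            _ ≤ _ := by gcongr
        by_cases h0 : ‖Mθ - Dg‖ = 0
        · rw [h0]
          positivity
        · have hpos : 0 < ‖Mθ - Dg‖ := lt_of_le_of_ne (norm_nonneg _) (Ne.symm h0)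
          have h3 : ‖Mθ - Dg‖ * ‖Mθ - Dg‖ ≤ (φ / 2 * ‖g‖) * ‖Mθ - Dg‖ := by
            calc _ = ‖Mθ - Dg‖ ^ 2 := by ring
              _ ≤ _ := h1
              _ = (5 * ψA * c * ‖θ‖) * ‖Mθ - Dg‖ := by ring
              _ ≤ _ := by gcongr
          exact le_of_mul_le_mul_right h3 hpos
      have := norm_sub_norm_le Dg (Dg - Mθ)
      rw [sub_sub_cancel, norm_sub_rev] at this
      linarith
    -- Since z_j is s_j with η_j added to its first block, its energy is at most 2 ‖θ‖ ‖g‖ + 2H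
    -- ‖θ‖²; the third 1/lam comes from lam ‖θ‖² ≤ ‖θ‖ ‖g‖.
    · have h1 : ∑ j ∈ I, (inner ℝ (z j) θ) ^ 2 ≤ 2 * ∑ j ∈ I, (inner ℝ (s j) θ) ^ 2 +
          2 * ∑ j ∈ I, (inner ℝ (blockFst θ) (η j)) ^ 2 := by
        rw [Finset.mul_sum, Finset.mul_sum, ← Finset.sum_add_distrib]
        refine Finset.sum_le_sum fun j _ => ?_
        rw [hzs]
        nlinarith [sq_nonneg (inner ℝ (s j) θ - inner ℝ (blockFst θ) (η j))]
      have h2 := hη (blockFst θ)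
      have h3 : ‖blockFst θ‖ ^ 2 ≤ ‖θ‖ ^ 2 := by
        have := norm_blockFst_le θ
        gcongr
      have h4 := hG θ
      have h5 : ‖θ‖ ≤ ‖g‖ / lam := by rw [le_div_iff₀ hlam]; linarith
      calc _ ≤ 3 * (‖θ‖ * ‖g‖) + 2 * (H * ‖θ‖ ^ 2) := by
            have : H * ‖blockFst θ‖ ^ 2 ≤ H * ‖θ‖ ^ 2 := by gcongr
            linarith
        _ ≤ 3 * (‖g‖ / lam * ‖g‖) + 2 * (H * (‖g‖ / lam) ^ 2) := by gcongr
        _ = _ := by field_simp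
  have hU : IsUnit (ivGram y u T) := by
    refine isUnit_of_norm_pos (c := φ / 2 * lam) (by positivity) fun θ => ?_
    obtain ⟨g, h1, h2, -⟩ := hgram θ
    calc _ = φ / 2 * (lam * ‖θ‖) := by ring
      _ ≤ φ / 2 * ‖g‖ := by gcongr
      _ ≤ _ := h2
  refine ⟨hU, ?_⟩
  rw [ivEstimator_sub_eq (A := A) (B := B) y
    (fun j => w (j + 1) + η (j + 2) - Matrix.toEuclideanLin A (η (j + 1))) u T hU (fun j => by
      rw [hy, hy, hx (j + 1), map_add]
      abel)]
  refine opNorm_mul_inv_le hU (by positivity) fun θ => ?_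
  obtain ⟨g, -, h2, h3⟩ := hgram θ
  rw [toEuclideanLin_sum_vecMulVec]
  set R := ∑ j ∈ I, (inner ℝ (z j) θ) ^ 2 + lam * ‖θ‖ ^ 2 with hR
  have hR0 : 0 ≤ R := by positivity
  set V := ∑ j ∈ I, (inner ℝ (z j) θ) •
    (w (j + 1) + η (j + 2) - Matrix.toEuclideanLin A (η (j + 1))) with hV
  have hsq : ∀ {a : ℝ} (q : EuclideanSpace ℝ (Fin n)), a ^ 2 ≤ K * ‖q‖ ^ 2 * R →
      |a| ≤ ‖q‖ * √(K * R) := by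
    intro a q h
    refine abs_le_of_sq_le_sq ?_ (by positivity)
    rw [mul_pow, Real.sq_sqrt (by positivity)]
    linarith
  -- V is paired with itself, which is possible because the noise bounds hold uniformly in the
  -- direction q, even a random one.
  have hVq : ‖V‖ ^ 2 ≤ 3 * ψA * √(K * R) * ‖V‖ := by
    rw [← real_inner_self_eq_norm_sq]
    have e : inner ℝ V V = ∑ j ∈ I, inner ℝ V (w (j + 1)) * inner ℝ (z j) θ +
        ∑ j ∈ I, inner ℝ V (η (j + 2)) * inner ℝ (z j) θ -
        ∑ j ∈ I, inner ℝ (Matrix.toEuclideanLin Aᵀ V) (η (j + 1)) * inner ℝ (z j) θ := by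
      conv_lhs => arg 3; rw [hV]
      rw [inner_sum, ← Finset.sum_add_distrib, ← Finset.sum_sub_distrib]
      refine Finset.sum_congr rfl fun j _ => ?_
      rw [inner_smul_right, inner_sub_right, inner_add_right, inner_toEuclideanLin_right A]
      ring
    have t1 := hsq V (v₁ V θ)
    have t2 := hsq V (v₂ V θ)
    have t3 := hsq (Matrix.toEuclideanLin Aᵀ V) (v₃ (Matrix.toEuclideanLin Aᵀ V) θ)
    have h4 := norm_toEuclideanLin_le Aᵀ V
    rw [norm_transpose_eq] at h4
    have h5 : ‖Matrix.toEuclideanLin Aᵀ V‖ * √(K * R) ≤ ψA * (‖V‖ * √(K * R)) := by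
      calc _ ≤ (ψA * ‖V‖) * √(K * R) := by gcongr; exact h4.trans (by gcongr)
        _ = _ := by ring
    have h6 : 0 ≤ ‖V‖ * √(K * R) := by positivity
    rw [e]
    rw [abs_le] at t1 t2 t3
    nlinarith
  have hVn : ‖V‖ ≤ 3 * ψA * √(K * R) := by
    by_cases h0 : ‖V‖ = 0
    · rw [h0]; positivity
    · have hpos : 0 < ‖V‖ := lt_of_le_of_ne (norm_nonneg _) (Ne.symm h0)
      rw [sq] at hVq
      exact le_of_mul_le_mul_right hVq hpos
  have hg : ‖g‖ ≤ 2 / φ * ‖Matrix.toEuclideanLin (ivGram y u T) θ‖ := by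
    rw [div_mul_eq_mul_div, le_div_iff₀ hφ]
    linarith
  have hgap : 0 ≤ 3 / lam + 2 * H / lam ^ 2 := by positivity
  calc ‖V‖ ≤ 3 * ψA * √(K * R) := hVn
    _ ≤ 3 * ψA * √(K * ((3 / lam + 2 * H / lam ^ 2) * ‖g‖ ^ 2)) := by gcongr
    _ = 3 * ψA * (√(K * (3 / lam + 2 * H / lam ^ 2)) * ‖g‖) := by
        rw [← mul_assoc K, Real.sqrt_mul (by positivity), Real.sqrt_sq (norm_nonneg _)]
    _ ≤ 3 * ψA * (√(K * (3 / lam + 2 * H / lam ^ 2)) *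
        (2 / φ * ‖Matrix.toEuclideanLin (ivGram y u T) θ‖)) := by gcongr
    _ = _ := by ring

end Deterministic

/-! ### Good events and their probabilities. -/

section Events

variable {Ω : Type*} {mΩ : MeasurableSpace Ω} {P : Measure Ω} {𝓕 : ℕ → MeasurableSpace Ω}

lemma measure_not_and_le {p₁ p₂ : Ω → Prop} {a b : ℝ} (ha : 0 ≤ a) (hb : 0 ≤ b)
    (h₁ : P {ω | ¬ p₁ ω} ≤ ENNReal.ofReal a) (h₂ : P {ω | ¬ p₂ ω} ≤ ENNReal.ofReal b) :
    P {ω | ¬ (p₁ ω ∧ p₂ ω)} ≤ ENNReal.ofReal (a + b) := by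
  rw [ENNReal.ofReal_add ha hb]
  refine le_trans (measure_mono ?_) ((measure_union_le _ _).trans (add_le_add h₁ h₂))
  intro ω hω
  exact not_and_or.1 hω

lemma measure_sum_norm_sq_not_le {κ : Type*} [Fintype κ] [DecidableEq κ]
    (hκ : 0 < Fintype.card κ) {X : ℕ → Ω → EuclideanSpace ℝ κ} {s δ : ℝ} (hs : 0 < s) (hδ : 0 < δ)
    (hX : ∀ t, IsGaussianVec P (X t) s) {T : ℕ} (hT : 0 < T) :
    P {ω | ¬ ∑ t ∈ Finset.range T, ‖X t ω‖ ^ 2 ≤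
      T * Fintype.card κ * s * (4 * Real.log (2 / δ))} ≤ ENNReal.ofReal δ := by
  refine le_trans (measure_mono ?_) (measure_sum_norm_sq_gt_le hκ hs hδ hX hT)
  intro ω hω
  exact (not_le.1 hω).le

variable [IsProbabilityMeasure P]

/-- Uniform bound for a bilinear noise term whose predictable factor has total energy at most
`L`. -/
lemma measure_crossTerm_gt_le {ι κ : Type*} [Fintype ι] [DecidableEq ι] [Fintype κ] [DecidableEq κ]
    {g : ℕ → Ω → EuclideanSpace ℝ ι} {s : ℝ} (hg : Innovations P 𝓕 g s) (hs : 0 < s)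
    {a : ℕ → Ω → EuclideanSpace ℝ κ} (ha : ∀ t, Measurable[𝓕 t] (a t)) {L δ c d : ℝ}
    (hL : 0 < L) (hδ : 0 < δ) (hδ1 : δ ≤ 1) (hι : 0 < Fintype.card ι) (hκ : 0 < Fintype.card κ)
    (hd : (Fintype.card ι : ℝ) ≤ d) (hc0 : 0 ≤ c)
    (hc : 9 * s * (2 * d * Real.log (10 * d) + 2 * Real.log (1 / δ) + 1) * (2 * L) ≤ c ^ 2)
    (N : ℕ) :
    P {ω | ¬ (∑ t ∈ Finset.range N, ‖a t ω‖ ^ 2 ≤ L → ∀ q p,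
      |∑ t ∈ Finset.range N, inner ℝ q (g t ω) * inner ℝ (a t ω) p| ≤ c * ‖q‖ * ‖p‖)} ≤
        ENNReal.ofReal δ := by
  -- Regularizing with lam = L makes the determinant term at most 1 and the normalization at most 2L
  -- ‖p‖².
  refine le_trans (measure_mono ?_)
    (measure_selfNormalized_le hg hs ha hL hL.le hδ hδ1 hι hκ N)
  intro ω hω
  rw [Set.mem_ofPred_eq, Classical.not_imp] at hω
  refine ⟨hω.1, fun hcon => hω.2 fun q p => ?_⟩
  have hkap : (0 : ℝ) < Fintype.card κ := by exact_mod_cast hκ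
  have hiot : (1 : ℝ) ≤ Fintype.card ι := by exact_mod_cast hι
  have hd0 : 0 ≤ d := by linarith
  have h1 : (Fintype.card κ : ℝ) * Real.log (1 + L / (Fintype.card κ * L)) ≤ 1 := by
    have : Real.log (1 + L / (Fintype.card κ * L)) ≤ L / (Fintype.card κ * L) := by
      have := Real.log_le_sub_one_of_pos (show 0 < 1 + L / (Fintype.card κ * L) by positivity)
      linarith
    calc _ ≤ (Fintype.card κ : ℝ) * (L / (Fintype.card κ * L)) := by gcongr
      _ = 1 := by field_simp
  have h2 : 2 * (Fintype.card ι : ℝ) * Real.log (10 * Fintype.card ι) ≤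
      2 * d * Real.log (10 * d) := by
    have : 0 ≤ Real.log (10 * Fintype.card ι) := Real.log_nonneg (by linarith)
    gcongr
  have h3 : ∑ t ∈ Finset.range N, (inner ℝ (a t ω) p) ^ 2 ≤ L * ‖p‖ ^ 2 := by
    refine le_trans (Finset.sum_le_sum fun t _ => ?_) ((Finset.sum_mul _ _ _).symm.le.trans
      (mul_le_mul_of_nonneg_right hω.1 (sq_nonneg _)))
    rw [← mul_pow, ← sq_abs]
    have := abs_real_inner_le_norm (a t ω) p
    gcongr
  have hlogδ : 0 ≤ Real.log (1 / δ) := Real.log_nonneg (by rw [le_div_iff₀ hδ]; linarith)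
  have hlogd : 0 ≤ Real.log (10 * d) := Real.log_nonneg (by linarith)
  refine abs_le_of_sq_le_sq ((hcon q p).trans ?_) (by positivity)
  calc _ ≤ 9 * s * (2 * d * Real.log (10 * d) + 2 * Real.log (1 / δ) + 1) * ‖q‖ ^ 2 *
        (L * ‖p‖ ^ 2 + L * ‖p‖ ^ 2) := by gcongr
    _ = 9 * s * (2 * d * Real.log (10 * d) + 2 * Real.log (1 / δ) + 1) * (2 * L) *
        (‖q‖ ^ 2 * ‖p‖ ^ 2) := by ring
    _ ≤ c ^ 2 * (‖q‖ ^ 2 * ‖p‖ ^ 2) := by gcongr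
    _ = _ := by ring

lemma measure_noiseTerm_gt_le {ι κ : Type*} [Fintype ι] [DecidableEq ι] [Fintype κ] [DecidableEq κ]
    {g : ℕ → Ω → EuclideanSpace ℝ ι} {s : ℝ} (hg : Innovations P 𝓕 g s) (hs : 0 < s)
    {a : ℕ → Ω → EuclideanSpace ℝ κ} (ha : ∀ t, Measurable[𝓕 t] (a t)) {lam L δ K : ℝ}
    (hlam : 0 < lam) (hL : 0 ≤ L) (hδ : 0 < δ) (hδ1 : δ ≤ 1) (hι : 0 < Fintype.card ι)
    (hκ : 0 < Fintype.card κ)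
    (hK : 9 * s * (2 * Fintype.card ι * Real.log (10 * Fintype.card ι) + 2 * Real.log (1 / δ) +
          Fintype.card κ * Real.log (1 + L / (Fintype.card κ * lam))) ≤ K) (N : ℕ) :
    P {ω | ¬ (∑ t ∈ Finset.range N, ‖a t ω‖ ^ 2 ≤ L → ∀ q θ,
      (∑ t ∈ Finset.range N, inner ℝ q (g t ω) * inner ℝ (a t ω) θ) ^ 2 ≤ K * ‖q‖ ^ 2 *
        (∑ t ∈ Finset.range N, (inner ℝ (a t ω) θ) ^ 2 + lam * ‖θ‖ ^ 2))} ≤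
        ENNReal.ofReal δ := by
  refine le_trans (measure_mono ?_)
    (measure_selfNormalized_le hg hs ha hlam hL hδ hδ1 hι hκ N)
  intro ω hω
  rw [Set.mem_ofPred_eq, Classical.not_imp] at hω
  refine ⟨hω.1, fun hcon => hω.2 fun q p => (hcon q p).trans ?_⟩
  gcongr

end Events

/-! ### Assembling the probabilistic estimates. -/

section Main

variable {Ω : Type*} {mΩ : MeasurableSpace Ω} {P : Measure Ω} [IsProbabilityMeasure P] {n m : ℕ}
  {u : ℕ → Ω → EuclideanSpace ℝ (Fin m)} {w η : ℕ → Ω → EuclideanSpace ℝ (Fin n)}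
  {Su : Matrix (Fin m) (Fin m) ℝ} {Sw Sη : Matrix (Fin n) (Fin n) ℝ}
  {A : Matrix (Fin n) (Fin n) ℝ} {B : Matrix (Fin n) (Fin m) ℝ}

lemma sum_norm_sq_succ_le {E : Type*} [SeminormedAddCommGroup E] (f : ℕ → E) (N : ℕ) :
    ∑ j ∈ Finset.range N, ‖f (j + 1)‖ ^ 2 ≤ ∑ j ∈ Finset.range (N + 1), ‖f j‖ ^ 2 := by
  rw [Finset.sum_range_succ']
  have : 0 ≤ ‖f 0‖ ^ 2 := by positivity
  linarith

lemma sum_norm_sq_le_succ {E : Type*} [SeminormedAddCommGroup E] (f : ℕ → E) (N : ℕ) :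
    ∑ j ∈ Finset.range N, ‖f j‖ ^ 2 ≤ ∑ j ∈ Finset.range (N + 1), ‖f j‖ ^ 2 := by
  rw [Finset.sum_range_succ]
  have : 0 ≤ ‖f N‖ ^ 2 := by positivity
  linarith

set_option maxHeartbeats 1000000 in
/-- The probabilistic part of the error analysis, for measurable noise and abstract thresholds. -/
lemma measure_iv_error_gt_le (hu : ∀ t, Measurable (u t)) (hw : ∀ t, Measurable (w t))
    (hη : ∀ t, Measurable (η t)) (h : IsGaussianNoise P Su Sw Sη u w η) (hSu : Su.PosSemidef)
    (hSw : Sw.PosSemidef) (hSη : Sη.PosSemidef) (hn : 0 < n) (hm : 0 < m)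
    {φ V₀ ψ σ ψA φA δ : ℝ} (hV₀ : 0 < V₀)
    (hφ : ∀ q : EuclideanSpace ℝ (Fin m), φ * ‖q‖ ^ 2 ≤ q.ofLp ⬝ᵥ Su *ᵥ q.ofLp)
    (hV₀φ : V₀ ≤ φ)
    (hR : ∀ q : EuclideanSpace ℝ (Fin n), V₀ * ‖q‖ ^ 2 ≤ φ * ∑ i ∈ Finset.range n,
      ‖Matrix.toEuclideanLin Bᵀ ((Matrix.toEuclideanLin Aᵀ ^ i) q)‖ ^ 2)
    (hψ : 0 < ψ) (hψσ : ψ ≤ σ) (hBψ : ‖B‖ ^ 2 * ‖Su‖ ≤ ψ) (huψ : ‖Su‖ ≤ ψ) (hwψ : ‖Sw‖ ≤ ψ)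
    (hηψ : ‖Sη‖ ≤ ψ)
    (hx : ∀ t, IsGaussianVec P (fun ω => state A B (fun i => u i ω) (fun i => w i ω) t) σ)
    (hψA1 : 1 ≤ ψA) (hψA : ‖A‖ ≤ ψA) (hφA : 0 < φA) (hφA1 : φA ≤ 1)
    (hA : ∀ v : EuclideanSpace ℝ (Fin n), φA * ‖v‖ ≤ ‖Matrix.toEuclideanLin A v‖)
    (hδ : 0 < δ) (hδ1 : δ ≤ 1) {T N J : ℕ} {ε L lam K c H : ℝ} (hT : T = N + 1)
    (hLdef : L = 16 * T * ((n : ℝ) + m) * σ * Real.log (2 / δ)) (hlam : 0 < lam)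
    (hJ : n + (n + 2) * J ≤ N) (hlamJ : lam ≤ (n + 2) * J * V₀ / 128) (hε : 0 < ε)
    (hε1 : ε ≤ 1 / 2) (hεL : ε ^ 2 * L ≤ lam)
    (hsmall : (5 * ((n : ℝ) + m) / ε) ^ (n + m) * Real.exp (-(J / 2)) ≤ δ)
    (hH : 9 * ψ * (2 * N + 4 * n * Real.log (10 * n) + 4 * Real.log (1 / δ)) ≤ H)
    (hc0 : 0 ≤ c)
    (hc : 9 * ψ * (2 * ((n : ℝ) + m) * Real.log (10 * ((n : ℝ) + m)) + 2 * Real.log (1 / δ) + 1) *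
      (2 * L) ≤ c ^ 2) (hcle : 5 * ψA * c ≤ φA * lam / 2)
    (hK : 9 * ψ * (2 * n * Real.log (10 * n) + 2 * Real.log (1 / δ) +
      ((n : ℝ) + m) * Real.log (1 + L / (((n : ℝ) + m) * lam))) ≤ K) :
    P {ω | ¬ (IsUnit (ivGram (obs A B (fun i => u i ω) (fun i => w i ω) (fun i => η i ω))
        (fun i => u i ω) T) ∧
      ‖ivEstimator (obs A B (fun i => u i ω) (fun i => w i ω) (fun i => η i ω))
        (fun i => u i ω) T - Matrix.fromCols A B‖ ≤
        6 * ψA / φA * √(K * (3 / lam + 2 * H / lam ^ 2)))} ≤ ENNReal.ofReal (14 * δ) := by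
  have hcn : (Fintype.card (Fin n) : ℝ) = n := by simp
  have hcm : (Fintype.card (Fin m) : ℝ) = m := by simp
  have hcd : (Fintype.card (Fin n ⊕ Fin m) : ℝ) = n + m := by simp
  have hcn0 : 0 < Fintype.card (Fin n) := by simpa using hn
  have hcm0 : 0 < Fintype.card (Fin m) := by simpa using hm
  have hcd0 : 0 < Fintype.card (Fin n ⊕ Fin m) := by simp; omega
  have hn1 : (1 : ℝ) ≤ n := by exact_mod_cast hn
  have hm1 : (1 : ℝ) ≤ m := by exact_mod_cast hm
  have hσ : 0 < σ := hψ.trans_le hψσ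
  have hT0 : 0 < T := by omega
  have hTr : (0 : ℝ) < T := by exact_mod_cast hT0
  have hℓ : 0 < Real.log (2 / δ) := Real.log_pos (by rw [lt_div_iff₀ hδ]; linarith)
  have hL : 0 < L := by rw [hLdef]; positivity
  have hlogn : 0 ≤ Real.log (10 * n) := Real.log_nonneg (by linarith)
  have hlogδ : 0 ≤ Real.log (1 / δ) := Real.log_nonneg (by rw [le_div_iff₀ hδ]; linarith)
  have hH0 : 0 ≤ H := le_trans (by positivity) hH
  have hlogL : 0 ≤ Real.log (1 + L / (((n : ℝ) + m) * lam)) :=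
    Real.log_nonneg (le_add_of_nonneg_right (by positivity))
  have hK0 : 0 ≤ K := le_trans (by positivity) hK
  -- Laws of the innovations.
  have lu : ∀ t, IsGaussianVec P (u t) ψ := fun t =>
    (isGaussianVec_of_hasLaw hSu (h.law_u t)).mono huψ
  have lw : ∀ t, IsGaussianVec P (w t) ψ := fun t =>
    (isGaussianVec_of_hasLaw hSw (h.law_w t)).mono hwψ
  have lη : ∀ t, IsGaussianVec P (η t) ψ := fun t =>
    (isGaussianVec_of_hasLaw hSη (h.law_η t)).mono hηψ
  have lB : ∀ t, IsGaussianVec P (fun ω => Matrix.toEuclideanLin B (u t ω)) ψ := fun t =>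
    ((isGaussianVec_of_hasLaw hSu (h.law_u t)).toEuclideanLin (norm_nonneg _) B).mono hBψ
  have iu := innovations_of_noise hu hw hη h 0 (g := u)
    (fun t => measurable_u_noiseSigma rfl) lu
  have iB := innovations_of_noise hu hw hη h 0 (g := fun t ω => Matrix.toEuclideanLin B (u t ω))
    (fun t => (measurable_toEuclideanLin B).comp (measurable_u_noiseSigma rfl)) lB
  have iw := innovations_of_noise hu hw hη h 1 (g := w)
    (fun t => measurable_w_noiseSigma rfl) lw
  have iη := innovations_of_noise hu hw hη h 2 (g := η)
    (fun t => measurable_η_noiseSigma rfl) lη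
  -- Measurability of the predictable factors.
  set x : ℕ → Ω → EuclideanSpace ℝ (Fin n) := fun j ω =>
    state A B (fun i => u i ω) (fun i => w i ω) j with hxdef
  have mu : ∀ {S : Set (ℕ × Fin 3)} {t : ℕ}, (t, 0) ∈ S → Measurable[noiseSigma u w η S] (u t) :=
    measurable_u_noiseSigma
  have mx : ∀ {S : Set (ℕ × Fin 3)} {t : ℕ}, (∀ i < t, (i, 0) ∈ S ∧ (i, 1) ∈ S) →
      Measurable[noiseSigma u w η S] (x t) := fun hS => measurable_state_zero hS
  have my : ∀ {S : Set (ℕ × Fin 3)} {t : ℕ}, (∀ i < t, (i, 0) ∈ S ∧ (i, 1) ∈ S) → (t, 2) ∈ S →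
      Measurable[noiseSigma u w η S] (fun ω => x t ω + η t ω) := fun hS ht =>
    (mx hS).add (measurable_η_noiseSigma ht)
  have ms : ∀ {S : Set (ℕ × Fin 3)} {t : ℕ}, (∀ i < t, (i, 0) ∈ S ∧ (i, 1) ∈ S) → (t + 1, 0) ∈ S →
      Measurable[noiseSigma u w η S] (fun ω => stack (x t ω) (u (t + 1) ω)) := fun hS ht =>
    measurable_stack (mx hS) (mu ht)
  have mι : ∀ {S : Set (ℕ × Fin 3)} {t : ℕ}, (∀ i < t, (i, 0) ∈ S ∧ (i, 1) ∈ S) → (t, 2) ∈ S →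
      (t + 1, 0) ∈ S →
      Measurable[noiseSigma u w η S] (fun ω => stack (x t ω + η t ω) (u (t + 1) ω)) :=
    fun hS ht ht' => measurable_stack (my hS ht) (mu ht')
  -- Predictability has two cases: noise of the driving kind must lie in the past, noise of another
  -- kind is always known.
  have hmem : ∀ {k : Fin 3} {t i : ℕ} {k' : Fin 3}, (k' = k → i < t) →
    ((i, k') : ℕ × Fin 3) ∈ beforeSet k t := fun h => h
  have hne : ∀ {k : Fin 3} {t i : ℕ} {k' : Fin 3}, k' ≠ k →
    ((i, k') : ℕ × Fin 3) ∈ beforeSet k t := fun h h' => absurd h' h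
  have hd1 : ((Fintype.card (Fin n) : ℕ) : ℝ) ≤ (n : ℝ) + m := by rw [hcn]; linarith
  have hd2 : ((Fintype.card (Fin m) : ℕ) : ℝ) ≤ (n : ℝ) + m := by rw [hcm]; linarith
  have hKd : 9 * ψ * (2 * Fintype.card (Fin n) * Real.log (10 * Fintype.card (Fin n)) +
      2 * Real.log (1 / δ) + Fintype.card (Fin n ⊕ Fin m) *
        Real.log (1 + L / (Fintype.card (Fin n ⊕ Fin m) * lam))) ≤ K := by
    rw [hcn, hcd]; exact hK
  -- The events.
  have t₁ := measure_sum_norm_sq_not_le hcn0 hσ hδ hx hT0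
  have t₂ := measure_sum_norm_sq_not_le hcn0 hψ hδ lη hT0
  have t₃ := measure_sum_norm_sq_not_le hcm0 hψ hδ lu hT0
  have t₄ := measure_sum_norm_sq_not_le hcn0 hψ hδ lB hT0
  have eG := measure_gram_lower_le hu hw hη h hSu hSw hn hV₀ hφ hV₀φ hR hJ hε hε1 hlamJ hεL
  replace eG : P {ω | ¬ (∑ j ∈ Finset.range N, ‖stack (x j ω) (u (j + 1) ω)‖ ^ 2 ≤ L →
      ∀ θ : EuclideanSpace ℝ (Fin n ⊕ Fin m), lam * ‖θ‖ ^ 2 ≤ ∑ j ∈ Finset.range N,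
        (inner ℝ (stack (x j ω) (u (j + 1) ω)) θ) ^ 2)} ≤ ENNReal.ofReal δ := by
    refine le_trans (measure_mono ?_) (eG.trans (ENNReal.ofReal_le_ofReal hsmall))
    intro ω hω
    exact Classical.not_imp.1 hω
  have eη := measure_empirical_cov_gt_le hcn0 iη hψ hδ hδ1 N
  have c₁ := measure_crossTerm_gt_le iη hψ (a := fun t ω => stack (x t ω) (u (t + 1) ω))
    (fun t => ms (fun i _ => ⟨hne (by decide), hne (by decide)⟩) (hne (by decide)))
    hL hδ hδ1 hcn0 hcd0 hd1 hc0 hc N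
  have c₂ := measure_crossTerm_gt_le iB hψ (a := fun t ω => x t ω + η t ω)
    (fun t => my (fun i hi => ⟨hmem (fun _ => hi), hne (by decide)⟩) (hne (by decide)))
    hL hδ hδ1 hcn0 hcn0 hd1 hc0 hc N
  -- Both factors are inputs; the later one is the innovation and the earlier one is predictable.
  have c₃ := measure_crossTerm_gt_le (iu.shift 1) hψ
    (a := fun t ω => Matrix.toEuclideanLin B (u t ω))
    (fun t => (measurable_toEuclideanLin B).comp (mu (hmem fun _ => Nat.lt_succ_self t)))
    hL hδ hδ1 hcm0 hcn0 hd2 hc0 hc N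
  have c₄ := measure_crossTerm_gt_le iw hψ
    (a := fun t ω => stack (x t ω + η t ω) (u (t + 1) ω))
    (fun t => mι (fun i hi => ⟨hne (by decide), hmem (fun _ => hi)⟩) (hne (by decide))
      (hne (by decide))) hL hδ hδ1 hcn0 hcd0 hd1 hc0 hc N
  have c₅ := measure_crossTerm_gt_le (iη.shift 1) hψ
    (a := fun t ω => stack (x t ω + η t ω) (u (t + 1) ω))
    (fun t => mι (fun i hi => ⟨hne (by decide), hne (by decide)⟩)
      (hmem fun _ => Nat.lt_succ_self t) (hne (by decide))) hL hδ hδ1 hcn0 hcd0 hd1 hc0 hc N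
  have v₁ := measure_noiseTerm_gt_le (iw.shift 1) hψ
    (a := fun t ω => stack (x t ω + η t ω) (u (t + 1) ω))
    (fun t => mι (fun i hi => ⟨hne (by decide), hmem (fun _ => by omega)⟩) (hne (by decide))
      (hne (by decide))) hlam hL.le hδ hδ1 hcn0 hcd0 hKd N
  have v₂ := measure_noiseTerm_gt_le (iη.shift 2) hψ
    (a := fun t ω => stack (x t ω + η t ω) (u (t + 1) ω))
    (fun t => mι (fun i hi => ⟨hne (by decide), hne (by decide)⟩)
      (hmem fun _ => by omega) (hne (by decide))) hlam hL.le hδ hδ1 hcn0 hcd0 hKd N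
  have v₃ := measure_noiseTerm_gt_le (iη.shift 1) hψ
    (a := fun t ω => stack (x t ω + η t ω) (u (t + 1) ω))
    (fun t => mι (fun i hi => ⟨hne (by decide), hne (by decide)⟩)
      (hmem fun _ => Nat.lt_succ_self t) (hne (by decide))) hlam hL.le hδ hδ1 hcn0 hcd0 hKd N
  have hδ0 := hδ.le
  -- Fourteen events: four energies, the Gram lower bound, the covariance of η, five cross terms and
  -- three noise terms. The conditional ones have the form "energy at most L implies the bound" and
  -- are discharged by the energy events.
  have hall := measure_not_and_le hδ0 (by positivity) t₁ <|
    measure_not_and_le hδ0 (by positivity) t₂ <| measure_not_and_le hδ0 (by positivity) t₃ <|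
    measure_not_and_le hδ0 (by positivity) t₄ <| measure_not_and_le hδ0 (by positivity) eG <|
    measure_not_and_le hδ0 (by positivity) eη <| measure_not_and_le hδ0 (by positivity) c₁ <|
    measure_not_and_le hδ0 (by positivity) c₂ <| measure_not_and_le hδ0 (by positivity) c₃ <|
    measure_not_and_le hδ0 (by positivity) c₄ <| measure_not_and_le hδ0 (by positivity) c₅ <|
    measure_not_and_le hδ0 (by positivity) v₁ <| measure_not_and_le hδ0 hδ0 v₂ v₃
  refine le_trans (measure_mono ?_) (hall.trans (ENNReal.ofReal_le_ofReal (by linarith)))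
  intro ω hω hcon
  refine hω ?_
  obtain ⟨t₁, t₂, t₃, t₄, eG, eη, c₁, c₂, c₃, c₄, c₅, v₁, v₂, v₃⟩ := hcon
  rw [hcn] at t₁ t₂ t₄ eη
  rw [hcm] at t₃
  set ℓ := Real.log (2 / δ) with hℓdef
  have hTψ : 0 ≤ T * ψ * ℓ := by positivity
  have hTψσ : T * ψ * ℓ ≤ T * σ * ℓ := by gcongr
  have bx : ∑ j ∈ Finset.range N, ‖x j ω‖ ^ 2 ≤ 4 * n * (T * σ * ℓ) := by
    have := sum_norm_sq_le_succ (fun j => x j ω) N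
    rw [← hT] at this
    linarith
  have bη : ∑ j ∈ Finset.range N, ‖η j ω‖ ^ 2 ≤ 4 * n * (T * σ * ℓ) := by
    have := sum_norm_sq_le_succ (fun j => η j ω) N
    rw [← hT] at this
    have : (4 * n : ℝ) * (T * ψ * ℓ) ≤ 4 * n * (T * σ * ℓ) := by gcongr
    linarith
  have bu : ∑ j ∈ Finset.range N, ‖u (j + 1) ω‖ ^ 2 ≤ 4 * m * (T * σ * ℓ) := by
    have := sum_norm_sq_succ_le (fun j => u j ω) N
    rw [← hT] at this
    have : (4 * m : ℝ) * (T * ψ * ℓ) ≤ 4 * m * (T * σ * ℓ) := by gcongr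
    linarith
  have bB : ∑ j ∈ Finset.range N, ‖Matrix.toEuclideanLin B (u j ω)‖ ^ 2 ≤
      4 * n * (T * σ * ℓ) := by
    have := sum_norm_sq_le_succ (fun j => Matrix.toEuclideanLin B (u j ω)) N
    rw [← hT] at this
    have : (4 * n : ℝ) * (T * ψ * ℓ) ≤ 4 * n * (T * σ * ℓ) := by gcongr
    linarith
  have hn0 : 0 ≤ n * (T * σ * ℓ) := by positivity
  have hm0 : 0 ≤ m * (T * σ * ℓ) := by positivity
  have hsum_y : ∑ j ∈ Finset.range N, ‖x j ω + η j ω‖ ^ 2 ≤ 16 * n * (T * σ * ℓ) := by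
    calc _ ≤ ∑ j ∈ Finset.range N, (2 * ‖x j ω‖ ^ 2 + 2 * ‖η j ω‖ ^ 2) := by
          refine Finset.sum_le_sum fun j _ => ?_
          have h1 := norm_add_le (x j ω) (η j ω)
          have h2 : ‖x j ω + η j ω‖ ^ 2 ≤ (‖x j ω‖ + ‖η j ω‖) ^ 2 := by gcongr
          nlinarith [sq_nonneg (‖x j ω‖ - ‖η j ω‖)]
      _ ≤ _ := by
          rw [Finset.sum_add_distrib, ← Finset.mul_sum, ← Finset.mul_sum]
          linarith
  have hLeq : L = 16 * (n * (T * σ * ℓ)) + 16 * (m * (T * σ * ℓ)) := by rw [hLdef]; ring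
  have hsum_s : ∑ j ∈ Finset.range N, ‖stack (x j ω) (u (j + 1) ω)‖ ^ 2 ≤ L := by
    simp only [norm_sq_stack, Finset.sum_add_distrib]
    linarith
  have hsum_ι : ∑ j ∈ Finset.range N, ‖stack (x j ω + η j ω) (u (j + 1) ω)‖ ^ 2 ≤ L := by
    simp only [norm_sq_stack, Finset.sum_add_distrib]
    linarith
  have hTN : T - 1 = N := by omega
  refine iv_error_le (x := fun t => x t ω) (w := fun t => w t ω) (η := fun t => η t ω)
    (fun t => rfl) (fun t => rfl) hψA1 hψA hφA hφA1 hA hlam hc0 hcle hH0 hK0 ?_ ?_ ?_ ?_ ?_ ?_ ?_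
    ?_ ?_ ?_
  all_goals rw [hTN]
  · exact eG hsum_s
  · intro q
    refine (eη q).trans ?_
    gcongr
  · exact c₁ hsum_s
  · exact c₂ (by linarith)
  · exact c₃ (by linarith)
  · exact c₄ hsum_ι
  · exact c₅ hsum_ι
  · exact v₁ hsum_ι
  · exact v₂ hsum_ι
  · exact v₃ hsum_ι

end Main

/-! ### Numerical consequences of the sample-size requirement. -/

section Thresholds

lemma log_four_div_bounds {δ : ℝ} (hδ0 : 0 < δ) (hδ1 : δ < 1) : 1 ≤ Real.log (4 / δ) := by
  rw [Real.le_log_iff_exp_le (by positivity)]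
  have h1 := Real.exp_one_lt_d9
  have h2 : (4 : ℝ) ≤ 4 / δ := by
    rw [le_div_iff₀ hδ0]
    linarith
  linarith

lemma log_horizon_bounds {n m ψ ψA r δ : ℝ} (hn : 1 ≤ n) (hm : 1 ≤ m) (hψ : 2 ≤ ψ) (hψA : 1 ≤ ψA)
    (hr0 : 0 < r) (hr1 : r ≤ 1) (hδ0 : 0 < δ) (hδ1 : δ < 1) :
    Real.log (4 / δ) ≤ Real.log (9 * n / δ) ∧ 1 ≤ Real.log (9 * n / δ) ∧
      Real.log (9 * n / δ) ≤
        Real.log (9 * (ψ * ψA ^ 4 / (r * δ)) * (m + n) * Real.log (9 * n / δ)) ∧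
      Real.log (10 * (n + m)) ≤
        Real.log (9 * (ψ * ψA ^ 4 / (r * δ)) * (m + n) * Real.log (9 * n / δ)) := by
  have h0 : Real.log (4 / δ) ≤ Real.log (9 * n / δ) := by
    refine Real.log_le_log (by positivity) ?_
    gcongr
    linarith
  have h1 : 1 ≤ Real.log (9 * n / δ) := (log_four_div_bounds hδ0 hδ1).trans h0
  have h2 : 2 / δ ≤ ψ * ψA ^ 4 / (r * δ) := by
    have h3 : 1 ≤ ψA ^ 4 := one_le_pow₀ hψA
    rw [div_le_div_iff₀ hδ0 (by positivity)]
    calc 2 * (r * δ) ≤ 2 * (1 * δ) := by gcongr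
      _ ≤ (ψ * 1) * δ := by nlinarith
      _ ≤ _ := by gcongr
  have h3 : 2 ≤ ψ * ψA ^ 4 / (r * δ) := by
    refine le_trans ?_ h2
    rw [le_div_iff₀ hδ0]
    linarith
  refine ⟨h0, h1, Real.log_le_log (by positivity) ?_, Real.log_le_log (by positivity) ?_⟩
  · calc 9 * n / δ = 9 * (1 / δ) * n * 1 := by ring
      _ ≤ 9 * (2 / δ) * (m + n) * Real.log (9 * n / δ) := by gcongr <;> linarith
      _ ≤ _ := by gcongr
  · calc 10 * (n + m) ≤ 9 * 2 * (m + n) * 1 := by linarith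
      _ ≤ _ := by gcongr

set_option maxHeartbeats 1000000 in
/-- The sample-size requirement implies all the thresholds used in the error analysis. -/
lemma sample_size_bounds {n m ψ ψA r V₀ a δ T : ℝ} (hn : 1 ≤ n) (hm : 1 ≤ m) (hψ : 2 ≤ ψ)
    (hψA : 1 ≤ ψA) (hr0 : 0 < r) (hr1 : r ≤ 1) (hV₀ : 0 < V₀) (hVψ : V₀ ≤ ψ) (ha0 : 0 < a)
    (ha1 : a ≤ 1) (hδ0 : 0 < δ) (hδ1 : δ < 1)
    (hT : 2 * 10 ^ 10 * (ψ ^ 2 * ψA ^ 4 / (V₀ ^ 2 * r) * Real.log (9 * n / δ) *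
      Real.log (9 * (ψ * ψA ^ 4 / (r * δ)) * (m + n) * Real.log (9 * n / δ)) / a ^ 2) * n *
        (m + n) ^ 2 ≤ T) {L lam : ℝ}
    (hL : L = 16 * T * (n + m) * (2 * ψ * ψA ^ 2 / r) * Real.log (4 / δ))
    (hlam : lam = T * V₀ / 256) :
    4 * n + 4 ≤ T ∧ 9 * ψ * (2 * T + 4 * n * Real.log (10 * n) + 4 * Real.log (4 / δ)) ≤
      72 * T * ψ ∧
    100 * ψA ^ 2 * (9 * ψ * (2 * (n + m) * Real.log (10 * (n + m)) + 2 * Real.log (4 / δ) + 1) *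
      (2 * L)) ≤ a ^ 2 * lam ^ 2 ∧
    (n + m) * Real.log (5 * (n + m) * (L / lam)) + Real.log (4 / δ) ≤ T / (12 * n) ∧
    4 * lam ≤ L := by
  obtain ⟨h1, h2, h3, h4⟩ := log_horizon_bounds hn hm hψ hψA hr0 hr1 hδ0 hδ1
  have hℓ1 := log_four_div_bounds hδ0 hδ1
  set ℓ := Real.log (4 / δ)
  set ℓ₁ := Real.log (9 * n / δ)
  set ℓ₂ := Real.log (9 * (ψ * ψA ^ 4 / (r * δ)) * (m + n) * ℓ₁)
  set d := n + m with hd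
  rw [show m + n = d by rw [hd]; ring] at hT
  have hd2 : 2 ≤ d := by linarith
  have hn0 : 0 < n := by linarith
  have hd0 : 0 < d := by linarith
  have hψ0 : 0 < ψ := by linarith
  have hψA0 : 0 < ψA := by linarith
  have hℓ0 : 0 < ℓ := by linarith
  have hℓ₁0 : 0 < ℓ₁ := by linarith
  have hℓ₂0 : 0 < ℓ₂ := by linarith
  have hnd : n ≤ d := by linarith
  -- The leading factor of κ₂ is X = t² / r, and t / r is the scale of L / lam.
  set t := ψ * ψA ^ 2 / V₀ with ht
  have ht1 : 1 ≤ t := by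
    rw [ht, le_div_iff₀ hV₀]
    nlinarith [one_le_pow₀ hψA (n := 2)]
  set X := t ^ 2 / r with hX
  have hX1 : t / r ≤ X := by
    rw [hX]
    gcongr
    nlinarith
  have hXr : 1 ≤ t / r := by
    rw [le_div_iff₀ hr0]
    linarith
  have hX0 : 1 ≤ X := hXr.trans hX1
  have hX00 : 0 < X := by linarith
  have ht0 : 0 < t := by linarith
  have hT1 : 2 * 10 ^ 10 * (X * ℓ₁ * ℓ₂ * n * d ^ 2) ≤ T * a ^ 2 := by
    have : ψ ^ 2 * ψA ^ 4 / (V₀ ^ 2 * r) = X := by rw [hX, ht]; field_simp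
    rw [this] at hT
    calc _ = 2 * 10 ^ 10 * (X * ℓ₁ * ℓ₂ / a ^ 2) * n * d ^ 2 * a ^ 2 := by field_simp
      _ ≤ _ := by gcongr
  have hG1 : 0 < X * ℓ₁ * ℓ₂ * n * d ^ 2 := by positivity
  have hT0 : 0 < T := by
    by_contra hcon
    have : T * a ^ 2 ≤ 0 := mul_nonpos_of_nonpos_of_nonneg (not_lt.1 hcon) (by positivity)
    linarith
  have hT2 : 2 * 10 ^ 10 * (X * ℓ₁ * ℓ₂ * n * d ^ 2) ≤ T := by
    refine hT1.trans (mul_le_of_le_one_right hT0.le (pow_le_one₀ ha0.le ha1))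
  have hT3 : 2 * 10 ^ 10 * (n * (X * ℓ₁ * d ^ 2)) ≤ T := by
    refine le_trans ?_ hT2
    calc _ = 2 * 10 ^ 10 * (X * ℓ₁ * 1 * n * d ^ 2) := by ring
      _ ≤ _ := by gcongr; linarith
  have hXl : 1 ≤ X * ℓ₁ := one_le_mul_of_one_le_of_one_le hX0 h2
  have hQd : d ^ 2 ≤ X * ℓ₁ * d ^ 2 := le_mul_of_one_le_left (by positivity) hXl
  have hQl : ℓ₁ ≤ X * ℓ₁ * d ^ 2 := by
    calc ℓ₁ = 1 * ℓ₁ * 1 := by ring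
      _ ≤ _ := by gcongr; nlinarith
  have hQ0 : 0 < X * ℓ₁ * d ^ 2 := by positivity
  have hT4 : 2 * 10 ^ 10 * (X * ℓ₁ * d ^ 2) ≤ T := by
    refine le_trans ?_ hT3
    have : X * ℓ₁ * d ^ 2 ≤ n * (X * ℓ₁ * d ^ 2) := le_mul_of_one_le_left hQ0.le hn
    linarith
  have hlogle : ∀ z : ℝ, 0 < z → Real.log z ≤ z := fun z hz => by
    have := Real.log_le_sub_one_of_pos hz
    linarith
  have hL0 : 0 < L := by rw [hL]; positivity
  have hlam0 : 0 < lam := by rw [hlam]; positivity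
  have hratio : L / lam = 4096 * d * (2 * (t / r) * ℓ) := by
    rw [hL, hlam, ht]
    field_simp
    norm_num
  have hprod : 1 ≤ t / r * ℓ := one_le_mul_of_one_le_of_one_le hXr hℓ1
  refine ⟨?_, ?_, ?_, ?_, ?_⟩
  · have h5 : n * 1 ≤ n * (X * ℓ₁ * d ^ 2) := by
      gcongr
      exact h2.trans hQl
    linarith
  · have h5 : n * Real.log (10 * n) ≤ 10 * (X * ℓ₁ * d ^ 2) := by
      calc n * Real.log (10 * n) ≤ d * (10 * d) :=
            mul_le_mul hnd ((hlogle _ (by positivity)).trans (by linarith))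
              (Real.log_nonneg (by linarith)) hd0.le
        _ = 10 * d ^ 2 := by ring
        _ ≤ _ := by gcongr
    have : 2 * T + 4 * n * Real.log (10 * n) + 4 * ℓ ≤ 8 * T := by linarith
    calc _ ≤ 9 * ψ * (8 * T) := by gcongr
      _ = _ := by ring
  · have h5 : 2 * d * Real.log (10 * d) + 2 * ℓ + 1 ≤ 5 * d * ℓ₂ := by
      have e1 : d * Real.log (10 * d) ≤ d * ℓ₂ := by gcongr
      have e2 : ℓ₂ ≤ d * ℓ₂ := le_mul_of_one_le_left (by linarith) (by linarith)
      linarith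
    have h6 : 100 * ψA ^ 2 * (9 * ψ * (2 * d * Real.log (10 * d) + 2 * ℓ + 1) * (2 * L)) ≤
        100 * ψA ^ 2 * (9 * ψ * (5 * d * ℓ₂) *
          (2 * (16 * T * d * (2 * ψ * ψA ^ 2 / r) * ℓ₁))) := by
      rw [hL]
      gcongr
    refine h6.trans ?_
    -- The cross terms are the only threshold that uses a² and ℓ₂. The product 288000 · 256² is just
    -- below 2 · 10¹⁰, which is where c₂ comes from.
    have h7 : 100 * ψA ^ 2 * (9 * ψ * (5 * d * ℓ₂) *
          (2 * (16 * T * d * (2 * ψ * ψA ^ 2 / r) * ℓ₁))) =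
        288000 * (X * ℓ₁ * ℓ₂ * 1 * d ^ 2) * (V₀ ^ 2 * T) := by
      rw [hX, ht]
      field_simp
      ring
    rw [h7]
    calc _ ≤ 288000 * (X * ℓ₁ * ℓ₂ * n * d ^ 2) * (V₀ ^ 2 * T) := by gcongr
      _ ≤ (T * a ^ 2 / 65536) * (V₀ ^ 2 * T) := by
          gcongr
          linarith
      _ = _ := by rw [hlam]; ring
  · rw [le_div_iff₀ (by positivity), hratio]
    -- The crude bound log z ≤ z is affordable because T exceeds n X ℓ₁ d² by a large constant.
    have h5 : Real.log (5 * d * (4096 * d * (2 * (t / r) * ℓ))) ≤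
        5 * d + (9 + (d + 2 * (X * ℓ₁))) := by
      rw [mul_assoc 4096, Real.log_mul (x := 5 * d) (by positivity) (by positivity),
        Real.log_mul (x := 4096) (by positivity) (by positivity),
        Real.log_mul (x := d) (by positivity) (by positivity)]
      have e1 : Real.log 4096 ≤ 9 := by
        rw [show (4096 : ℝ) = 2 ^ 12 by norm_num, Real.log_pow]
        have := Real.log_two_lt_d9
        push_cast
        linarith
      have e2 := hlogle (5 * d) (by positivity)
      have e3 := hlogle d (by positivity)
      have e4 := hlogle (2 * (t / r) * ℓ) (by positivity)
      have e5 : t / r * ℓ ≤ X * ℓ₁ := by gcongr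
      linarith
    have h6 : d * Real.log (5 * d * (4096 * d * (2 * (t / r) * ℓ))) ≤
        18 * (X * ℓ₁ * d ^ 2) := by
      have e1 : d ≤ d ^ 2 := by nlinarith
      have e2 : X * ℓ₁ * d ≤ X * ℓ₁ * d ^ 2 := by gcongr
      calc _ ≤ d * (5 * d + (9 + (d + 2 * (X * ℓ₁)))) := by gcongr
        _ = 6 * d ^ 2 + 9 * d + 2 * (X * ℓ₁ * d) := by ring
        _ ≤ _ := by linarith
    calc _ ≤ (18 * (X * ℓ₁ * d ^ 2) + X * ℓ₁ * d ^ 2) * (12 * n) := by gcongr; linarith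
      _ = 228 * (n * (X * ℓ₁ * d ^ 2)) := by ring
      _ ≤ T := by
          have := mul_pos hn0 hQ0
          linarith
  · have : 4 ≤ L / lam := by
      rw [hratio]
      nlinarith
    rwa [le_div_iff₀ hlam0] at this

/-- The error bound obtained from the thresholds, in the form of the theorem. -/
lemma error_bound_le {n m ψ ψA r φu b a δ T : ℝ} (hn : 1 ≤ n) (hm : 1 ≤ m) (hψ : 2 ≤ ψ)
    (hψA : 1 ≤ ψA) (hr0 : 0 < r) (hr1 : r ≤ 1) (hφu : 0 < φu) (hφψ : φu ≤ ψ) (hb0 : 0 < b)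
    (hb1 : b ≤ 1) (ha0 : 0 < a) (hδ0 : 0 < δ) (hδ1 : δ < 1) (hT : 0 < T) {L lam K : ℝ}
    (hL : L = 16 * T * (n + m) * (2 * ψ * ψA ^ 2 / r) * Real.log (4 / δ))
    (hlam : lam = T * (b * φu) / 256)
    (hK : K = 9 * ψ * (2 * n * Real.log (10 * n) + 2 * Real.log (4 / δ) +
      (n + m) * Real.log (1 + L / ((n + m) * lam)))) :
    6 * ψA / a * √(K * (3 / lam + 2 * (72 * T * ψ) / lam ^ 2)) ≤
      2 * 10 ^ 5 * (ψA * max (√(ψ / φu)) (ψ / φu) * √((b * φu + 1) / (b ^ 3 * φu)) *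
        √(Real.log (5 * ψ * ψA ^ 2 / (r * δ) * n * Real.log (4 / δ))) / a) *
        √((m + n) / T) := by
  have hℓ1 := log_four_div_bounds hδ0 hδ1
  set ℓ := Real.log (4 / δ) with hℓ
  set arg := 5 * ψ * ψA ^ 2 / (r * δ) * n * ℓ with harg
  set Λ := Real.log arg with hΛ
  set V := b * φu with hV
  have hV0 : 0 < V := by positivity
  have hVψ : V ≤ ψ := (mul_le_of_le_one_left hφu.le hb1).trans hφψ
  set Z := ψ * ψA ^ 2 * ℓ / r with hZ
  have hψA2 : 1 ≤ ψA ^ 2 := one_le_pow₀ hψA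
  have hψψ : 2 ≤ ψ * ψA ^ 2 := by nlinarith
  have hZ1 : 1 ≤ Z := by
    rw [hZ, le_div_iff₀ hr0]
    nlinarith
  have hδi : 1 ≤ 1 / δ := by rw [le_div_iff₀ hδ0]; linarith
  have hri : 1 ≤ 1 / r := by rw [le_div_iff₀ hr0]; linarith
  have hargZ : arg = 5 * Z * (1 / δ) * n := by rw [harg, hZ]; field_simp
  have hZle : Z ≤ arg := by
    rw [hargZ]
    calc Z = Z * 1 * 1 := by ring
      _ ≤ 5 * Z * (1 / δ) * n := by gcongr; linarith
  have hZ2 : 2 ≤ Z := by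
    rw [hZ, le_div_iff₀ hr0]
    nlinarith
  have h10n : 10 * n ≤ arg := by
    rw [hargZ]
    calc 10 * n = 5 * 2 * 1 * n := by ring
      _ ≤ _ := by gcongr
  have h4δ : 4 / δ ≤ arg := by
    rw [hargZ]
    calc 4 / δ = 4 * 1 * (1 / δ) * 1 := by ring
      _ ≤ _ := by gcongr; norm_num
  have hΛn : Real.log (10 * n) ≤ Λ := Real.log_le_log (by positivity) h10n
  have hΛℓ : ℓ ≤ Λ := Real.log_le_log (by positivity) h4δ
  have hΛZ : Real.log Z ≤ Λ := Real.log_le_log (by positivity) hZle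
  have hΛ2 : 9 / 4 ≤ Λ := by
    refine le_trans ?_ (Real.log_le_log (by norm_num) ((by linarith : (10 : ℝ) ≤ 10 * n).trans h10n))
    rw [show (10 : ℝ) = 2 ^ 3 * (5 / 4) by norm_num, Real.log_mul (by norm_num) (by norm_num),
      Real.log_pow]
    have e1 := Real.log_two_gt_d9
    have e2 := Real.one_sub_inv_le_log_of_pos (show (0 : ℝ) < 5 / 4 by norm_num)
    norm_num at e2 ⊢
    linarith
  have hd : 0 < n + m := by linarith
  have hn0 : 0 < n := by linarith
  have hψ0 : 0 < ψ := by linarith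
  have hψA0 : 0 < ψA := by linarith
  have hℓ0 : 0 < ℓ := by linarith
  have hΛ0 : 0 < Λ := by linarith
  have hlogn : 0 ≤ Real.log (10 * n) := Real.log_nonneg (by linarith)
  have hlam0 : 0 < lam := by rw [hlam]; positivity
  have hLl : L / ((n + m) * lam) = 8192 * Z / V := by
    rw [hL, hlam, hZ]
    field_simp
    norm_num
  -- The dependence on V is moved out of the logarithm as (V+1)/V; this is the source of that factor
  -- in κ₁.
  have hlogY : Real.log (1 + 8192 * Z / V) ≤ 6 * Λ * ((V + 1) / V) := by
    have e1 : 1 + 8192 * Z / V ≤ 8193 * Z * ((V + 1) / V) := by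
      rw [← sub_nonneg]
      have : 8193 * Z * ((V + 1) / V) - (1 + 8192 * Z / V) = (8193 * Z - 1) + Z / V := by
        field_simp
        ring
      rw [this]
      have : 0 ≤ Z / V := by positivity
      linarith
    have e2 : Real.log (8193 : ℝ) ≤ 10 := by
      have e3 : Real.log (8193 : ℝ) ≤ Real.log (2 ^ 14) :=
        Real.log_le_log (by norm_num) (by norm_num)
      rw [Real.log_pow] at e3
      have := Real.log_two_lt_d9
      push_cast at e3
      linarith
    have e4 : Real.log ((V + 1) / V) ≤ 1 / V := by
      have := Real.log_le_sub_one_of_pos (show 0 < (V + 1) / V by positivity)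
      refine this.trans (le_of_eq ?_)
      field_simp
      ring
    have e5 : 1 / V ≤ Λ * (1 / V) := le_mul_of_one_le_left (by positivity) (by linarith)
    calc _ ≤ Real.log (8193 * Z * ((V + 1) / V)) := Real.log_le_log (by positivity) e1
      _ = Real.log 8193 + Real.log Z + Real.log ((V + 1) / V) := by
          rw [Real.log_mul (by positivity) (by positivity),
            Real.log_mul (by positivity) (by positivity)]
      _ ≤ 6 * Λ + 6 * (Λ * (1 / V)) := by
          have : 0 ≤ Λ * (1 / V) := by positivity
          linarith
      _ = _ := by field_simp
  have hV1 : 1 ≤ (V + 1) / V := by rw [le_div_iff₀ hV0]; linarith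
  have hKle : K ≤ 90 * ψ * ((n + m) * Λ * ((V + 1) / V)) := by
    have e1 : 2 * n * Real.log (10 * n) ≤ 2 * ((n + m) * Λ * ((V + 1) / V)) := by
      calc _ = 2 * (n * Real.log (10 * n) * 1) := by ring
        _ ≤ _ := by gcongr; linarith
    have e2 : 2 * ℓ ≤ 2 * ((n + m) * Λ * ((V + 1) / V)) := by
      calc _ = 2 * (1 * ℓ * 1) := by ring
        _ ≤ _ := by gcongr; linarith
    have e3 : (n + m) * Real.log (1 + L / ((n + m) * lam)) ≤
        6 * ((n + m) * Λ * ((V + 1) / V)) := by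
      rw [hLl]
      calc _ ≤ (n + m) * (6 * Λ * ((V + 1) / V)) := by gcongr
        _ = _ := by ring
    rw [hK]
    calc _ ≤ 9 * ψ * (2 * ((n + m) * Λ * ((V + 1) / V)) + 2 * ((n + m) * Λ * ((V + 1) / V)) +
          6 * ((n + m) * Λ * ((V + 1) / V))) := by gcongr
      _ = _ := by ring
  have hsq : 3 / lam + 2 * (72 * T * ψ) / lam ^ 2 ≤ 10 ^ 7 * ψ / (T * V ^ 2) := by
    have : 3 / lam + 2 * (72 * T * ψ) / lam ^ 2 = (768 * V + 9437184 * ψ) / (T * V ^ 2) := by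
      rw [hlam]
      field_simp
      ring
    rw [this]
    gcongr
    linarith
  -- The constants are 90 · 10⁷ = 9 · 10⁸ ≤ 33000², and 6 · 33000 = 198000 ≤ 2 · 10⁵ gives c₁.
  have hinner : K * (3 / lam + 2 * (72 * T * ψ) / lam ^ 2) ≤
      (33000 ^ 2) * ((ψ / φu) ^ 2 * ((V + 1) / (b ^ 3 * φu)) * Λ * ((m + n) / T)) := by
    calc _ ≤ 90 * ψ * ((n + m) * Λ * ((V + 1) / V)) * (10 ^ 7 * ψ / (T * V ^ 2)) := by gcongr
      _ = (9 * 10 ^ 8) * ((ψ / φu) ^ 2 * ((V + 1) / (b ^ 3 * φu)) * Λ * ((m + n) / T)) := by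
          rw [hV]
          field_simp
          ring
      _ ≤ _ := by
          gcongr
          norm_num
  have hroot : √(K * (3 / lam + 2 * (72 * T * ψ) / lam ^ 2)) ≤
      33000 * (ψ / φu * √((V + 1) / (b ^ 3 * φu)) * √Λ * √((m + n) / T)) := by
    refine (Real.sqrt_le_sqrt hinner).trans (le_of_eq ?_)
    rw [Real.sqrt_mul (by positivity), Real.sqrt_sq (by norm_num),
      Real.sqrt_mul (by positivity), Real.sqrt_mul (by positivity), Real.sqrt_mul (by positivity),
      Real.sqrt_sq (by positivity)]
  calc _ ≤ 6 * ψA / a * (33000 * (ψ / φu * √((V + 1) / (b ^ 3 * φu)) * √Λ * √((m + n) / T))) := by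
        gcongr
    _ = 198000 * (ψA * (ψ / φu) * √((V + 1) / (b ^ 3 * φu)) * √Λ / a) * √((m + n) / T) := by ring
    _ ≤ _ := by
        gcongr
        · norm_num
        · exact le_max_right _ _

end Thresholds

/-! ### Consequences of stability and bounds on ψ. -/

section Stability

lemma toEuclideanLin_pow_apply {κ : Type*} [Fintype κ] [DecidableEq κ] (M : Matrix κ κ ℝ) (i : ℕ)
    (q : EuclideanSpace ℝ κ) :
    Matrix.toEuclideanLin (M ^ i) q = (Matrix.toEuclideanLin M ^ i) q := by
  induction i with
  | zero => simp
  | succ i ih => rw [pow_succ', pow_succ', toEuclideanLin_mul_apply, ih, Module.End.mul_apply]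

variable {n m : ℕ} {A : Matrix (Fin n) (Fin n) ℝ}

/-- The terms with i ≥ 1 form a geometric series. The term i = 0 is taken as ‖q‖² directly, since
the stability bound there carries 1/ρ. Each part is at most ψA²/(1-ρ²) ‖q‖², hence the factor 2. -/
lemma sum_norm_sq_pow_transpose_le {ψA ρ : ℝ} (h : IsStableWith A ψA ρ) (k : ℕ)
    (q : EuclideanSpace ℝ (Fin n)) :
    ∑ i ∈ Finset.range k, ‖(Matrix.toEuclideanLin Aᵀ ^ i) q‖ ^ 2 ≤
      2 * ψA ^ 2 / (1 - ρ ^ 2) * ‖q‖ ^ 2 := by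
  obtain ⟨h1, hρ0, hρ1, hpow⟩ := h
  have hρ2 : ρ ^ 2 < 1 := pow_lt_one₀ hρ0.le hρ1 two_ne_zero
  have hr : 0 < 1 - ρ ^ 2 := by linarith
  have hψ2 : 1 ≤ ψA ^ 2 := one_le_pow₀ h1
  rcases k with _ | k
  · simp only [Finset.range_zero, Finset.sum_empty]
    positivity
  have hstep : ∀ i, ‖(Matrix.toEuclideanLin Aᵀ ^ (i + 1)) q‖ ^ 2 ≤
      ψA ^ 2 * ‖q‖ ^ 2 * (ρ ^ 2) ^ i := by
    intro i
    have h2 := norm_toEuclideanLin_le (A ^ (i + 1))ᵀ q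
    rw [norm_transpose_eq, Matrix.transpose_pow, toEuclideanLin_pow_apply] at h2
    have h3 := hpow (i + 1)
    rw [show ((i + 1 : ℕ) : ℤ) - 1 = (i : ℤ) by push_cast; ring, zpow_natCast] at h3
    calc _ ≤ (ψA * ρ ^ i * ‖q‖) ^ 2 := by
          gcongr
          exact h2.trans (by gcongr)
      _ = _ := by ring
  rw [Finset.sum_range_succ', pow_zero]
  have hgeom : ∑ i ∈ Finset.range k, (ρ ^ 2) ^ i ≤ (1 - ρ ^ 2)⁻¹ := by
    rw [← tsum_geometric_of_lt_one (by positivity) hρ2]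
    exact (summable_geometric_of_lt_one (by positivity) hρ2).sum_le_tsum _
      (fun i _ => by positivity)
  have hinv : 1 ≤ (1 - ρ ^ 2)⁻¹ := (one_le_inv₀ hr).2 (by nlinarith [sq_nonneg ρ])
  calc _ ≤ ∑ i ∈ Finset.range k, ψA ^ 2 * ‖q‖ ^ 2 * (ρ ^ 2) ^ i + ‖q‖ ^ 2 := by
        gcongr with i
        · exact hstep i
        · simp
    _ ≤ ψA ^ 2 * ‖q‖ ^ 2 * (1 - ρ ^ 2)⁻¹ + ψA ^ 2 * ‖q‖ ^ 2 * (1 - ρ ^ 2)⁻¹ := by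
        rw [← Finset.mul_sum]
        gcongr
        calc ‖q‖ ^ 2 = 1 * ‖q‖ ^ 2 * 1 := by ring
          _ ≤ _ := by gcongr
    _ = _ := by
        rw [div_eq_mul_inv]
        ring

end Stability

lemma min_pow_one {x : ℝ} (hx : 0 ≤ x) (k : ℕ) : min (x ^ k) 1 = (min x 1) ^ k := by
  rcases le_total x 1 with h | h
  · rw [min_eq_left h, min_eq_left (pow_le_one₀ hx h)]
  · rw [min_eq_right h, min_eq_right (one_le_pow₀ h), one_pow]

lemma singVal_le_norm {m : ℕ} (hm : 0 < m) (S : Matrix (Fin m) (Fin m) ℝ) : singVal S m ≤ ‖S‖ := by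
  have h1 := singVal_mul_norm_le S (EuclideanSpace.single ⟨0, hm⟩ 1)
  have h2 := norm_toEuclideanLin_le S (EuclideanSpace.single ⟨0, hm⟩ 1)
  simp only [PiLp.norm_single, norm_one, mul_one] at h1 h2
  exact h1.trans h2

lemma psi_bounds {n m : ℕ} (B : Matrix (Fin n) (Fin m) ℝ) (Su : Matrix (Fin m) (Fin m) ℝ)
    (Sw Sη : Matrix (Fin n) (Fin n) ℝ) :
    2 ≤ psi B Su Sw Sη ∧ ‖B‖ ^ 2 * ‖Su‖ + ‖Sw‖ ≤ psi B Su Sw Sη ∧ ‖Su‖ ≤ psi B Su Sw Sη ∧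
      ‖Sη‖ ≤ psi B Su Sw Sη := by
  have hB1 : 1 ≤ (max ‖B‖ 1) ^ 2 := one_le_pow₀ (le_max_right _ _)
  have hBB : ‖B‖ ^ 2 ≤ (max ‖B‖ 1) ^ 2 := by
    gcongr
    exact le_max_left _ _
  have hu := le_max_left ‖Su‖ 1
  have hu1 := le_max_right ‖Su‖ 1
  have hw := le_max_left ‖Sw‖ 1
  have hw1 := le_max_right ‖Sw‖ 1
  have hle : (max ‖B‖ 1) ^ 2 * max ‖Su‖ 1 + max ‖Sw‖ 1 ≤ psi B Su Sw Sη := le_max_left _ _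
  have hmul : max ‖Su‖ 1 ≤ (max ‖B‖ 1) ^ 2 * max ‖Su‖ 1 :=
    le_mul_of_one_le_left (by positivity) hB1
  refine ⟨by linarith, le_trans ?_ hle, by linarith, (le_max_left _ _).trans (le_max_right _ _)⟩
  gcongr

/-! ### Replacing the noise by almost everywhere equal versions. -/

section Noise

variable {Ω : Type*} {mΩ : MeasurableSpace Ω} {P : Measure Ω} {n m : ℕ}
  {u u' : ℕ → Ω → EuclideanSpace ℝ (Fin m)} {w w' η η' : ℕ → Ω → EuclideanSpace ℝ (Fin n)}
  {Su : Matrix (Fin m) (Fin m) ℝ} {Sw Sη : Matrix (Fin n) (Fin n) ℝ}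

lemma IsGaussianNoise.congr (h : IsGaussianNoise P Su Sw Sη u w η) (hu : ∀ t, u t =ᵐ[P] u' t)
    (hw : ∀ t, w t =ᵐ[P] w' t) (hη : ∀ t, η t =ᵐ[P] η' t) :
    IsGaussianNoise P Su Sw Sη u' w' η' where
  law_u t := (h.law_u t).congr (hu t).symm
  law_w t := (h.law_w t).congr (hw t).symm
  law_η t := (h.law_η t).congr (hη t).symm
  indep_time := h.indep_time.congr fun t => by
    filter_upwards [hu t, hw t, hη t] with ω h1 h2 h3
    rw [h1, h2, h3]
  indep_u_wη t := (h.indep_u_wη t).congr (hu t) (by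
    filter_upwards [hw t, hη t] with ω h2 h3
    rw [h2, h3])
  indep_w_η t := (h.indep_w_η t).congr (hw t) (hη t)

end Noise

/-! ### Choice of the parameters. -/

section Measurable

variable {Ω : Type*} {mΩ : MeasurableSpace Ω} {P : Measure Ω} [IsProbabilityMeasure P] {n m : ℕ}
  {u : ℕ → Ω → EuclideanSpace ℝ (Fin m)} {w η : ℕ → Ω → EuclideanSpace ℝ (Fin n)}
  {Su : Matrix (Fin m) (Fin m) ℝ} {Sw Sη : Matrix (Fin n) (Fin n) ℝ}
  {A : Matrix (Fin n) (Fin n) ℝ} {B : Matrix (Fin n) (Fin m) ℝ}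

lemma isGaussianVec_state (hu : ∀ t, Measurable (u t)) (hw : ∀ t, Measurable (w t))
    (hη : ∀ t, Measurable (η t)) (h : IsGaussianNoise P Su Sw Sη u w η) (hSu : Su.PosSemidef)
    (hSw : Sw.PosSemidef) {ψ ψA ρ : ℝ} (hψ : ‖B‖ ^ 2 * ‖Su‖ + ‖Sw‖ ≤ ψ)
    (hA : IsStableWith A ψA ρ) (t : ℕ) :
    IsGaussianVec P (fun ω => state A B (fun i => u i ω) (fun i => w i ω) t)
      (2 * ψ * ψA ^ 2 / (1 - ρ ^ 2)) := by
  intro q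
  obtain ⟨v, h1, h2, -⟩ := hasLaw_inner_state hu hw hη h hSu hSw A B
    (φ := 0) (fun q => by
      have := hSu.dotProduct_mulVec_nonneg q.ofLp
      simpa using this) 0 t q
  simp only [zero_add] at h1
  refine ⟨v, h1, h2.trans ?_⟩
  have h3 := sum_norm_sq_pow_transpose_le hA t q
  have h4 : 0 ≤ ∑ i ∈ Finset.range t, ‖(Matrix.toEuclideanLin Aᵀ ^ i) q‖ ^ 2 :=
    Finset.sum_nonneg fun _ _ => by positivity
  have h5 : 0 ≤ ‖B‖ ^ 2 * ‖Su‖ + ‖Sw‖ := by positivity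
  calc _ ≤ ψ * (2 * ψA ^ 2 / (1 - ρ ^ 2) * ‖q‖ ^ 2) := by gcongr; linarith
    _ = _ := by ring

set_option maxHeartbeats 1000000 in
/-- The error bound for measurable noise. -/
lemma iv_error_bound_of_measurable (hu : ∀ t, Measurable (u t)) (hw : ∀ t, Measurable (w t))
    (hη : ∀ t, Measurable (η t)) (h : IsGaussianNoise P Su Sw Sη u w η) (hSu : Su.PosDef)
    (hSw : Sw.PosSemidef) (hSη : Sη.PosSemidef) (hn : 0 < n) (hm : 0 < m) {ψA ρA : ℝ}
    (hstable : IsStableWith A ψA ρA) (hctrb : IsControllable A B) (hA : IsUnit A)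
    {φA φR φu ψ : ℝ} (hφA : φA = singVal A n) (hφR : φR = singVal (ctrbMatrix A B) n)
    (hφu : φu = singVal Su m) (hψ : ψ = psi B Su Sw Sη) {δ : ℝ} (hδ0 : 0 < δ) (hδ1 : δ < 1)
    {T : ℕ} (hT : 2 * 10 ^ 10 * (kappa₂ n m δ ψA ρA ψ φu φR / min (φA ^ 2) 1) * n *
      ((m : ℝ) + n) ^ 2 ≤ T) :
    P {ω | ¬ (IsUnit (ivGram (obs A B (fun i => u i ω) (fun i => w i ω) (fun i => η i ω))
        (fun i => u i ω) T) ∧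
      ‖ivEstimator (obs A B (fun i => u i ω) (fun i => w i ω) (fun i => η i ω))
        (fun i => u i ω) T - Matrix.fromCols A B‖ ≤
        2 * 10 ^ 5 * (kappa₁ n δ ψA ρA ψ φu φR / min φA 1) * √(((m : ℝ) + n) / T))} ≤
      ENNReal.ofReal (7 * δ) := by
  have hφA0 : 0 < φA := by
    rw [hφA]
    exact singVal_pos A hn (by rw [Matrix.rank_of_isUnit A hA, Fintype.card_fin])
  have hφR0 : 0 < φR := by
    rw [hφR]
    exact singVal_pos _ hn hctrb
  have hφu0 : 0 < φu := by
    rw [hφu]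
    exact singVal_pos Su hm (by rw [Matrix.rank_of_isUnit Su hSu.isUnit, Fintype.card_fin])
  have hbnd := psi_bounds B Su Sw Sη
  rw [← hψ] at hbnd
  obtain ⟨hψ2, hψBw, hψu, hψη⟩ := hbnd
  have hφuψ : φu ≤ ψ := by
    rw [hφu]
    exact (singVal_le_norm hm Su).trans hψu
  have hn1 : (1 : ℝ) ≤ n := by exact_mod_cast hn
  have hm1 : (1 : ℝ) ≤ m := by exact_mod_cast hm
  obtain ⟨hψA1, hρ0, hρ1, hpow⟩ := hstable
  have hψA : ‖A‖ ≤ ψA := by simpa using hpow 1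
  have hr0 : 0 < 1 - ρA ^ 2 := by
    have := pow_lt_one₀ hρ0.le hρ1 two_ne_zero
    linarith
  have hr1 : 1 - ρA ^ 2 ≤ 1 := by nlinarith [sq_nonneg ρA]
  set a := min φA 1 with ha
  have ha0 : 0 < a := lt_min hφA0 one_pos
  have ha1 : a ≤ 1 := min_le_right _ _
  -- V₀ = b φu is the excitation per block; the truncated powers of φR in κ₁ and κ₂ are powers of b.
  set b := min (φR ^ 2) 1 with hb
  have hb0 : 0 < b := lt_min (by positivity) one_pos
  have hb1 : b ≤ 1 := min_le_right _ _
  have hb2 : min (φR ^ 4) 1 = b ^ 2 := by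
    rw [hb, ← min_pow_one (by positivity)]
    ring_nf
  have hb3 : min (φR ^ 6) 1 = b ^ 3 := by
    rw [hb, ← min_pow_one (by positivity)]
    ring_nf
  rw [min_pow_one hφA0.le, ← ha, kappa₂, hb2, ← mul_pow] at hT
  rw [kappa₁, ← hb, hb3]
  have hψ0 : 0 < ψ := by linarith
  set ℓ := Real.log (4 / δ) with hℓ
  obtain ⟨L, hL⟩ : ∃ L : ℝ, L = 16 * T * ((n : ℝ) + m) * (2 * ψ * ψA ^ 2 / (1 - ρA ^ 2)) * ℓ :=
    ⟨_, rfl⟩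
  obtain ⟨lam, hlam⟩ : ∃ lam : ℝ, lam = T * (b * φu) / 256 := ⟨_, rfl⟩
  have hV0 : 0 < b * φu := by positivity
  have hVφ : b * φu ≤ φu := mul_le_of_le_one_left hφu0.le hb1
  obtain ⟨q₁, q₂, q₃, q₄, q₅⟩ := sample_size_bounds hn1 hm1 hψ2 hψA1 hr0 hr1 hV0
    (hVφ.trans hφuψ) ha0 ha1 hδ0 hδ1 hT hL hlam
  have hTpos : (0 : ℝ) < T := by linarith
  have hTn : 4 * n + 4 ≤ T := by exact_mod_cast q₁
  have hlam0 : 0 < lam := by rw [hlam]; positivity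
  have hL0 : 0 < L := by linarith
  have hℓ1 : 1 ≤ ℓ := log_four_div_bounds hδ0 hδ1
  have hlogδ : Real.log (1 / (δ / 2)) ≤ ℓ := by
    refine Real.log_le_log (by positivity) ?_
    rw [one_div_div]
    gcongr
    norm_num
  set N := T - 1 with hN
  have hTN : T = N + 1 := by omega
  -- The number of complete blocks; T ≥ 4n + 4 ensures (n+2) J ≥ T/2.
  set J := (N - n) / (n + 2) with hJ
  have hJ1 : n + (n + 2) * J ≤ N := by
    have := Nat.div_mul_le_self (N - n) (n + 2)
    rw [← hJ, mul_comm] at this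
    omega
  have hJ2 : (T : ℝ) / 2 ≤ (n + 2) * J := by
    have h1 := Nat.lt_div_mul_add (a := N - n) (b := n + 2) (by omega)
    rw [← hJ, mul_comm] at h1
    have h2 : T ≤ 2 * ((n + 2) * J) := by omega
    have h3 : (T : ℝ) ≤ 2 * ((n + 2) * J) := by exact_mod_cast h2
    linarith
  have hJ3 : (T : ℝ) / (12 * n) ≤ J / 2 := by
    rw [div_le_iff₀ (by positivity)]
    have : ((n : ℝ) + 2) * J ≤ (3 * n) * J := by gcongr; linarith
    linarith
  have hratio : lam / L ≤ 1 / 4 := by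
    rw [div_le_iff₀ hL0]
    linarith
  -- The coarsest mesh with ε² L ≤ lam.
  set ε := √(lam / L) with hε
  have hε0 : 0 < ε := Real.sqrt_pos.2 (by positivity)
  have hεsq : ε ^ 2 = lam / L := Real.sq_sqrt (by positivity)
  have hε1 : ε ≤ 1 / 2 := by
    refine le_of_sq_le_sq ?_ (by norm_num)
    rw [hεsq]
    linarith
  have hεL : ε ^ 2 * L ≤ lam := by
    rw [hεsq, div_mul_cancel₀ _ hL0.ne']
  have hsmall : (5 * ((n : ℝ) + m) / ε) ^ (n + m) * Real.exp (-(J / 2)) ≤ δ / 2 := by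
    have h1 : 5 * ((n : ℝ) + m) / ε ≤ 5 * ((n : ℝ) + m) * (L / lam) := by
      rw [div_eq_mul_inv]
      gcongr
      rw [← inv_div, ← hεsq]
      gcongr
      nlinarith
    have h2 : 0 < 5 * ((n : ℝ) + m) * (L / lam) := by positivity
    have h3 : (5 * ((n : ℝ) + m) * (L / lam)) ^ (n + m) =
        Real.exp (((n : ℝ) + m) * Real.log (5 * ((n : ℝ) + m) * (L / lam))) := by
      rw [← Real.exp_log (pow_pos h2 (n + m)), Real.log_pow]
      push_cast
      rfl
    calc _ ≤ (5 * ((n : ℝ) + m) * (L / lam)) ^ (n + m) * Real.exp (-(J / 2)) := by gcongr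
      _ = Real.exp (((n : ℝ) + m) * Real.log (5 * ((n : ℝ) + m) * (L / lam)) - J / 2) := by
          rw [h3, ← Real.exp_add, sub_eq_add_neg]
      _ ≤ Real.exp (-ℓ) := by
          gcongr
          linarith
      _ = δ / 4 := by
          rw [Real.exp_neg, hℓ, Real.exp_log (by positivity), inv_div]
      _ ≤ _ := by linarith
  set KC := 9 * ψ * (2 * ((n : ℝ) + m) * Real.log (10 * ((n : ℝ) + m)) + 2 * ℓ + 1) * (2 * L)
    with hKC
  have hKC0 : 0 ≤ KC := by
    have : 0 ≤ Real.log (10 * ((n : ℝ) + m)) := Real.log_nonneg (by linarith)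
    positivity
  set K := 9 * ψ * (2 * (n : ℝ) * Real.log (10 * n) + 2 * ℓ +
    ((n : ℝ) + m) * Real.log (1 + L / (((n : ℝ) + m) * lam))) with hK
  have hσ : ψ ≤ 2 * ψ * ψA ^ 2 / (1 - ρA ^ 2) := by
    rw [le_div_iff₀ hr0]
    have h1 : 1 ≤ ψA ^ 2 := one_le_pow₀ hψA1
    calc ψ * (1 - ρA ^ 2) ≤ ψ * 1 := by gcongr
      _ ≤ ψ * ψA ^ 2 := by gcongr
      _ ≤ 2 * ψ * ψA ^ 2 := by
          have : 0 ≤ ψ * ψA ^ 2 := by positivity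
          linarith
  have hquad : ∀ q : EuclideanSpace ℝ (Fin m), φu * ‖q‖ ^ 2 ≤ q.ofLp ⬝ᵥ Su *ᵥ q.ofLp := by
    intro q
    rw [hφu]
    exact singVal_mul_norm_sq_le_quadForm hSu.posSemidef q
  have hR : ∀ q : EuclideanSpace ℝ (Fin n), b * φu * ‖q‖ ^ 2 ≤ φu * ∑ i ∈ Finset.range n,
      ‖Matrix.toEuclideanLin Bᵀ ((Matrix.toEuclideanLin Aᵀ ^ i) q)‖ ^ 2 := by
    intro q
    have h1 := singVal_ctrbMatrix_sq_mul_le A B hn q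
    rw [← hφR] at h1
    have h2 : b ≤ φR ^ 2 := min_le_left _ _
    calc b * φu * ‖q‖ ^ 2 = φu * (b * ‖q‖ ^ 2) := by ring
      _ ≤ φu * (φR ^ 2 * ‖q‖ ^ 2) := by gcongr
      _ ≤ _ := by gcongr
  have hAlow : ∀ v : EuclideanSpace ℝ (Fin n), a * ‖v‖ ≤ ‖Matrix.toEuclideanLin A v‖ := by
    intro v
    refine le_trans ?_ (singVal_mul_norm_le A v)
    rw [← hφA]
    gcongr
    exact min_le_left _ _
  have hNT : (N : ℝ) ≤ T := by exact_mod_cast Nat.sub_le T 1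
  have hnB : 0 ≤ ‖B‖ ^ 2 * ‖Su‖ := by positivity
  have hnw : 0 ≤ ‖Sw‖ := norm_nonneg _
  -- Each event gets δ/2, so log(2/(δ/2)) is the log(4/δ) of κ₁ and the total is 14 · δ/2 = 7δ.
  have key := measure_iv_error_gt_le hu hw hη h hSu.posSemidef hSw hSη hn hm hV0 hquad hVφ hR hψ0 hσ
    (by linarith) hψu (by linarith) hψη
    (isGaussianVec_state hu hw hη h hSu.posSemidef hSw hψBw ⟨hψA1, hρ0, hρ1, hpow⟩)
    hψA1 hψA ha0 ha1 hAlow (δ := δ / 2) (by positivity) (by linarith) hTN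
    (by rw [hL, show 2 / (δ / 2) = 4 / δ by field_simp; norm_num]) hlam0 hJ1
    (by
      rw [hlam]
      calc (T : ℝ) * (b * φu) / 256 = T / 2 * (b * φu) / 128 := by ring
        _ ≤ _ := by gcongr) hε0 hε1 hεL hsmall (H := 72 * T * ψ)
    (le_trans (by gcongr) q₂) (c := √KC) (Real.sqrt_nonneg _)
    (by
      rw [Real.sq_sqrt hKC0, hKC]
      gcongr)
    (by
      have h1 : 10 * ψA * √KC ≤ a * lam := by
        refine le_of_sq_le_sq ?_ (by positivity)
        rw [mul_pow, mul_pow, mul_pow, Real.sq_sqrt hKC0]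
        refine le_trans (le_of_eq ?_) q₃
        ring
      linarith)
    (K := K)
    (by
      rw [hK]
      gcongr)
  rw [show 14 * (δ / 2) = 7 * δ by ring] at key
  refine le_trans (measure_mono ?_) key
  intro ω hω hcon
  refine hω ⟨hcon.1, hcon.2.trans ?_⟩
  exact error_bound_le hn1 hm1 hψ2 hψA1 hr0 hr1 hφu0 hφuψ hb0 hb1 ha0 hδ0 hδ1 hTpos hL hlam hK

end Measurable

end NoisyLTI

/-! ### The theorem. -/

theorem theorem1 :
    ∃ c₁ c₂ : ℝ, 0 < c₁ ∧ 0 < c₂ ∧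
      ∀ (n m : ℕ) (_hn : 0 < n) (_hm : 0 < m)
        (A : Matrix (Fin n) (Fin n) ℝ) (B : Matrix (Fin n) (Fin m) ℝ)
        (Su : Matrix (Fin m) (Fin m) ℝ) (Sw Sη : Matrix (Fin n) (Fin n) ℝ)
        (_hSu : Su.PosDef) (_hSw : Sw.PosSemidef) (_hSη : Sη.PosSemidef)
        (ψA ρA : ℝ) (_hstable : NoisyLTI.IsStableWith A ψA ρA)
        (_hctrb : NoisyLTI.IsControllable A B) (_hA : IsUnit A)
        (φA φR φu ψ : ℝ) (_hφA : φA = NoisyLTI.singVal A n)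
        (_hφR : φR = NoisyLTI.singVal (NoisyLTI.ctrbMatrix A B) n)
        (_hφu : φu = NoisyLTI.singVal Su m) (_hψ : ψ = NoisyLTI.psi B Su Sw Sη)
        {Ω : Type*} [MeasurableSpace Ω] (P : Measure Ω) [IsProbabilityMeasure P]
        (u : ℕ → Ω → EuclideanSpace ℝ (Fin m)) (w η : ℕ → Ω → EuclideanSpace ℝ (Fin n))
        (_hnoise : NoisyLTI.IsGaussianNoise P Su Sw Sη u w η)
        (y : Ω → ℕ → EuclideanSpace ℝ (Fin n))
        (_hy : ∀ ω, y ω = NoisyLTI.obs A B (fun t => u t ω) (fun t => w t ω) (fun t => η t ω))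
        (δ : ℝ) (_hδ₀ : 0 < δ) (_hδ₁ : δ < 1) (T : ℕ)
        (_hT : c₂ * (NoisyLTI.kappa₂ n m δ ψA ρA ψ φu φR / min (φA ^ 2) 1) * n * ((m : ℝ) + n) ^ 2
          ≤ T),
        ENNReal.ofReal (1 - 11 * δ) ≤
          P {ω | IsUnit (NoisyLTI.ivGram (y ω) (fun t => u t ω) T) ∧
            ‖NoisyLTI.ivEstimator (y ω) (fun t => u t ω) T - Matrix.fromCols A B‖ ≤
              c₁ * (NoisyLTI.kappa₁ n δ ψA ρA ψ φu φR / min φA 1) * √(((m : ℝ) + n) / T)} := by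
  refine ⟨2 * 10 ^ 5, 2 * 10 ^ 10, by norm_num, by norm_num, ?_⟩
  intro n m hn hm A B Su Sw Sη hSu hSw hSη ψA ρA hstable hctrb hA φA φR φu ψ hφA hφR hφu hψ Ω _ P _
    u w η hnoise y hy δ hδ0 hδ1 T hT
  -- The laws give only almost everywhere measurability, so the bound is proved for measurable
  -- versions, which agree at all times outside one null set.
  have mu := fun t => (hnoise.law_u t).aemeasurable
  have mw := fun t => (hnoise.law_w t).aemeasurable
  have mη := fun t => (hnoise.law_η t).aemeasurable
  have key := NoisyLTI.iv_error_bound_of_measurable (fun t => (mu t).measurable_mk)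
    (fun t => (mw t).measurable_mk) (fun t => (mη t).measurable_mk)
    (hnoise.congr (fun t => (mu t).ae_eq_mk) (fun t => (mw t).ae_eq_mk)
      (fun t => (mη t).ae_eq_mk)) hSu hSw hSη hn hm hstable hctrb hA hφA hφR hφu hψ hδ0 hδ1 hT
  have hu := ae_all_iff.2 fun t => (mu t).ae_eq_mk
  have hw := ae_all_iff.2 fun t => (mw t).ae_eq_mk
  have hη := ae_all_iff.2 fun t => (mη t).ae_eq_mk
  have hbad : P {ω | IsUnit (NoisyLTI.ivGram (y ω) (fun t => u t ω) T) ∧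
      ‖NoisyLTI.ivEstimator (y ω) (fun t => u t ω) T - Matrix.fromCols A B‖ ≤
        2 * 10 ^ 5 * (NoisyLTI.kappa₁ n δ ψA ρA ψ φu φR / min φA 1) * √(((m : ℝ) + n) / T)}ᶜ ≤
      ENNReal.ofReal (7 * δ) := by
    refine le_trans (measure_mono_ae ?_) key
    filter_upwards [hu, hw, hη] with ω h1 h2 h3 hω hcon
    refine hω ?_
    simp only [← h1, ← h2, ← h3] at hcon
    rw [← hy] at hcon
    exact hcon
  -- Subadditivity suffices here, so the good event need not be shown measurable.
  have h1 := measure_univ_le_add_compl (μ := P)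
    {ω | IsUnit (NoisyLTI.ivGram (y ω) (fun t => u t ω) T) ∧
      ‖NoisyLTI.ivEstimator (y ω) (fun t => u t ω) T - Matrix.fromCols A B‖ ≤
        2 * 10 ^ 5 * (NoisyLTI.kappa₁ n δ ψA ρA ψ φu φR / min φA 1) * √(((m : ℝ) + n) / T)}
  rw [measure_univ] at h1
  have h2 : (1 : ENNReal) ≤ _ := h1.trans (add_le_add_right hbad _)
  calc ENNReal.ofReal (1 - 11 * δ) ≤ ENNReal.ofReal (1 - 7 * δ) :=
        ENNReal.ofReal_le_ofReal (by linarith)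
    _ = 1 - ENNReal.ofReal (7 * δ) := by
        rw [ENNReal.ofReal_sub _ (by positivity), ENNReal.ofReal_one]
    _ ≤ _ := tsub_le_iff_right.2 h2
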